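/- Let $F$ be a field of characteristic $\ne 2$ in which $-1$ is a square, let $Z$ be a unital commutative associative $F$-algebra and let $\delta$ be an $F$-linear derivation of $Z$ with $Z=Z\delta(Z)$ (i.e. the ideal generated by $\delta(Z)$ is $Z$). The Cheng–Kac Jordan superalgebra $J=JCK(Z,\delta)$ is $J=J_{\bar 0}\oplus J_{\bar 1}$ with $J_{\bar 0}=Z1\oplus Zw_1\oplus Zw_2\oplus Zw_3$ and $J_{\bar 1}=Zx\oplus Zx_1\oplus Zx_2\oplus Zx_3$ free $Z$-modules of rank $4$, with the supercommutative product determined, for $f,g\in Z$, by: $J_{\bar 0}$ is a $Z$-algebra with unit $1$, $w_1^2=w_2^2=1=-w_3^2$ and $w_iw_j=0$ for $i\neq j$; $f(gx)=(fg)x$, $f(gx_j)=(fg)x_j$, $(fw_i)(gx)=(\delta(f)g)x_i$, $(fw_i)(gx_j)=-(fg)x_{i\times j}$; $(fx)(gx)=\delta(f)g-f\delta(g)$, $(fx)(gx_j)=-(fg)w_j$, $(fx_i)(gx)=(fg)w_i$, $(fx_i)(gx_j)=0$; where $x_{1\times2}=-x_{2\times1}=x_3$, $x_{1\times3}=-x_{3\times1}=x_2$,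 $x_{3\times2}=-x_{2\times3}=x_1$, $x_{i\times i}=0$. Let $K=Z\oplus Zx$, a subalgebra of $J$. For a Jordan superalgebra $S$, let $\mathrm{Der}(S)=\mathrm{Der}(S)_{\bar 0}\oplus\mathrm{Der}(S)_{\bar 1}$ be the Lie superalgebra of its superderivations and let $\mathrm{Inder}(S)$ be the linear span of the operators $D(a,b)\colon c\mapsto a(bc)-(-1)^{|a||b|}b(ac)$, for homogeneous $a,b\in S$. Put $\overline{\mathrm{Der}}(K)=\mathrm{Der}(K)_{\bar 0}\oplus\mathrm{Inder}(K)_{\bar 1}$. For a graded Lie subalgebra $\mathfrak d$ with $\mathrm{Inder}(S)\le\mathfrak d\le\mathrm{Der}(S)$, the Tits construction $\mathcal T(S,\mathfrak d)$ is the superspace $(\mathfrak{so}_3\otimes S)\oplus\mathfrak d$, where $\mathfrak{so}_3$ is the (purely even) Lie algebra of skew-symmetric $3\times3$ matrices over $F$, with the superanticommutative bracket that extends that of $\mathfrak d$ and satisfies $[\partial,A\otimes a]=A\otimes\partial(a)$ and $[A\otimes a,B\otimes b]=[A,B]\otimes ab+\tfrac12\mathrm{tr}(AB)D(a,b)$ for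 $\partial\in\mathfrak d$, $A,B\in\mathfrak{so}_3$, $a,b\in S$; and $\mathcal T(S)=\mathcal T(S,\mathrm{Inder}(S))$. Then $\mathrm{Der}(J)$ and $\mathcal T(K,\overline{\mathrm{Der}}(K))$ are isomorphic Lie superalgebras, and $\mathrm{Inder}(J)$ and $\mathcal T(K)$ are isomorphic Lie superalgebras. -/

import Mathlib

open scoped TensorProduct

set_option linter.unusedSimpArgs false

/-- The Koszul sign `(-1)^(i j)` of two parities, as a scalar of `F`. -/
def koszul (F : Type*) [Ring F] (i j : ZMod 2) : F := (-1) ^ (i.val * j.val)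

theorem koszul_zero_left (F : Type*) [Ring F] (j : ZMod 2) : koszul F 0 j = 1 := by
  simp [koszul]

theorem koszul_zero_right (F : Type*) [Ring F] (i : ZMod 2) : koszul F i 0 = 1 := by
  simp [koszul]

theorem koszul_one_one (F : Type*) [Ring F] : koszul F 1 1 = -1 := by
  simp [koszul, ZMod.val_one]

theorem parity_cases (i : ZMod 2) : i = 0 ∨ i = 1 := by
  revert i; decide

theorem parity_one_add_one : (1 : ZMod 2) + 1 = 0 := by decide

theorem parity_sum {M : Type*} [AddCommMonoid M] (f : ZMod 2 → M) :
    ∑ i, f i = f 0 + f 1 := Fin.sum_univ_two f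

/-- A (not necessarily associative, not necessarily unital) superalgebra over `F` with underlying
vector space `A`: a decomposition `A = A_0 ⊕ A_1` and a bilinear product with
`A_i A_j ⊆ A_{i+j}`. -/
structure Superalgebra (F : Type*) (A : Type*) [Field F] [AddCommGroup A] [Module F A] where
  part : ZMod 2 → Submodule F A
  isCompl : IsCompl (part 0) (part 1)
  mul : A →ₗ[F] A →ₗ[F] A
  mul_mem : ∀ (i j : ZMod 2) (a b : A), a ∈ part i → b ∈ part j → mul a b ∈ part (i + j)

namespace Superalgebra

section General

variable {F A B : Type*} [Field F] [AddCommGroup A] [Module F A] [AddCommGroup B] [Module F B]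

theorem isCompl_part (S : Superalgebra F A) (i : ZMod 2) :
    IsCompl (S.part i) (S.part (i + 1)) := by
  rcases parity_cases i with rfl | rfl
  · exact S.isCompl
  · exact S.isCompl.symm

/-- The projection of `A` onto the homogeneous component `A_i`. -/
noncomputable def proj (S : Superalgebra F A) (i : ZMod 2) : Module.End F A :=
  (S.part i).projection (S.part (i + 1)) (S.isCompl_part i)

theorem proj_mem (S : Superalgebra F A) (i : ZMod 2) (a : A) : S.proj i a ∈ S.part i :=
  Submodule.projection_apply_mem _ _

theorem proj_of_mem (S : Superalgebra F A) {i : ZMod 2} {a : A} (ha : a ∈ S.part i) :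
    S.proj i a = a :=
  Submodule.projection_apply_of_mem_left _ ha

theorem proj_succ_of_mem (S : Superalgebra F A) {i : ZMod 2} {a : A} (ha : a ∈ S.part (i + 1)) :
    S.proj i a = 0 :=
  Submodule.projection_apply_of_mem_right _ ha

theorem proj_zero_of_mem (S : Superalgebra F A) {a : A} (ha : a ∈ S.part 1) :
    S.proj 0 a = 0 :=
  S.proj_succ_of_mem (by simpa using ha)

theorem proj_one_of_mem (S : Superalgebra F A) {a : A} (ha : a ∈ S.part 0) :
    S.proj 1 a = 0 :=
  S.proj_succ_of_mem (by simpa [parity_one_add_one] using ha)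

theorem proj_add (S : Superalgebra F A) (a : A) : S.proj 0 a + S.proj 1 a = a :=
  Submodule.projection_add_projection_eq_self _ _

theorem proj_add_eq_one (S : Superalgebra F A) : S.proj 0 + S.proj 1 = 1 :=
  LinearMap.ext S.proj_add

theorem ext_homogeneous (S : Superalgebra F A) {f g : A →ₗ[F] B}
    (h : ∀ i, ∀ a ∈ S.part i, f a = g a) : f = g := by
  ext a
  rw [← S.proj_add a, map_add, map_add, h 0 _ (S.proj_mem 0 a), h 1 _ (S.proj_mem 1 a)]

/-- The linear endomorphisms of `A` which are homogeneous of degree `i`. -/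
def endPart (S : Superalgebra F A) (i : ZMod 2) : Submodule F (Module.End F A) where
  carrier := {f | ∀ (j : ZMod 2) (a : A), a ∈ S.part j → f a ∈ S.part (i + j)}
  add_mem' hf hg j a ha := add_mem (hf j a ha) (hg j a ha)
  zero_mem' _ _ _ := zero_mem _
  smul_mem' c _ hf j a ha := Submodule.smul_mem _ c (hf j a ha)

/-- The homogeneous component of degree `i` of an endomorphism `f`:
it acts on `A_j` as `f` followed by the projection onto `A_{i+j}`. -/
noncomputable def endComp (S : Superalgebra F A) (i : ZMod 2) :
    Module.End F A →ₗ[F] Module.End F A where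
  toFun f := ∑ j, S.proj (i + j) * f * S.proj j
  map_add' f g := by simp only [mul_add, add_mul, Finset.sum_add_distrib]
  map_smul' c f := by
    simp only [mul_smul_comm, smul_mul_assoc, Finset.smul_sum, RingHom.id_apply]

theorem endComp_apply_of_mem (S : Superalgebra F A) (i j : ZMod 2) (f : Module.End F A) {a : A}
    (ha : a ∈ S.part j) : S.endComp i f a = S.proj (i + j) (f a) := by
  rcases parity_cases j with rfl | rfl
  · simp [endComp, parity_sum, S.proj_of_mem ha, S.proj_one_of_mem ha]
  · simp [endComp, parity_sum, S.proj_of_mem ha, S.proj_zero_of_mem ha]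

theorem endComp_mem (S : Superalgebra F A) (i : ZMod 2) (f : Module.End F A) :
    S.endComp i f ∈ S.endPart i := fun j a ha => by
  rw [S.endComp_apply_of_mem i j f ha]
  exact S.proj_mem _ _

theorem endComp_of_mem (S : Superalgebra F A) {i : ZMod 2} {f : Module.End F A}
    (hf : f ∈ S.endPart i) : S.endComp i f = f :=
  S.ext_homogeneous fun j a ha => by
    rw [S.endComp_apply_of_mem i j f ha, S.proj_of_mem (hf j a ha)]

theorem endComp_add (S : Superalgebra F A) (f : Module.End F A) :
    S.endComp 0 f + S.endComp 1 f = f :=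
  S.ext_homogeneous fun j a ha => by
    rw [LinearMap.add_apply, S.endComp_apply_of_mem 0 j f ha, S.endComp_apply_of_mem 1 j f ha]
    rcases parity_cases j with rfl | rfl
    · simpa using S.proj_add (f a)
    · simpa [parity_one_add_one, add_comm] using S.proj_add (f a)

theorem isCompl_endPart (S : Superalgebra F A) : IsCompl (S.endPart 0) (S.endPart 1) := by
  constructor
  · rw [Submodule.disjoint_def]
    intro f h0 h1
    refine S.ext_homogeneous fun j a ha => ?_
    have h0' := h0 j a ha
    have h1' := h1 j a ha
    rcases parity_cases j with rfl | rfl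
    · exact Submodule.disjoint_def.1 S.isCompl.disjoint _ (by simpa using h0') (by simpa using h1')
    · exact Submodule.disjoint_def.1 S.isCompl.disjoint _
        (by simpa [parity_one_add_one] using h1') (by simpa using h0')
  · rw [codisjoint_iff, eq_top_iff]
    intro f _
    rw [← S.endComp_add f]
    exact Submodule.add_mem_sup (S.endComp_mem 0 f) (S.endComp_mem 1 f)

theorem endComp_zero_of_mem (S : Superalgebra F A) {f : Module.End F A}
    (hf : f ∈ S.endPart 1) : S.endComp 0 f = 0 := by
  have h := S.endComp_add f
  rwa [S.endComp_of_mem hf, add_eq_right] at h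

theorem endComp_one_of_mem (S : Superalgebra F A) {f : Module.End F A}
    (hf : f ∈ S.endPart 0) : S.endComp 1 f = 0 := by
  have h := S.endComp_add f
  rwa [S.endComp_of_mem hf, add_eq_left] at h

/-- The supercommutator of endomorphisms: on homogeneous endomorphisms it is
`[f, g] = f g - (-1)^(|f| |g|) g f`, and it is extended bilinearly. -/
noncomputable def superComm (S : Superalgebra F A) :
    Module.End F A →ₗ[F] Module.End F A →ₗ[F] Module.End F A :=
  LinearMap.mk₂ F
    (fun f g => ∑ i, ∑ j, (S.endComp i f * S.endComp j g -
      koszul F i j • (S.endComp j g * S.endComp i f)))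
    (fun f f' g => by
      simp only [parity_sum, map_add, add_mul, mul_add, smul_add]; abel)
    (fun c f g => by
      simp only [parity_sum, map_smul, smul_mul_assoc, mul_smul_comm, smul_comm _ c,
        smul_add, smul_sub])
    (fun f g g' => by
      simp only [parity_sum, map_add, add_mul, mul_add, smul_add]; abel)
    (fun c f g => by
      simp only [parity_sum, map_smul, smul_mul_assoc, mul_smul_comm, smul_comm _ c,
        smul_add, smul_sub])

theorem superComm_of_mem (S : Superalgebra F A) {i j : ZMod 2} {f g : Module.End F A}
    (hf : f ∈ S.endPart i) (hg : g ∈ S.endPart j) :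
    S.superComm f g = f * g - koszul F i j • (g * f) := by
  rcases parity_cases i with rfl | rfl <;> rcases parity_cases j with rfl | rfl <;>
  simp [superComm, parity_sum, S.endComp_of_mem hf, S.endComp_of_mem hg,
    S.endComp_zero_of_mem, S.endComp_one_of_mem, hf, hg]

theorem mul_mem_endPart (S : Superalgebra F A) {i j : ZMod 2} {f g : Module.End F A}
    (hf : f ∈ S.endPart i) (hg : g ∈ S.endPart j) : f * g ∈ S.endPart (i + j) := fun k a ha => by
  rw [add_assoc]; exact hf _ _ (hg _ _ ha)

/-- The general linear Lie superalgebra of (the graded space underlying) a superalgebra. -/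
noncomputable def gl (S : Superalgebra F A) : Superalgebra F (Module.End F A) where
  part := S.endPart
  isCompl := S.isCompl_endPart
  mul := S.superComm
  mul_mem i j f g hf hg := by
    rw [S.superComm_of_mem hf hg]
    refine sub_mem (S.mul_mem_endPart hf hg) (Submodule.smul_mem _ _ ?_)
    rw [add_comm]
    exact S.mul_mem_endPart hg hf

/-- A graded subalgebra of a superalgebra. -/
structure Sub (S : Superalgebra F A) where
  carrier : Submodule F A
  proj_mem : ∀ (i : ZMod 2) (a : A), a ∈ carrier → S.proj i a ∈ carrier
  mul_mem : ∀ a b : A, a ∈ carrier → b ∈ carrier → S.mul a b ∈ carrier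

/-- A graded subalgebra, as a superalgebra in its own right. -/
def Sub.toSuperalgebra {S : Superalgebra F A} (T : S.Sub) : Superalgebra F T.carrier where
  part i := (S.part i).comap T.carrier.subtype
  isCompl := by
    constructor
    · rw [Submodule.disjoint_def]
      intro a h0 h1
      exact Subtype.ext (Submodule.disjoint_def.1 S.isCompl.disjoint _ h0 h1)
    · rw [codisjoint_iff, eq_top_iff]
      intro a _
      have h : a = ⟨S.proj 0 a, T.proj_mem 0 a a.2⟩ + ⟨S.proj 1 a, T.proj_mem 1 a a.2⟩ :=
        Subtype.ext (S.proj_add a).symm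
      rw [h]
      exact Submodule.add_mem_sup (S.proj_mem 0 a) (S.proj_mem 1 a)
  mul := LinearMap.mk₂ F (fun a b => ⟨S.mul a b, T.mul_mem a b a.2 b.2⟩)
    (fun _ _ _ => Subtype.ext (by simp)) (fun _ _ _ => Subtype.ext (by simp))
    (fun _ _ _ => Subtype.ext (by simp)) (fun _ _ _ => Subtype.ext (by simp))
  mul_mem i j a b ha hb := S.mul_mem i j a b ha hb

/-- The graded subalgebra `P_0 ⊕ P_1` given by its homogeneous components. -/
def Sub.ofParts (S : Superalgebra F A) (P : ZMod 2 → Submodule F A)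
    (hP : ∀ i, P i ≤ S.part i)
    (hmul : ∀ (i j : ZMod 2) (a b : A), a ∈ P i → b ∈ P j → S.mul a b ∈ P (i + j)) : S.Sub where
  carrier := P 0 ⊔ P 1
  proj_mem i a ha := by
    obtain ⟨x, hx, y, hy, rfl⟩ := Submodule.mem_sup.1 ha
    rcases parity_cases i with rfl | rfl
    · rw [map_add, S.proj_of_mem (hP 0 hx), S.proj_zero_of_mem (hP 1 hy), add_zero]
      exact Submodule.mem_sup_left hx
    · rw [map_add, S.proj_of_mem (hP 1 hy), S.proj_one_of_mem (hP 0 hx), zero_add]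
      exact Submodule.mem_sup_right hy
  mul_mem a b ha hb := by
    have hle : ∀ i, P i ≤ P 0 ⊔ P 1 := fun i => by
      rcases parity_cases i with rfl | rfl
      · exact le_sup_left
      · exact le_sup_right
    obtain ⟨x, hx, y, hy, rfl⟩ := Submodule.mem_sup.1 ha
    obtain ⟨z, hz, w, hw, rfl⟩ := Submodule.mem_sup.1 hb
    simp only [map_add, LinearMap.add_apply]
    exact add_mem (add_mem (hle _ (hmul _ _ _ _ hx hz)) (hle _ (hmul _ _ _ _ hy hz)))
      (add_mem (hle _ (hmul _ _ _ _ hx hw)) (hle _ (hmul _ _ _ _ hy hw)))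

/-- Isomorphism of superalgebras: an even bijective linear map preserving the product. -/
def IsIsomorphic (S : Superalgebra F A) (T : Superalgebra F B) : Prop :=
  ∃ e : A ≃ₗ[F] B, (∀ (i : ZMod 2) (a : A), a ∈ S.part i → e a ∈ T.part i) ∧
    ∀ a b : A, e (S.mul a b) = T.mul (e a) (e b)

/-- Lie superalgebras: super-anticommutativity and the super Jacobi identity, together with
`[a, [a, a]] = 0` for odd `a` (which is automatic unless the characteristic is `3`) and
`[a, a] = 0` for even `a` (which is automatic unless the characteristic is `2`). -/
structure IsLie (S : Superalgebra F A) : Prop where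
  skew : ∀ (i j : ZMod 2) (a b : A), a ∈ S.part i → b ∈ S.part j →
    S.mul a b = -(koszul F i j • S.mul b a)
  jacobi : ∀ (i j k : ZMod 2) (a b c : A), a ∈ S.part i → b ∈ S.part j → c ∈ S.part k →
    S.mul a (S.mul b c) = S.mul (S.mul a b) c + koszul F i j • S.mul b (S.mul a c)
  even_self : ∀ a ∈ S.part 0, S.mul a a = 0
  odd_cube : ∀ a ∈ S.part 1, S.mul a (S.mul a a) = 0

/-- The operator `D(a, b) = [L_a, L_b]`, where `L_a` is the left multiplication by `a`. -/
noncomputable def innerDer (S : Superalgebra F A) : A →ₗ[F] A →ₗ[F] Module.End F A :=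
  S.superComm.compl₁₂ S.mul S.mul

theorem mul_mem_endPart_of_mem (S : Superalgebra F A) {i : ZMod 2} {a : A}
    (ha : a ∈ S.part i) : S.mul a ∈ S.endPart i := fun j b hb => S.mul_mem i j a b ha hb

/-- On homogeneous elements, `D(a, b) c = a (b c) - (-1)^(|a| |b|) b (a c)`. -/
theorem innerDer_apply (S : Superalgebra F A) {i j : ZMod 2} {a b : A}
    (ha : a ∈ S.part i) (hb : b ∈ S.part j) (c : A) :
    S.innerDer a b c = S.mul a (S.mul b c) - koszul F i j • S.mul b (S.mul a c) := by
  simp [innerDer, S.superComm_of_mem (S.mul_mem_endPart_of_mem ha) (S.mul_mem_endPart_of_mem hb)]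

theorem innerDer_mem_endPart (S : Superalgebra F A) {i j : ZMod 2} {a b : A}
    (ha : a ∈ S.part i) (hb : b ∈ S.part j) : S.innerDer a b ∈ S.endPart (i + j) :=
  S.gl.mul_mem i j _ _ (S.mul_mem_endPart_of_mem ha) (S.mul_mem_endPart_of_mem hb)

/-- Jordan superalgebras (over a field of characteristic not `2`): supercommutativity and the
linearized Jordan superidentity, together with the Jordan identity for even elements
(which is automatic unless the characteristic is `3`). -/
structure IsJordan (S : Superalgebra F A) : Prop where
  comm : ∀ (i j : ZMod 2) (a b : A), a ∈ S.part i → b ∈ S.part j →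
    S.mul a b = koszul F i j • S.mul b a
  cyclic : ∀ (i j k : ZMod 2) (a b c : A), a ∈ S.part i → b ∈ S.part j → c ∈ S.part k →
    koszul F i k • S.innerDer a (S.mul b c) + koszul F j i • S.innerDer b (S.mul c a) +
      koszul F k j • S.innerDer c (S.mul a b) = 0
  jordan : ∀ a ∈ S.part 0, S.innerDer (S.mul a a) a = 0

/-- The superderivations of degree `i`. -/
def derPart (S : Superalgebra F A) (i : ZMod 2) : Submodule F (Module.End F A) where
  carrier := {f | f ∈ S.endPart i ∧ ∀ (j : ZMod 2) (a b : A), a ∈ S.part j →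
    f (S.mul a b) = S.mul (f a) b + koszul F i j • S.mul a (f b)}
  add_mem' {f g} hf hg := ⟨add_mem hf.1 hg.1, fun j a b ha => by
    simp only [LinearMap.add_apply, hf.2 j a b ha, hg.2 j a b ha, map_add, smul_add]; abel⟩
  zero_mem' := ⟨zero_mem _, by simp⟩
  smul_mem' c f hf := ⟨Submodule.smul_mem _ c hf.1, fun j a b ha => by
    simp only [LinearMap.smul_apply, hf.2 j a b ha, map_smul, smul_add, smul_comm c]⟩

theorem superComm_mem_derPart (S : Superalgebra F A) (i j : ZMod 2) (f g : Module.End F A)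
    (hf : f ∈ S.derPart i) (hg : g ∈ S.derPart j) : S.superComm f g ∈ S.derPart (i + j) := by
  refine ⟨S.gl.mul_mem i j f g hf.1 hg.1, fun k a b ha => ?_⟩
  have hfa := hf.1 k a ha
  have hga := hg.1 k a ha
  simp only [S.superComm_of_mem hf.1 hg.1, LinearMap.sub_apply, LinearMap.smul_apply,
    Module.End.mul_apply, hf.2 k a b ha, hg.2 k a b ha, map_add, map_smul, map_sub,
    hf.2 _ _ _ hga, hg.2 _ _ _ hfa, hf.2 _ _ _ ha, hg.2 _ _ _ ha]
  rcases parity_cases i with rfl | rfl <;> rcases parity_cases j with rfl | rfl <;>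
    rcases parity_cases k with rfl | rfl <;>
    simp [koszul_zero_left, koszul_zero_right, koszul_one_one, parity_one_add_one] <;> abel

/-- The Lie superalgebra `Der(S) = Der(S)_0 ⊕ Der(S)_1` of superderivations. -/
noncomputable def der (S : Superalgebra F A) : S.gl.Sub :=
  Sub.ofParts S.gl S.derPart (fun _ _ hf => hf.1) S.superComm_mem_derPart

end General
end Superalgebra

namespace Superalgebra

section Inner

variable {F A : Type*} [Field F] [AddCommGroup A] [Module F A]

set_option maxHeartbeats 1000000 in
/-- In a Jordan superalgebra the operators `D(a, b)` are superderivations. -/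
theorem IsJordan.innerDer_mem_derPart {S : Superalgebra F A} (h : S.IsJordan) {i j : ZMod 2}
    {a b : A} (ha : a ∈ S.part i) (hb : b ∈ S.part j) : S.innerDer a b ∈ S.derPart (i + j) := by
  refine ⟨S.innerDer_mem_endPart ha hb, fun k c d hc => ?_⟩
  have key : ∀ l : ZMod 2, ∀ d ∈ S.part l, S.innerDer a b (S.mul c d) =
      S.mul (S.innerDer a b c) d + koszul F (i + j) k • S.mul c (S.innerDer a b d) := by
    intro l d hd
    have ab := S.mul_mem _ _ _ _ ha hb
    have ac := S.mul_mem _ _ _ _ ha hc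
    have ad := S.mul_mem _ _ _ _ ha hd
    have bc := S.mul_mem _ _ _ _ hb hc
    have bd := S.mul_mem _ _ _ _ hb hd
    have cd := S.mul_mem _ _ _ _ hc hd
    have da := S.mul_mem _ _ _ _ hd ha
    have db := S.mul_mem _ _ _ _ hd hb
    have H1 := congrArg (fun f : Module.End F A => f a) (h.cyclic j k l b c d hb hc hd)
    have H2 := congrArg (fun f : Module.End F A => f b) (h.cyclic i k l a c d ha hc hd)
    simp only [LinearMap.add_apply, LinearMap.smul_apply, LinearMap.zero_apply,
      S.innerDer_apply hb cd, S.innerDer_apply hc db, S.innerDer_apply hd bc,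
      S.innerDer_apply ha cd, S.innerDer_apply hc da, S.innerDer_apply hd ac] at H1 H2
    simp only [LinearMap.smul_apply, h.comm _ _ _ _ hd ha, h.comm _ _ _ _ hd hb, h.comm _ _ _ _ hb ha,
      h.comm _ _ _ _ hc ha, h.comm _ _ _ _ hc hb, LinearMap.map_smul,
      h.comm _ _ _ _ cd ha, h.comm _ _ _ _ cd hb, h.comm _ _ _ _ bc ha, h.comm _ _ _ _ ac hb,
      h.comm _ _ _ _ bd ha, h.comm _ _ _ _ ad hb, h.comm _ _ _ _ bc ad, h.comm _ _ _ _ bd ac,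
      h.comm _ _ _ _ cd ab,
      h.comm _ _ _ _ hd (S.mul_mem _ _ _ _ ha bc),
      h.comm _ _ _ _ hd (S.mul_mem _ _ _ _ hb ac)] at H1 H2
    simp only [S.innerDer_apply ha hb, map_sub, LinearMap.sub_apply, LinearMap.map_smul,
      LinearMap.smul_apply]
    clear ab ac ad bc bd cd da db ha hb hc hd
    rcases parity_cases i with rfl | rfl <;> rcases parity_cases j with rfl | rfl <;>
      rcases parity_cases k with rfl | rfl <;> rcases parity_cases l with rfl | rfl <;>
      simp only [koszul_zero_left, koszul_zero_right, koszul_one_one, parity_one_add_one,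
        add_zero, zero_add] at H1 H2 ⊢ <;>
      first
      | linear_combination (norm := module) H2 - H1
      | linear_combination (norm := module) H1 - H2
      | linear_combination (norm := module) H2 + H1
      | linear_combination (norm := module) -H2 - H1
  rw [← S.proj_add d]
  simp only [map_add, smul_add, key 0 _ (S.proj_mem 0 d), key 1 _ (S.proj_mem 1 d)]
  abel

theorem superComm_innerDer (S : Superalgebra F A) {i j k : ZMod 2} {f : Module.End F A}
    {a b : A} (hf : f ∈ S.derPart i) (ha : a ∈ S.part j) (hb : b ∈ S.part k) :
    S.superComm f (S.innerDer a b) =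
      S.innerDer (f a) b + koszul F i j • S.innerDer a (f b) := by
  refine S.ext_homogeneous fun l c hc => ?_
  have hfa := hf.1 j a ha
  have hfb := hf.1 k b hb
  simp only [S.superComm_of_mem hf.1 (S.innerDer_mem_endPart ha hb), LinearMap.sub_apply,
    LinearMap.add_apply, LinearMap.smul_apply, Module.End.mul_apply, S.innerDer_apply ha hb,
    S.innerDer_apply hfa hb, S.innerDer_apply ha hfb, map_sub, LinearMap.map_smul,
    hf.2 j a _ ha, hf.2 k b _ hb, map_add]
  rcases parity_cases i with rfl | rfl <;> rcases parity_cases j with rfl | rfl <;>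
    rcases parity_cases k with rfl | rfl <;>
    simp only [koszul_zero_left, koszul_zero_right, koszul_one_one, parity_one_add_one,
        add_zero, zero_add] <;> module

/-- The homogeneous component of degree `i` of the span of the operators `D(a, b)`. -/
def inderPart (S : Superalgebra F A) (i : ZMod 2) : Submodule F (Module.End F A) :=
  Submodule.span F {f | ∃ j k : ZMod 2, j + k = i ∧ ∃ a ∈ S.part j, ∃ b ∈ S.part k,
    f = S.innerDer a b}

theorem inderPart_le_endPart (S : Superalgebra F A) (i : ZMod 2) :
    S.inderPart i ≤ S.endPart i := by
  refine Submodule.span_le.2 ?_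
  rintro f ⟨j, k, rfl, a, ha, b, hb, rfl⟩
  exact S.innerDer_mem_endPart ha hb

theorem IsJordan.inderPart_le_derPart {S : Superalgebra F A} (h : S.IsJordan) (i : ZMod 2) :
    S.inderPart i ≤ S.derPart i := by
  refine Submodule.span_le.2 ?_
  rintro f ⟨j, k, rfl, a, ha, b, hb, rfl⟩
  exact h.innerDer_mem_derPart ha hb

theorem superComm_mem_inderPart (S : Superalgebra F A) {i j : ZMod 2} {f g : Module.End F A}
    (hf : f ∈ S.derPart i) (hg : g ∈ S.inderPart j) : S.superComm f g ∈ S.inderPart (i + j) := by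
  induction hg using Submodule.span_induction with
  | mem g hg =>
    obtain ⟨k, l, rfl, a, ha, b, hb, rfl⟩ := hg
    rw [S.superComm_innerDer hf ha hb]
    refine add_mem (Submodule.subset_span ⟨i + k, l, by ring, _, hf.1 k a ha, b, hb, rfl⟩)
      (Submodule.smul_mem _ _
        (Submodule.subset_span ⟨k, i + l, by ring, a, ha, _, hf.1 l b hb, rfl⟩))
  | zero => simp
  | add x y _ _ hx hy => rw [map_add]; exact add_mem hx hy
  | smul c x _ hx => rw [map_smul]; exact Submodule.smul_mem _ c hx

theorem superComm_skew (S : Superalgebra F A) {i j : ZMod 2} {f g : Module.End F A}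
    (hf : f ∈ S.endPart i) (hg : g ∈ S.endPart j) :
    S.superComm f g = -(koszul F i j • S.superComm g f) := by
  rw [S.superComm_of_mem hf hg, S.superComm_of_mem hg hf]
  rcases parity_cases i with rfl | rfl <;> rcases parity_cases j with rfl | rfl <;>
    simp [koszul_zero_left, koszul_zero_right, koszul_one_one, add_comm]

/-- The Lie superalgebra `Inder(S)` of inner derivations of a Jordan superalgebra: the linear span
of the operators `D(a, b)`. -/
noncomputable def inder (S : Superalgebra F A) (h : S.IsJordan) : S.gl.Sub :=
  Sub.ofParts S.gl S.inderPart S.inderPart_le_endPart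
    (fun i _ _ _ hf hg => S.superComm_mem_inderPart (h.inderPart_le_derPart i hf) hg)

theorem inder_carrier (S : Superalgebra F A) (h : S.IsJordan) :
    (S.inder h).carrier = Submodule.span F {f | ∃ a b : A, f = S.innerDer a b} := by
  apply le_antisymm
  · refine sup_le ?_ ?_ <;>
    · refine Submodule.span_mono ?_
      rintro f ⟨j, k, -, a, -, b, -, rfl⟩
      exact ⟨a, b, rfl⟩
  · refine Submodule.span_le.2 ?_
    rintro f ⟨a, b, rfl⟩
    have hm : ∀ i j : ZMod 2, S.innerDer (S.proj i a) (S.proj j b) ∈ (S.inder h).carrier := by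
      intro i j
      have hij : S.innerDer (S.proj i a) (S.proj j b) ∈ S.inderPart (i + j) :=
        Submodule.subset_span ⟨i, j, rfl, _, S.proj_mem i a, _, S.proj_mem j b, rfl⟩
      rcases parity_cases (i + j) with h0 | h0 <;> rw [h0] at hij
      · exact Submodule.mem_sup_left hij
      · exact Submodule.mem_sup_right hij
    have e : S.innerDer a b = S.innerDer (S.proj 0 a) (S.proj 0 b) +
        S.innerDer (S.proj 1 a) (S.proj 0 b) + (S.innerDer (S.proj 0 a) (S.proj 1 b) +
        S.innerDer (S.proj 1 a) (S.proj 1 b)) := by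
      conv_lhs => rw [← S.proj_add a, ← S.proj_add b]
      simp only [map_add, LinearMap.add_apply]
    rw [SetLike.mem_coe, e]
    exact add_mem (add_mem (hm _ _) (hm _ _)) (add_mem (hm _ _) (hm _ _))

theorem inder_le_der (S : Superalgebra F A) (h : S.IsJordan) :
    (S.inder h).carrier ≤ S.der.carrier :=
  sup_le_sup (h.inderPart_le_derPart 0) (h.inderPart_le_derPart 1)

/-- The Lie superalgebra `Der(S)_0 ⊕ Inder(S)_1` of a Jordan superalgebra. -/
noncomputable def derBar (S : Superalgebra F A) (h : S.IsJordan) : S.gl.Sub :=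
  Sub.ofParts S.gl (fun i => if i = 0 then S.derPart 0 else S.inderPart 1)
    (fun i => by
      rcases parity_cases i with rfl | rfl
      · exact fun _ hf => hf.1
      · exact S.inderPart_le_endPart 1)
    (fun i j f g hf hg => by
      have key : ∀ f g, f ∈ S.derPart 0 → g ∈ S.inderPart 1 →
          S.superComm f g ∈ S.inderPart 1 := fun f g hf hg => by
        simpa using S.superComm_mem_inderPart hf hg
      change S.superComm f g ∈ _
      rcases parity_cases i with rfl | rfl <;> rcases parity_cases j with rfl | rfl
      · simpa using S.superComm_mem_derPart 0 0 f g (by simpa using hf) (by simpa using hg)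
      · simpa using key f g (by simpa using hf) (by simpa using hg)
      · have hf' : f ∈ S.inderPart 1 := by simpa using hf
        have hg' : g ∈ S.derPart 0 := by simpa using hg
        have e := S.superComm_skew (S.inderPart_le_endPart 1 hf') hg'.1
        rw [koszul_zero_right, one_smul] at e
        have hm := neg_mem (key g f hg' hf')
        rw [← e] at hm
        simpa using hm
      · have hf' : f ∈ S.inderPart 1 := by simpa using hf
        have hg' : g ∈ S.inderPart 1 := by simpa using hg
        have hm := S.superComm_mem_derPart 1 1 f g (h.inderPart_le_derPart 1 hf')
          (h.inderPart_le_derPart 1 hg')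
        rw [parity_one_add_one] at hm
        simpa [parity_one_add_one] using hm)

theorem inder_le_derBar (S : Superalgebra F A) (h : S.IsJordan) :
    (S.inder h).carrier ≤ (S.derBar h).carrier := by
  refine sup_le_sup ?_ ?_
  · simpa using h.inderPart_le_derPart 0
  · simp

theorem derBar_le_der (S : Superalgebra F A) (h : S.IsJordan) :
    (S.derBar h).carrier ≤ S.der.carrier := by
  refine sup_le_sup ?_ ?_
  · simp
  · simpa using h.inderPart_le_derPart 1

end Inner
end Superalgebra

/-- The orthogonal Lie algebra `so_3` of skew-symmetric `3 × 3` matrices. -/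
abbrev SO3 (F : Type*) [Field F] : Type _ := ↥(LieAlgebra.Orthogonal.so (Fin 3) F)

/-- The bilinear form `(X, Y) ↦ trace (X Y)` on `so_3`. -/
def so3Trace (F : Type*) [Field F] : SO3 F →ₗ[F] SO3 F →ₗ[F] F :=
  LinearMap.mk₂ F (fun X Y => (X.1 * Y.1).trace)
    (fun X X' Y => by simp [add_mul]) (fun c X Y => by simp)
    (fun X Y Y' => by simp [mul_add]) (fun c X Y => by simp)

/-- The bilinear map `(X, Y) ↦ [X, Y]` on `so_3`. -/
def so3Bracket (F : Type*) [Field F] : SO3 F →ₗ[F] SO3 F →ₗ[F] SO3 F :=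
  LinearMap.mk₂ F (fun X Y => ⁅X, Y⁆)
    (fun X X' Y => add_lie X X' Y) (fun c X Y => smul_lie c X Y)
    (fun X Y Y' => lie_add X Y Y') (fun c X Y => lie_smul c X Y)

namespace Superalgebra

section Tits

variable {F A : Type*} [Field F] [AddCommGroup A] [Module F A]

/-- The component `so_3 ⊗ A_i` of `so_3 ⊗ A`. -/
noncomputable def so3Part (S : Superalgebra F A) (i : ZMod 2) : Submodule F (SO3 F ⊗[F] A) :=
  LinearMap.range ((S.part i).subtype.lTensor (SO3 F))

theorem tmul_mem_so3Part (S : Superalgebra F A) {i : ZMod 2} (X : SO3 F) {a : A}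
    (ha : a ∈ S.part i) : X ⊗ₜ[F] a ∈ S.so3Part i :=
  ⟨X ⊗ₜ ⟨a, ha⟩, by simp⟩

theorem so3Part_induction (S : Superalgebra F A) {i : ZMod 2} {P : SO3 F ⊗[F] A → Prop}
    {u : SO3 F ⊗[F] A} (hu : u ∈ S.so3Part i) (zero : P 0)
    (tmul : ∀ (X : SO3 F), ∀ a ∈ S.part i, P (X ⊗ₜ a))
    (add : ∀ u v, P u → P v → P (u + v)) : P u := by
  obtain ⟨t, rfl⟩ := hu
  induction t using TensorProduct.induction_on with
  | zero => simpa using zero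
  | tmul X a => simpa using tmul X a a.2
  | add x y hx hy => rw [map_add]; exact add _ _ hx hy

theorem lTensor_mem_so3Part (S : Superalgebra F A) {i j : ZMod 2} {f : Module.End F A}
    (hf : f ∈ S.endPart i) {u : SO3 F ⊗[F] A} (hu : u ∈ S.so3Part j) :
    f.lTensor (SO3 F) u ∈ S.so3Part (i + j) := by
  refine S.so3Part_induction (P := fun u => f.lTensor (SO3 F) u ∈ S.so3Part (i + j)) hu
    (by simp) (fun X a ha => ?_) (fun u v hu hv => ?_)
  · rw [LinearMap.lTensor_tmul]
    exact S.tmul_mem_so3Part X (hf j a ha)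
  · rw [map_add]
    exact add_mem hu hv

theorem isCompl_so3Part (S : Superalgebra F A) : IsCompl (S.so3Part 0) (S.so3Part 1) := by
  constructor
  · rw [Submodule.disjoint_def]
    intro u h0 h1
    have e0 : (S.proj 0).lTensor (SO3 F) u = u := by
      refine S.so3Part_induction (P := fun u => (S.proj 0).lTensor (SO3 F) u = u) h0 (by simp) (fun X a ha => ?_) (fun u v hu hv => ?_)
      · rw [LinearMap.lTensor_tmul, S.proj_of_mem ha]
      · rw [map_add, hu, hv]
    have e1 : (S.proj 0).lTensor (SO3 F) u = 0 := by
      refine S.so3Part_induction (P := fun u => (S.proj 0).lTensor (SO3 F) u = 0) h1 (by simp) (fun X a ha => ?_) (fun u v hu hv => ?_)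
      · rw [LinearMap.lTensor_tmul, S.proj_zero_of_mem ha, TensorProduct.tmul_zero]
      · rw [map_add, hu, hv, add_zero]
    rw [← e0, e1]
  · rw [codisjoint_iff, eq_top_iff]
    intro u _
    induction u using TensorProduct.induction_on with
    | zero => exact zero_mem _
    | tmul X a =>
      rw [← S.proj_add a, TensorProduct.tmul_add]
      exact Submodule.add_mem_sup (S.tmul_mem_so3Part X (S.proj_mem 0 a))
        (S.tmul_mem_so3Part X (S.proj_mem 1 a))
    | add x y hx hy => exact add_mem (hx trivial) (hy trivial)

/-- The linear map sending a homogeneous endomorphism `f` to `a ↦ (-1)^(|f| |a|) f a`. -/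
noncomputable def signTwist (S : Superalgebra F A) : Module.End F A →ₗ[F] Module.End F A where
  toFun f := ∑ i, ∑ j, koszul F i j • (S.endComp i f * S.proj j)
  map_add' f g := by simp only [parity_sum, map_add, add_mul, smul_add]; abel
  map_smul' c f := by
    simp only [parity_sum, map_smul, smul_mul_assoc, smul_comm _ c, smul_add, RingHom.id_apply]

theorem signTwist_apply (S : Superalgebra F A) {i j : ZMod 2} {f : Module.End F A} {a : A}
    (hf : f ∈ S.endPart i) (ha : a ∈ S.part j) :
    S.signTwist f a = koszul F i j • f a := by
  rcases parity_cases i with rfl | rfl <;> rcases parity_cases j with rfl | rfl <;>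
  simp [signTwist, parity_sum, S.endComp_of_mem hf, S.proj_of_mem ha,
    S.endComp_zero_of_mem, S.endComp_one_of_mem, S.proj_zero_of_mem, S.proj_one_of_mem, hf, ha]

theorem signTwist_mem (S : Superalgebra F A) {i : ZMod 2} {f : Module.End F A}
    (hf : f ∈ S.endPart i) : S.signTwist f ∈ S.endPart i := fun j a ha => by
  rw [S.signTwist_apply hf ha]
  exact Submodule.smul_mem _ _ (hf j a ha)

/-- The bilinear map `(X ⊗ a, Y ⊗ b) ↦ [X, Y] ⊗ a b` on `so_3 ⊗ A`. -/
noncomputable def so3Mul (S : Superalgebra F A) :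
    SO3 F ⊗[F] A →ₗ[F] SO3 F ⊗[F] A →ₗ[F] SO3 F ⊗[F] A :=
  TensorProduct.map₂ (so3Bracket F) S.mul

/-- The bilinear map `(X ⊗ a, Y ⊗ b) ↦ (1/2) trace (X Y) D(a, b)` on `so_3 ⊗ A`. -/
noncomputable def so3Der (S : Superalgebra F A) :
    SO3 F ⊗[F] A →ₗ[F] SO3 F ⊗[F] A →ₗ[F] Module.End F A :=
  (2⁻¹ : F) • (TensorProduct.map₂ (so3Trace F) S.innerDer).compr₂
    (TensorProduct.lid F (Module.End F A)).toLinearMap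

theorem so3Mul_tmul (S : Superalgebra F A) (X Y : SO3 F) (a b : A) :
    S.so3Mul (X ⊗ₜ a) (Y ⊗ₜ b) = ⁅X, Y⁆ ⊗ₜ S.mul a b := by
  simp [so3Mul, so3Bracket]

theorem so3Der_tmul (S : Superalgebra F A) (X Y : SO3 F) (a b : A) :
    S.so3Der (X ⊗ₜ a) (Y ⊗ₜ b) = (2⁻¹ * (X.1 * Y.1).trace : F) • S.innerDer a b := by
  simp [so3Der, so3Trace, mul_smul]

theorem so3Der_mem (S : Superalgebra F A) {D : Submodule F (Module.End F A)}
    (hD : ∀ a b, S.innerDer a b ∈ D) (u v : SO3 F ⊗[F] A) : S.so3Der u v ∈ D := by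
  induction u using TensorProduct.induction_on with
  | zero => simp
  | tmul X a =>
    induction v using TensorProduct.induction_on with
    | zero => simp
    | tmul Y b => rw [so3Der_tmul]; exact Submodule.smul_mem _ _ (hD a b)
    | add x y hx hy => rw [map_add]; exact add_mem hx hy
  | add x y hx hy => rw [map_add, LinearMap.add_apply]; exact add_mem hx hy

theorem so3Mul_mem_part (S : Superalgebra F A) {i j : ZMod 2} {u v : SO3 F ⊗[F] A}
    (hu : u ∈ S.so3Part i) (hv : v ∈ S.so3Part j) : S.so3Mul u v ∈ S.so3Part (i + j) := by
  refine S.so3Part_induction (P := fun u => S.so3Mul u v ∈ S.so3Part (i + j)) hu (by simp) (fun X a ha => ?_) (fun u u' hu hu' => ?_)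
  · refine S.so3Part_induction (P := fun v => S.so3Mul (X ⊗ₜ a) v ∈ S.so3Part (i + j)) hv (by simp) (fun Y b hb => ?_) (fun v v' hv hv' => ?_)
    · rw [so3Mul_tmul]
      exact S.tmul_mem_so3Part _ (S.mul_mem _ _ _ _ ha hb)
    · rw [map_add]; exact add_mem hv hv'
  · rw [map_add, LinearMap.add_apply]; exact add_mem hu hu'

theorem so3Der_mem_part (S : Superalgebra F A) {i j : ZMod 2} {u v : SO3 F ⊗[F] A}
    (hu : u ∈ S.so3Part i) (hv : v ∈ S.so3Part j) : S.so3Der u v ∈ S.endPart (i + j) := by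
  refine S.so3Part_induction (P := fun u => S.so3Der u v ∈ S.endPart (i + j)) hu (by simp) (fun X a ha => ?_) (fun u u' hu hu' => ?_)
  · refine S.so3Part_induction (P := fun v => S.so3Der (X ⊗ₜ a) v ∈ S.endPart (i + j)) hv (by simp) (fun Y b hb => ?_) (fun v v' hv hv' => ?_)
    · rw [so3Der_tmul]
      exact Submodule.smul_mem _ _ (S.innerDer_mem_endPart ha hb)
    · rw [map_add]; exact add_mem hv hv'
  · rw [map_add, LinearMap.add_apply]; exact add_mem hu hu'

theorem innerDer_mem_inder (S : Superalgebra F A) (h : S.IsJordan) (a b : A) :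
    S.innerDer a b ∈ (S.inder h).carrier := by
  rw [S.inder_carrier h]
  exact Submodule.subset_span ⟨a, b, rfl⟩

/-- The Tits construction `T(S, d) = (so_3 ⊗ S) ⊕ d` for a Jordan superalgebra `S` and a graded
subalgebra `Inder(S) ≤ d ≤ Der(S)`. The bracket is determined by
* `[f, g]` is the bracket of `d`, for `f, g ∈ d`,
* `[f, X ⊗ a] = X ⊗ f a` and `[X ⊗ a, f] = -(-1)^(|f| |a|) X ⊗ f a`,
* `[X ⊗ a, Y ⊗ b] = [X, Y] ⊗ a b + (1/2) trace (X Y) D(a, b)`. -/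
noncomputable def tits (S : Superalgebra F A) (h : S.IsJordan) (d : S.gl.Sub)
    (hd : (S.inder h).carrier ≤ d.carrier) (_hd' : d.carrier ≤ S.der.carrier) :
    Superalgebra F ((SO3 F ⊗[F] A) × d.carrier) where
  part i := (S.so3Part i).prod (d.toSuperalgebra.part i)
  isCompl := by
    have h1 := S.isCompl_so3Part
    have h2 := d.toSuperalgebra.isCompl
    constructor
    · rw [Submodule.disjoint_def]
      rintro ⟨u, f⟩ ⟨hu, hf⟩ ⟨hu', hf'⟩
      exact Prod.ext (Submodule.disjoint_def.1 h1.disjoint u hu hu')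
        (Submodule.disjoint_def.1 h2.disjoint f hf hf')
    · rw [codisjoint_iff, Submodule.prod_sup_prod, h1.sup_eq_top, h2.sup_eq_top,
        Submodule.prod_top]
  mul := LinearMap.mk₂ F
    (fun p q =>
      (S.so3Mul p.1 q.1 + LinearMap.lTensor (SO3 F) (p.2 : Module.End F A) q.1 -
          LinearMap.lTensor (SO3 F) (S.signTwist (q.2 : Module.End F A)) p.1,
        ⟨S.so3Der p.1 q.1, S.so3Der_mem (fun a b => hd (S.innerDer_mem_inder h a b)) _ _⟩ +
          d.toSuperalgebra.mul p.2 q.2))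
    (fun p p' q => by
      ext1
      · simp [LinearMap.lTensor_add]; abel
      · apply Subtype.ext; simp; abel)
    (fun c p q => by
      ext1
      · simp [LinearMap.lTensor_smul, smul_sub, smul_add]
      · apply Subtype.ext; simp)
    (fun p q q' => by
      ext1
      · simp [LinearMap.lTensor_add]; abel
      · apply Subtype.ext; simp; abel)
    (fun c p q => by
      ext1
      · simp [LinearMap.lTensor_smul, smul_sub, smul_add]
      · apply Subtype.ext; simp)
  mul_mem i j p q hp hq := by
    refine ⟨sub_mem (add_mem (S.so3Mul_mem_part hp.1 hq.1) (S.lTensor_mem_so3Part hp.2 hq.1)) ?_,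
      add_mem ?_ (d.toSuperalgebra.mul_mem i j _ _ hp.2 hq.2)⟩
    · rw [add_comm]
      exact S.lTensor_mem_so3Part (S.signTwist_mem hq.2) hp.1
    · exact S.so3Der_mem_part hp.1 hq.1

theorem tits_mul_tmul_tmul (S : Superalgebra F A) (h : S.IsJordan) (d : S.gl.Sub)
    (hd : (S.inder h).carrier ≤ d.carrier) (hd' : d.carrier ≤ S.der.carrier)
    (X Y : SO3 F) (a b : A) :
    (S.tits h d hd hd').mul (X ⊗ₜ a, 0) (Y ⊗ₜ b, 0) =
      (⁅X, Y⁆ ⊗ₜ S.mul a b,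
        (2⁻¹ * (X.1 * Y.1).trace : F) • ⟨S.innerDer a b, hd (S.innerDer_mem_inder h a b)⟩) := by
  ext1
  · simp [tits, so3Mul_tmul]
  · apply Subtype.ext; simp [tits, so3Der_tmul]

theorem tits_mul_der_tmul (S : Superalgebra F A) (h : S.IsJordan) (d : S.gl.Sub)
    (hd : (S.inder h).carrier ≤ d.carrier) (hd' : d.carrier ≤ S.der.carrier)
    (f : d.carrier) (X : SO3 F) (a : A) :
    (S.tits h d hd hd').mul (0, f) (X ⊗ₜ a, 0) = (X ⊗ₜ f.1 a, 0) := by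
  ext1
  · simp [tits]
  · apply Subtype.ext; simp [tits]

theorem tits_mul_tmul_der (S : Superalgebra F A) (h : S.IsJordan) (d : S.gl.Sub)
    (hd : (S.inder h).carrier ≤ d.carrier) (hd' : d.carrier ≤ S.der.carrier)
    {i j : ZMod 2} (f : d.carrier) (hf : f.1 ∈ S.endPart i) (X : SO3 F) {a : A}
    (ha : a ∈ S.part j) :
    (S.tits h d hd hd').mul (X ⊗ₜ a, 0) (0, f) = (-(koszul F i j • X ⊗ₜ f.1 a), 0) := by
  ext1
  · simp [tits, S.signTwist_apply hf ha]
  · apply Subtype.ext; simp [tits]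

theorem tits_mul_der_der (S : Superalgebra F A) (h : S.IsJordan) (d : S.gl.Sub)
    (hd : (S.inder h).carrier ≤ d.carrier) (hd' : d.carrier ≤ S.der.carrier)
    (f g : d.carrier) :
    (S.tits h d hd hd').mul (0, f) (0, g) = (0, d.toSuperalgebra.mul f g) := by
  ext1
  · simp [tits]
  · apply Subtype.ext; simp [tits]

end Tits
end Superalgebra

section ProductGrading

variable (F M N : Type*) [Field F] [AddCommGroup M] [Module F M] [AddCommGroup N] [Module F N]

/-- The grading of `M × N` with even part `M × 0` and odd part `0 × N`. -/
def prodPart (i : ZMod 2) : Submodule F (M × N) :=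
  if i = 0 then LinearMap.ker (LinearMap.snd F M N) else LinearMap.ker (LinearMap.fst F M N)

variable {F M N}

theorem mem_prodPart_zero {a : M × N} : a ∈ prodPart F M N 0 ↔ a.2 = 0 := by
  simp [prodPart]

theorem mem_prodPart_one {a : M × N} : a ∈ prodPart F M N 1 ↔ a.1 = 0 := by
  simp [prodPart]

variable (F M N)

theorem isCompl_prodPart : IsCompl (prodPart F M N 0) (prodPart F M N 1) := by
  constructor
  · rw [Submodule.disjoint_def]
    intro a h0 h1
    exact Prod.ext (mem_prodPart_one.1 h1) (mem_prodPart_zero.1 h0)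
  · rw [codisjoint_iff, eq_top_iff]
    intro a _
    have h : a = (a.1, 0) + (0, a.2) := by simp
    rw [h]
    exact Submodule.add_mem_sup (mem_prodPart_zero.2 rfl) (mem_prodPart_one.2 rfl)

end ProductGrading

section ChengKac

variable {F Z : Type*} [Field F] [CommRing Z] [Algebra F Z]

/-- The underlying space of the Cheng-Kac superalgebra. The element
`((f, u₁, u₂, u₃), (g, v₁, v₂, v₃))` stands for
`f 1 + u₁ w₁ + u₂ w₂ + u₃ w₃ + g x + v₁ x₁ + v₂ x₂ + v₃ x₃`. -/
abbrev JCKSpace (Z : Type*) : Type _ := (Z × Z × Z × Z) × (Z × Z × Z × Z)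

/-- The product of the Cheng-Kac superalgebra: the bilinear, supercommutative product with
* `(f w₁) (g w₁) = (f w₂) (g w₂) = f g = -(f w₃) (g w₃)`, `(f w_i) (g w_j) = 0` for `i ≠ j`;
* `f (g x) = (f g) x`, `f (g x_j) = (f g) x_j`, `(f w_i) (g x) = (δ f g) x_i`,
  `(f w_i) (g x_j) = -(f g) x_{i × j}`;
* `(f x) (g x) = δ f g - f δ g`, `(f x) (g x_j) = -(f g) w_j`, `(f x_i) (g x) = (f g) w_i`,
  `(f x_i) (g x_j) = 0`;

where `x_{1×2} = -x_{2×1} = x₃`, `x_{1×3} = -x_{3×1} = x₂`, `x_{3×2} = -x_{2×3} = x₁`,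
`x_{i×i} = 0`. -/
def jckMul (δ : Derivation F Z Z) : JCKSpace Z → JCKSpace Z → JCKSpace Z
  | ((f, u₁, u₂, u₃), (g, v₁, v₂, v₃)), ((f', u₁', u₂', u₃'), (g', v₁', v₂', v₃')) =>
    ((f * f' + u₁ * u₁' + u₂ * u₂' - u₃ * u₃' + (δ g * g' - g * δ g'),
      f * u₁' + u₁ * f' + (v₁ * g' - g * v₁'),
      f * u₂' + u₂ * f' + (v₂ * g' - g * v₂'),
      f * u₃' + u₃ * f' + (v₃ * g' - g * v₃')),
     (f * g' + g * f',
      f * v₁' + v₁ * f' + (δ u₁ * g' + g * δ u₁')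
        - (u₃ * v₂' - u₂ * v₃') - (u₃' * v₂ - u₂' * v₃),
      f * v₂' + v₂ * f' + (δ u₂ * g' + g * δ u₂')
        - (u₁ * v₃' - u₃ * v₁') - (u₁' * v₃ - u₃' * v₁),
      f * v₃' + v₃ * f' + (δ u₃ * g' + g * δ u₃')
        - (u₁ * v₂' - u₂ * v₁') - (u₁' * v₂ - u₂' * v₁)))

theorem jck_even {a : JCKSpace Z} (ha : a ∈ prodPart F (Z × Z × Z × Z) (Z × Z × Z × Z) 0) :
    ∃ f u₁ u₂ u₃, a = ((f, u₁, u₂, u₃), (0, 0, 0, 0)) :=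
  ⟨a.1.1, a.1.2.1, a.1.2.2.1, a.1.2.2.2, Prod.ext rfl (mem_prodPart_zero.1 ha)⟩

theorem jck_odd {a : JCKSpace Z} (ha : a ∈ prodPart F (Z × Z × Z × Z) (Z × Z × Z × Z) 1) :
    ∃ g v₁ v₂ v₃, a = ((0, 0, 0, 0), (g, v₁, v₂, v₃)) :=
  ⟨a.2.1, a.2.2.1, a.2.2.2.1, a.2.2.2.2, Prod.ext (mem_prodPart_one.1 ha) rfl⟩

theorem jckMul_mem (δ : Derivation F Z Z) (i j : ZMod 2) (a b : JCKSpace Z)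
    (ha : a ∈ prodPart F (Z × Z × Z × Z) (Z × Z × Z × Z) i)
    (hb : b ∈ prodPart F (Z × Z × Z × Z) (Z × Z × Z × Z) j) :
    jckMul δ a b ∈ prodPart F (Z × Z × Z × Z) (Z × Z × Z × Z) (i + j) := by
  rcases parity_cases i with rfl | rfl <;> rcases parity_cases j with rfl | rfl
  · obtain ⟨f, u₁, u₂, u₃, rfl⟩ := jck_even (F := F) ha
    obtain ⟨f', u₁', u₂', u₃', rfl⟩ := jck_even (F := F) hb
    exact mem_prodPart_zero.2 (by simp [jckMul])
  · obtain ⟨f, u₁, u₂, u₃, rfl⟩ := jck_even (F := F) ha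
    obtain ⟨f', u₁', u₂', u₃', rfl⟩ := jck_odd (F := F) hb
    exact mem_prodPart_one.2 (by simp [jckMul])
  · obtain ⟨f, u₁, u₂, u₃, rfl⟩ := jck_odd (F := F) ha
    obtain ⟨f', u₁', u₂', u₃', rfl⟩ := jck_even (F := F) hb
    exact mem_prodPart_one.2 (by simp [jckMul])
  · obtain ⟨f, u₁, u₂, u₃, rfl⟩ := jck_odd (F := F) ha
    obtain ⟨f', u₁', u₂', u₃', rfl⟩ := jck_odd (F := F) hb
    exact mem_prodPart_zero.2 (by simp [jckMul])

/-- The Cheng-Kac Jordan superalgebra `JCK(Z, δ)`. -/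
def JCK (δ : Derivation F Z Z) : Superalgebra F (JCKSpace Z) where
  part := prodPart F _ _
  isCompl := isCompl_prodPart F _ _
  mul := LinearMap.mk₂ F (jckMul δ)
    (fun a a' b => by
      ext <;> simp only [jckMul, Prod.fst_add, Prod.snd_add, map_add] <;> ring)
    (fun c a b => by
      ext <;> simp only [jckMul, Prod.smul_fst, Prod.smul_snd, Derivation.map_smul] <;>
        simp only [Algebra.smul_def] <;> ring)
    (fun a b b' => by
      ext <;> simp only [jckMul, Prod.fst_add, Prod.snd_add, map_add] <;> ring)
    (fun c a b => by
      ext <;> simp only [jckMul, Prod.smul_fst, Prod.smul_snd, Derivation.map_smul] <;>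
        simp only [Algebra.smul_def] <;> ring)
  mul_mem := jckMul_mem δ

theorem JCK_mul_apply (δ : Derivation F Z Z) (a b : JCKSpace Z) :
    (JCK δ).mul a b = jckMul δ a b := rfl

theorem jck_mem_even {δ : Derivation F Z Z} {a : JCKSpace Z} (ha : a ∈ (JCK δ).part 0) :
    ∃ f u₁ u₂ u₃, a = ((f, u₁, u₂, u₃), (0, 0, 0, 0)) := jck_even (F := F) ha

theorem jck_mem_odd {δ : Derivation F Z Z} {a : JCKSpace Z} (ha : a ∈ (JCK δ).part 1) :
    ∃ g v₁ v₂ v₃, a = ((0, 0, 0, 0), (g, v₁, v₂, v₃)) := jck_odd (F := F) ha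

theorem jck_mem_cases {δ : Derivation F Z Z} {i : ZMod 2} {a : JCKSpace Z}
    (ha : a ∈ (JCK δ).part i) :
    (i = 0 ∧ ∃ f u₁ u₂ u₃, a = ((f, u₁, u₂, u₃), (0, 0, 0, 0))) ∨
      (i = 1 ∧ ∃ g v₁ v₂ v₃, a = ((0, 0, 0, 0), (g, v₁, v₂, v₃))) := by
  rcases parity_cases i with rfl | rfl
  · exact Or.inl ⟨rfl, jck_mem_even ha⟩
  · exact Or.inr ⟨rfl, jck_mem_odd ha⟩

set_option maxHeartbeats 4000000 in
theorem jck_cyclic_zero (δ : Derivation F Z Z) (p : ZMod 2) (a b c : JCKSpace Z)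
    (ha : a ∈ (JCK δ).part 0) (hb : b ∈ (JCK δ).part 0) (hc : c ∈ (JCK δ).part p) :
    koszul F 0 p • (JCK δ).innerDer a ((JCK δ).mul b c) +
      koszul F 0 0 • (JCK δ).innerDer b ((JCK δ).mul c a) +
      koszul F p 0 • (JCK δ).innerDer c ((JCK δ).mul a b) = 0 := by
  have ab := (JCK δ).mul_mem _ _ _ _ ha hb
  have bc := (JCK δ).mul_mem _ _ _ _ hb hc
  have ca := (JCK δ).mul_mem _ _ _ _ hc ha
  refine (JCK δ).ext_homogeneous fun l d hd => ?_
  simp only [LinearMap.add_apply, LinearMap.smul_apply, Superalgebra.innerDer_apply _ ha bc,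
    Superalgebra.innerDer_apply _ hb ca, Superalgebra.innerDer_apply _ hc ab]
  clear ab bc ca
  obtain ⟨f, u₁, u₂, u₃, rfl⟩ := jck_mem_even ha
  obtain ⟨f', u₁', u₂', u₃', rfl⟩ := jck_mem_even hb
  rcases jck_mem_cases hc with ⟨rfl, f'', u₁'', u₂'', u₃'', rfl⟩ | ⟨rfl, f'', u₁'', u₂'', u₃'', rfl⟩ <;>
  rcases jck_mem_cases hd with ⟨rfl, d₀, d₁, d₂, d₃, rfl⟩ | ⟨rfl, d₀, d₁, d₂, d₃, rfl⟩
  all_goals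
    clear ha hb hc hd
    simp only [koszul_zero_left, koszul_zero_right, koszul_one_one, parity_one_add_one,
      add_zero, zero_add, one_smul, neg_smul, JCK_mul_apply, jckMul, map_zero, mul_zero,
      zero_mul, sub_zero, zero_sub, sub_self, LinearMap.zero_apply, Prod.mk_add_mk,
      Prod.mk_sub_mk, Prod.neg_mk, neg_zero]
    refine Prod.ext (Prod.ext ?_ (Prod.ext ?_ (Prod.ext ?_ ?_)))
      (Prod.ext ?_ (Prod.ext ?_ (Prod.ext ?_ ?_))) <;>
    simp only [map_add, map_sub, map_neg, Derivation.leibniz, smul_eq_mul, Prod.fst_zero,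
      Prod.snd_zero] <;>
    ring

set_option maxHeartbeats 4000000 in
theorem jck_cyclic_one (δ : Derivation F Z Z) (p : ZMod 2) (a b c : JCKSpace Z)
    (ha : a ∈ (JCK δ).part p) (hb : b ∈ (JCK δ).part 1) (hc : c ∈ (JCK δ).part 1) :
    koszul F p 1 • (JCK δ).innerDer a ((JCK δ).mul b c) +
      koszul F 1 p • (JCK δ).innerDer b ((JCK δ).mul c a) +
      koszul F 1 1 • (JCK δ).innerDer c ((JCK δ).mul a b) = 0 := by
  have ab := (JCK δ).mul_mem _ _ _ _ ha hb
  have bc := (JCK δ).mul_mem _ _ _ _ hb hc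
  have ca := (JCK δ).mul_mem _ _ _ _ hc ha
  refine (JCK δ).ext_homogeneous fun l d hd => ?_
  simp only [LinearMap.add_apply, LinearMap.smul_apply, Superalgebra.innerDer_apply _ ha bc,
    Superalgebra.innerDer_apply _ hb ca, Superalgebra.innerDer_apply _ hc ab]
  clear ab bc ca
  obtain ⟨f', u₁', u₂', u₃', rfl⟩ := jck_mem_odd hb
  obtain ⟨f'', u₁'', u₂'', u₃'', rfl⟩ := jck_mem_odd hc
  rcases jck_mem_cases ha with ⟨rfl, f, u₁, u₂, u₃, rfl⟩ | ⟨rfl, f, u₁, u₂, u₃, rfl⟩ <;>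
  rcases jck_mem_cases hd with ⟨rfl, d₀, d₁, d₂, d₃, rfl⟩ | ⟨rfl, d₀, d₁, d₂, d₃, rfl⟩
  all_goals
    clear ha hb hc hd
    simp only [koszul_zero_left, koszul_zero_right, koszul_one_one, parity_one_add_one,
      add_zero, zero_add, one_smul, neg_smul, JCK_mul_apply, jckMul, map_zero, mul_zero,
      zero_mul, sub_zero, zero_sub, sub_self, LinearMap.zero_apply, Prod.mk_add_mk,
      Prod.mk_sub_mk, Prod.neg_mk, neg_zero]
    refine Prod.ext (Prod.ext ?_ (Prod.ext ?_ (Prod.ext ?_ ?_)))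
      (Prod.ext ?_ (Prod.ext ?_ (Prod.ext ?_ ?_))) <;>
    simp only [map_add, map_sub, map_neg, Derivation.leibniz, smul_eq_mul, Prod.fst_zero,
      Prod.snd_zero] <;>
    ring

set_option maxHeartbeats 4000000 in
theorem JCK_isJordan (δ : Derivation F Z Z) : (JCK δ).IsJordan where
  comm i j a b ha hb := by
    rcases parity_cases i with rfl | rfl <;> rcases parity_cases j with rfl | rfl
    · obtain ⟨f, u₁, u₂, u₃, rfl⟩ := jck_mem_even ha
      obtain ⟨f', u₁', u₂', u₃', rfl⟩ := jck_mem_even hb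
      ext <;> simp [JCK_mul_apply, jckMul, koszul_zero_left] <;> ring
    · obtain ⟨f, u₁, u₂, u₃, rfl⟩ := jck_mem_even ha
      obtain ⟨f', u₁', u₂', u₃', rfl⟩ := jck_mem_odd hb
      ext <;> simp [JCK_mul_apply, jckMul, koszul_zero_left] <;> ring
    · obtain ⟨f, u₁, u₂, u₃, rfl⟩ := jck_mem_odd ha
      obtain ⟨f', u₁', u₂', u₃', rfl⟩ := jck_mem_even hb
      ext <;> simp [JCK_mul_apply, jckMul, koszul_zero_right] <;> ring
    · obtain ⟨f, u₁, u₂, u₃, rfl⟩ := jck_mem_odd ha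
      obtain ⟨f', u₁', u₂', u₃', rfl⟩ := jck_mem_odd hb
      ext <;> simp [JCK_mul_apply, jckMul, koszul_one_one] <;> ring
  cyclic i j k a b c ha hb hc := by
    rcases parity_cases i with rfl | rfl <;> rcases parity_cases j with rfl | rfl <;>
      rcases parity_cases k with rfl | rfl
    · exact jck_cyclic_zero δ 0 a b c ha hb hc
    · exact jck_cyclic_zero δ 1 a b c ha hb hc
    · have H := jck_cyclic_zero δ 1 c a b hc ha hb
      rwa [add_assoc, add_comm] at H
    · exact jck_cyclic_one δ 0 a b c ha hb hc
    · have H := jck_cyclic_zero δ 1 b c a hb hc ha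
      rwa [add_comm, ← add_assoc] at H
    · have H := jck_cyclic_one δ 0 b c a hb hc ha
      rwa [add_comm, ← add_assoc] at H
    · have H := jck_cyclic_one δ 0 c a b hc ha hb
      rwa [add_assoc, add_comm] at H
    · exact jck_cyclic_one δ 1 a b c ha hb hc
  jordan a ha := by
    apply LinearMap.ext
    rintro ⟨⟨d₀, d₁, d₂, d₃⟩, ⟨e₀, e₁, e₂, e₃⟩⟩
    rw [Superalgebra.innerDer_apply _ ((JCK δ).mul_mem _ _ _ _ ha ha) ha]
    obtain ⟨f, u₁, u₂, u₃, rfl⟩ := jck_mem_even ha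
    simp only [koszul_zero_right, add_zero, one_smul, JCK_mul_apply, jckMul, map_zero, mul_zero,
      zero_mul, sub_zero, zero_add, zero_sub, sub_self, Prod.mk_sub_mk, LinearMap.zero_apply]
    refine Prod.ext (Prod.ext ?_ (Prod.ext ?_ (Prod.ext ?_ ?_)))
      (Prod.ext ?_ (Prod.ext ?_ (Prod.ext ?_ ?_))) <;>
    simp only [map_add, map_sub, map_neg, Derivation.leibniz, smul_eq_mul, Prod.fst_zero,
      Prod.snd_zero] <;>
    ring

/-- The product of the Kantor double of vector type `Z ⊕ Z x`, where `(f, g)` stands for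
`f 1 + g x`: `(f x) (g x) = δ f g - f δ g`. -/
def kantorMul (δ : Derivation F Z Z) : Z × Z → Z × Z → Z × Z
  | (f, g), (f', g') => (f * f' + (δ g * g' - g * δ g'), f * g' + g * f')

/-- The Kantor double superalgebra of vector type `K = Z ⊕ Z x`, a subalgebra of `JCK(Z, δ)`
(see `kantorIncl_mul` below). -/
def KantorK (δ : Derivation F Z Z) : Superalgebra F (Z × Z) where
  part := prodPart F _ _
  isCompl := isCompl_prodPart F _ _
  mul := LinearMap.mk₂ F (kantorMul δ)
    (fun a a' b => by
      ext <;> simp only [kantorMul, Prod.fst_add, Prod.snd_add, map_add] <;> ring)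
    (fun c a b => by
      ext <;> simp only [kantorMul, Prod.smul_fst, Prod.smul_snd, Derivation.map_smul] <;>
        simp only [Algebra.smul_def] <;> ring)
    (fun a b b' => by
      ext <;> simp only [kantorMul, Prod.fst_add, Prod.snd_add, map_add] <;> ring)
    (fun c a b => by
      ext <;> simp only [kantorMul, Prod.smul_fst, Prod.smul_snd, Derivation.map_smul] <;>
        simp only [Algebra.smul_def] <;> ring)
  mul_mem i j a b ha hb := by
    obtain ⟨f, g⟩ := a
    obtain ⟨f', g'⟩ := b
    rcases parity_cases i with rfl | rfl <;> rcases parity_cases j with rfl | rfl <;>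
    simp only [add_zero, zero_add, parity_one_add_one, mem_prodPart_zero,
      mem_prodPart_one] at ha hb ⊢ <;>
    subst ha <;> subst hb <;> simp [kantorMul]

/-- The inclusion of `K = Z ⊕ Z x` in `JCK(Z, δ)`. -/
def kantorIncl (F Z : Type*) [Field F] [CommRing Z] [Algebra F Z] : Z × Z →ₗ[F] JCKSpace Z where
  toFun a := ((a.1, 0, 0, 0), (a.2, 0, 0, 0))
  map_add' a b := by simp
  map_smul' c a := by simp

theorem kantorIncl_injective : Function.Injective (kantorIncl F Z) := by
  rintro ⟨f, g⟩ ⟨f', g'⟩ h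
  simpa [kantorIncl] using h

theorem kantorIncl_mem (δ : Derivation F Z Z) (i : ZMod 2) (a : Z × Z)
    (ha : a ∈ (KantorK δ).part i) : kantorIncl F Z a ∈ (JCK δ).part i := by
  obtain ⟨f, g⟩ := a
  rcases parity_cases i with rfl | rfl
  · obtain rfl : g = 0 := mem_prodPart_zero.1 ha
    exact (mem_prodPart_zero (a := kantorIncl F Z (f, 0))).2 rfl
  · obtain rfl : f = 0 := mem_prodPart_one.1 ha
    exact (mem_prodPart_one (a := kantorIncl F Z (0, g))).2 rfl

/-- The product of `K = Z ⊕ Z x` is the one of `JCK(Z, δ)`. -/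
theorem kantorIncl_mul (δ : Derivation F Z Z) (a b : Z × Z) :
    kantorIncl F Z ((KantorK δ).mul a b) =
      (JCK δ).mul (kantorIncl F Z a) (kantorIncl F Z b) := by
  change kantorIncl F Z (kantorMul δ a b) = jckMul δ _ _
  simp [kantorIncl, kantorMul, jckMul]

theorem KantorK_isJordan (δ : Derivation F Z Z) : (KantorK δ).IsJordan where
  comm i j a b ha hb := by
    apply kantorIncl_injective (F := F)
    rw [map_smul, kantorIncl_mul, kantorIncl_mul]
    exact (JCK_isJordan δ).comm i j _ _ (kantorIncl_mem δ i a ha) (kantorIncl_mem δ j b hb)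
  cyclic i j k a b c ha hb hc := by
    apply LinearMap.ext
    intro d
    have ha' := kantorIncl_mem δ i a ha
    have hb' := kantorIncl_mem δ j b hb
    have hc' := kantorIncl_mem δ k c hc
    have H := congrArg (fun f : Module.End F _ => f (kantorIncl F Z d))
      ((JCK_isJordan δ).cyclic i j k _ _ _ ha' hb' hc')
    apply kantorIncl_injective (F := F)
    simp only [LinearMap.add_apply, LinearMap.smul_apply, LinearMap.zero_apply,
      Superalgebra.innerDer_apply _ ha' ((JCK δ).mul_mem _ _ _ _ hb' hc'),
      Superalgebra.innerDer_apply _ hb' ((JCK δ).mul_mem _ _ _ _ hc' ha'),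
      Superalgebra.innerDer_apply _ hc' ((JCK δ).mul_mem _ _ _ _ ha' hb')] at H
    simp only [LinearMap.add_apply, LinearMap.smul_apply, LinearMap.zero_apply, map_add, map_sub,
      map_smul, map_zero, kantorIncl_mul,
      Superalgebra.innerDer_apply _ ha ((KantorK δ).mul_mem _ _ _ _ hb hc),
      Superalgebra.innerDer_apply _ hb ((KantorK δ).mul_mem _ _ _ _ hc ha),
      Superalgebra.innerDer_apply _ hc ((KantorK δ).mul_mem _ _ _ _ ha hb)]
    exact H
  jordan a ha := by
    apply LinearMap.ext
    intro d
    have ha' := kantorIncl_mem δ 0 a ha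
    have H := congrArg (fun f : Module.End F _ => f (kantorIncl F Z d))
      ((JCK_isJordan δ).jordan _ ha')
    apply kantorIncl_injective (F := F)
    simp only [LinearMap.zero_apply,
      Superalgebra.innerDer_apply _ ((JCK δ).mul_mem _ _ _ _ ha' ha') ha'] at H
    simp only [LinearMap.zero_apply, map_sub, map_smul, map_zero, kantorIncl_mul,
      Superalgebra.innerDer_apply _ ((KantorK δ).mul_mem _ _ _ _ ha ha) ha]
    exact H

end ChengKac

/-! Derivations of `J` are put in a normal form whose parameters are exactly those of the Tits
construction, and the brackets are then compared.

Even derivations: from `D 1 = 0`, `w_i² = ±1` and `w_i w_j = 0` it follows that `D` sends each `w_i`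
to a `Z`-combination of the `w_j`, by a matrix skew for the form `diag(1, 1, -1)`. Every such matrix
is realised by an inner derivation `jckRot p`. What remains annihilates the `w_i`, and is the
extension `jckExtEven d h` of an even derivation `kantorEven d h` of `K`, where `[d, δ] = 2hδ`
(`exists_eq_jckRot_add_jckExtEven`). Odd derivations: `D` is determined by the `x`-coordinates of
the `D w_i` and the `1`-coordinate of `D x`, so it equals `jckOdd q + jckExtOdd m`, and is inner
(`exists_eq_jckOdd_add_jckExtOdd`). On the other side, `Inder(K)_1` consists of the operators
`kantorOdd m`. Thus `p` and `q` supply `so_3 ⊗ Z` and `so_3 ⊗ Zx`, while `(d, h)` and `m` supply the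
derivations of `K`.

In coordinates `so_3` is `F³` with the cross product. The brackets of the operators on `J` have the
same shape, except that `w_3² = -1` replaces the sum of squares by `diag(1, 1, -1)`. Rescaling some
coordinates by a square root `ι` of `-1` removes the difference; the rescaled map is `jckTits`, and
`jck_isIsomorphic_tits` packages the comparison.

The equality `Z = Zδ(Z)` makes every `kantorOdd m` and `jckExtOdd m` inner, and makes an element of
`Z` vanish when it kills `δ(Z)`. For the inner case, an even inner derivation of either algebra acts
on `Z` (up to components outside `Z`) as `kδ`; conversely `d = kδ` forces `h = -δ(k)/2`, which is
`D(-(k/2)x, x)` (`eq_of_mul_derivation`). Derivation algebras are Lie as subalgebras of `gl`, and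
the Tits constructions inherit this through the isomorphisms. -/

namespace Superalgebra

/-! ### Lie superalgebras inside `gl`, and transport along isomorphisms. -/

section General

variable {F A B : Type*} [Field F] [AddCommGroup A] [Module F A] [AddCommGroup B] [Module F B]

theorem superComm_mem_endPart (S : Superalgebra F A) {i j : ZMod 2} {f g : Module.End F A}
    (hf : f ∈ S.endPart i) (hg : g ∈ S.endPart j) : S.superComm f g ∈ S.endPart (i + j) :=
  S.gl.mul_mem i j f g hf hg

/-- For homogeneous endomorphisms the super Jacobi identity is a formal identity in an associative
algebra, once the eight parity patterns fix the signs. -/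
theorem Sub.isLie_toSuperalgebra {S : Superalgebra F A} (T : S.gl.Sub) :
    T.toSuperalgebra.IsLie where
  skew i j f g hf hg := Subtype.ext (S.superComm_skew hf hg)
  jacobi i j k f g h hf hg hh := by
    apply Subtype.ext
    change S.superComm f.1 (S.superComm g.1 h.1) = S.superComm (S.superComm f.1 g.1) h.1 +
      koszul F i j • S.superComm g.1 (S.superComm f.1 h.1)
    have hf' : f.1 ∈ S.endPart i := hf
    have hg' : g.1 ∈ S.endPart j := hg
    have hh' : h.1 ∈ S.endPart k := hh
    rw [S.superComm_of_mem hf' (S.superComm_mem_endPart hg' hh'),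
      S.superComm_of_mem (S.superComm_mem_endPart hf' hg') hh',
      S.superComm_of_mem hg' (S.superComm_mem_endPart hf' hh')]
    rw [S.superComm_of_mem hg' hh', S.superComm_of_mem hf' hg', S.superComm_of_mem hf' hh']
    rcases parity_cases i with rfl | rfl <;> rcases parity_cases j with rfl | rfl <;>
      rcases parity_cases k with rfl | rfl <;>
      simp only [koszul_zero_left, koszul_zero_right, koszul_one_one, parity_one_add_one,
        add_zero, zero_add, one_smul, neg_smul] <;> noncomm_ring
  even_self f hf := by
    apply Subtype.ext
    change S.superComm f.1 f.1 = 0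
    have hf' : f.1 ∈ S.endPart 0 := hf
    rw [S.superComm_of_mem hf' hf', koszul_zero_left, one_smul, sub_self]
  odd_cube f hf := by
    apply Subtype.ext
    change S.superComm f.1 (S.superComm f.1 f.1) = 0
    have hf' : f.1 ∈ S.endPart 1 := hf
    -- For odd `f` one has `[f, f] = 2f²`, which commutes with `f`; no division by `3` is involved.
    rw [S.superComm_of_mem hf' (S.superComm_mem_endPart hf' hf'), S.superComm_of_mem hf' hf']
    simp only [koszul_one_one, parity_one_add_one, koszul_zero_right, one_smul, neg_smul]
    noncomm_ring

/-- This spares a direct proof of the Jacobi identity for the Tits constructions. The isomorphism is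
only assumed to map `S_i` into `T_i`; comparing homogeneous components shows that it maps onto
`T_i`, so every identity may be tested on images of homogeneous elements. -/
theorem IsIsomorphic.isLie {S : Superalgebra F A} {T : Superalgebra F B} (h : S.IsIsomorphic T)
    (hS : S.IsLie) : T.IsLie := by
  obtain ⟨e, he, hmul⟩ := h
  have hpart : ∀ (i : ZMod 2) (b : B), b ∈ T.part i → ∃ a ∈ S.part i, e a = b := by
    intro i b hb
    have h0 : e (S.proj 0 (e.symm b)) + e (S.proj 1 (e.symm b)) = b := by
      rw [← map_add, S.proj_add, e.apply_symm_apply]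
    have m0 := he 0 _ (S.proj_mem 0 (e.symm b))
    have m1 := he 1 _ (S.proj_mem 1 (e.symm b))
    refine ⟨S.proj i (e.symm b), S.proj_mem _ _, ?_⟩
    rcases parity_cases i with rfl | rfl
    · have h1 := congrArg (T.proj 0) h0
      rwa [map_add, T.proj_of_mem m0, T.proj_zero_of_mem m1, add_zero, T.proj_of_mem hb] at h1
    · have h1 := congrArg (T.proj 1) h0
      rwa [map_add, T.proj_one_of_mem m0, T.proj_of_mem m1, zero_add, T.proj_of_mem hb] at h1
  refine ⟨?_, ?_, ?_, ?_⟩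
  · intro i j a b ha hb
    obtain ⟨a, ha', rfl⟩ := hpart i a ha
    obtain ⟨b, hb', rfl⟩ := hpart j b hb
    rw [← hmul, ← hmul, hS.skew i j a b ha' hb', map_neg, map_smul]
  · intro i j k a b c ha hb hc
    obtain ⟨a, ha', rfl⟩ := hpart i a ha
    obtain ⟨b, hb', rfl⟩ := hpart j b hb
    obtain ⟨c, hc', rfl⟩ := hpart k c hc
    simp only [← hmul]
    rw [hS.jacobi i j k a b c ha' hb' hc', map_add, map_smul]
  · intro a ha
    obtain ⟨a, ha', rfl⟩ := hpart 0 a ha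
    rw [← hmul, hS.even_self a ha', map_zero]
  · intro a ha
    obtain ⟨a, ha', rfl⟩ := hpart 1 a ha
    rw [← hmul, ← hmul, hS.odd_cube a ha', map_zero]

/-- Projecting to degree `i` kills the summand from the other `P`. This lets a homogeneous element
of `Der` or `Inder` be treated as an element of `derPart` or `inderPart`. -/
theorem Sub.mem_ofParts (S : Superalgebra F A) (P : ZMod 2 → Submodule F A)
    (hP : ∀ i, P i ≤ S.part i)
    (hmul : ∀ (i j : ZMod 2) (a b : A), a ∈ P i → b ∈ P j → S.mul a b ∈ P (i + j))
    {i : ZMod 2} {a : A} (ha : a ∈ (Sub.ofParts S P hP hmul).carrier) (hi : a ∈ S.part i) :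
    a ∈ P i := by
  obtain ⟨x, hx, y, hy, rfl⟩ := Submodule.mem_sup.1 ha
  rcases parity_cases i with rfl | rfl
  · have h := S.proj_of_mem hi
    rw [map_add, S.proj_of_mem (hP 0 hx), S.proj_zero_of_mem (hP 1 hy), add_zero] at h
    rwa [← h]
  · have h := S.proj_of_mem hi
    rw [map_add, S.proj_of_mem (hP 1 hy), S.proj_one_of_mem (hP 0 hx), zero_add] at h
    rwa [← h]

/-- A homogeneous injective homomorphism onto a graded subalgebra gives an isomorphism. -/
theorem Sub.isIsomorphic_of_range_eq {S : Superalgebra F A} (T : S.Sub) (U : Superalgebra F B)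
    (φ : B →ₗ[F] A) (hinj : Function.Injective φ) (hrange : LinearMap.range φ = T.carrier)
    (hpart : ∀ (i : ZMod 2) (b : B), b ∈ U.part i → φ b ∈ S.part i)
    (hmul : ∀ (i j : ZMod 2) (a b : B), a ∈ U.part i → b ∈ U.part j →
      φ (U.mul a b) = S.mul (φ a) (φ b)) :
    T.toSuperalgebra.IsIsomorphic U := by
  have hmul' : ∀ a b : B, φ (U.mul a b) = S.mul (φ a) (φ b) := by
    intro a b
    rw [← U.proj_add a, ← U.proj_add b]
    simp only [map_add, LinearMap.add_apply,
      hmul _ _ _ _ (U.proj_mem _ a) (U.proj_mem _ b)]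
  let e : B ≃ₗ[F] T.carrier :=
    (LinearEquiv.ofInjective φ hinj).trans (LinearEquiv.ofEq _ _ hrange)
  have he : ∀ b, ((e b : T.carrier) : A) = φ b := fun b => rfl
  refine ⟨e.symm, fun i a ha => ?_, fun a b => ?_⟩
  -- The component of the preimage in the degree of `a` already maps to `a`, so by injectivity it is
  -- the whole preimage.
  · have h0 : φ (U.proj 0 (e.symm a)) + φ (U.proj 1 (e.symm a)) = a := by
      rw [← map_add, U.proj_add, ← he, e.apply_symm_apply]
    have m0 := hpart 0 _ (U.proj_mem 0 (e.symm a))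
    have m1 := hpart 1 _ (U.proj_mem 1 (e.symm a))
    have ha' : a.1 ∈ S.part i := ha
    rcases parity_cases i with rfl | rfl
    · have h1 := congrArg (S.proj 0) h0
      rw [map_add, S.proj_of_mem m0, S.proj_zero_of_mem m1, add_zero, S.proj_of_mem ha'] at h1
      have : e.symm a = U.proj 0 (e.symm a) := by
        apply hinj
        rw [h1, ← he, e.apply_symm_apply]
      rw [this]
      exact U.proj_mem _ _
    · have h1 := congrArg (S.proj 1) h0
      rw [map_add, S.proj_one_of_mem m0, S.proj_of_mem m1, zero_add, S.proj_of_mem ha'] at h1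
      have : e.symm a = U.proj 1 (e.symm a) := by
        apply hinj
        rw [h1, ← he, e.apply_symm_apply]
      rw [this]
      exact U.proj_mem _ _
  · apply hinj
    rw [hmul', ← he, ← he, ← he]
    simp only [e.apply_symm_apply]
    rfl

end General
end Superalgebra

/-! ### Coordinates on `so_3 ⊗ A`: cross product and dot product. -/

section SO3

variable (F : Type*) [Field F]

/-- The skew-symmetric matrix of the map `v ↦ c × v`. -/
def so3Mk (c : F × F × F) : SO3 F :=
  ⟨!![0, -c.2.2, c.2.1; c.2.2, 0, -c.1; -c.2.1, c.1, 0], by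
    rw [LieAlgebra.Orthogonal.mem_so]
    ext i j
    fin_cases i <;> fin_cases j <;> simp⟩

variable {F}

/-- Skew-symmetry only gives `2 X_ii = 0`; characteristic different from `2` is what makes `so_3`
three-dimensional. -/
theorem so3_eq_mk (hF : ringChar F ≠ 2) (X : SO3 F) :
    X = so3Mk F (X.1 2 1, X.1 0 2, X.1 1 0) := by
  have h := (LieAlgebra.Orthogonal.mem_so _ _ X.1).1 X.2
  have hij : ∀ i j, X.1 j i = - X.1 i j := fun i j => congrFun (congrFun h i) j
  have hii : ∀ i, X.1 i i = 0 := fun i => by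
    have h2 := hij i i
    have h3 : (2 : F) * X.1 i i = 0 := by linear_combination h2
    exact (mul_eq_zero.1 h3).resolve_left (Ring.two_ne_zero hF)
  apply Subtype.ext
  ext i j
  fin_cases i <;> fin_cases j <;> simp [so3Mk, hii, hij 1 2, hij 2 0, hij 0 1]

theorem so3Mk_lie (c d : F × F × F) :
    ⁅so3Mk F c, so3Mk F d⁆ = so3Mk F (c.2.1 * d.2.2 - c.2.2 * d.2.1,
      c.2.2 * d.1 - c.1 * d.2.2, c.1 * d.2.1 - c.2.1 * d.1) := by
  apply Subtype.ext
  change (so3Mk F c).1 * (so3Mk F d).1 - (so3Mk F d).1 * (so3Mk F c).1 = _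
  ext i j
  fin_cases i <;> fin_cases j <;>
    simp [so3Mk, Matrix.mul_apply, Fin.sum_univ_three] <;> ring

/-- The factor `-2` cancels the `1/2` of the Tits bracket, so that the trace term becomes minus a
dot product in `so3Der_vec`. -/
theorem so3Mk_trace (c d : F × F × F) :
    ((so3Mk F c).1 * (so3Mk F d).1).trace =
      -(2 * (c.1 * d.1 + c.2.1 * d.2.1 + c.2.2 * d.2.2)) := by
  simp [so3Mk, Matrix.trace, Matrix.mul_apply, Fin.sum_univ_three]; ring

variable {A : Type*} [AddCommGroup A] [Module F A]

variable (F A) in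
/-- The coordinates of an element of `so_3 ⊗ A`. -/
noncomputable def so3Coord : SO3 F ⊗[F] A →ₗ[F] A × A × A :=
  TensorProduct.lift (LinearMap.mk₂ F
    (fun X a => (X.1 2 1 • a, X.1 0 2 • a, X.1 1 0 • a))
    (fun X X' a => by simp [add_smul]) (fun c X a => by simp [mul_smul])
    (fun X a b => by simp) (fun c X a => by simp [smul_comm c]))

/-- The element of `so_3 ⊗ A` with given coordinates. -/
noncomputable def so3Vec (F : Type*) [Field F] {A : Type*} [AddCommGroup A] [Module F A]
    (a : A × A × A) : SO3 F ⊗[F] A :=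
  so3Mk F (1, 0, 0) ⊗ₜ a.1 + so3Mk F (0, 1, 0) ⊗ₜ a.2.1 + so3Mk F (0, 0, 1) ⊗ₜ a.2.2

theorem so3Coord_vec (a : A × A × A) : so3Coord F A (so3Vec F a) = a := by
  simp [so3Coord, so3Vec, so3Mk]

theorem so3Mk_eq (c : F × F × F) : so3Mk F c =
    c.1 • so3Mk F (1, 0, 0) + c.2.1 • so3Mk F (0, 1, 0) + c.2.2 • so3Mk F (0, 0, 1) := by
  apply Subtype.ext
  ext i j
  fin_cases i <;> fin_cases j <;> simp [so3Mk]

theorem so3Vec_coord (hF : ringChar F ≠ 2) (u : SO3 F ⊗[F] A) :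
    so3Vec F (so3Coord F A u) = u := by
  induction u using TensorProduct.induction_on with
  | zero => simp [so3Vec]
  | tmul X a =>
    conv_rhs => rw [so3_eq_mk hF X, so3Mk_eq]
    simp [so3Vec, so3Coord, TensorProduct.add_tmul, TensorProduct.smul_tmul]
  | add x y hx hy =>
    conv_rhs => rw [← hx, ← hy]
    simp only [so3Vec, map_add, Prod.fst_add, Prod.snd_add, TensorProduct.tmul_add]
    abel

theorem so3Coord_tmul_mk (c : F × F × F) (a : A) :
    so3Coord F A (so3Mk F c ⊗ₜ a) = (c.1 • a, c.2.1 • a, c.2.2 • a) := by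
  simp [so3Coord, so3Mk]

theorem so3Coord_lTensor (f : Module.End F A) (u : SO3 F ⊗[F] A) :
    so3Coord F A (f.lTensor (SO3 F) u) =
      (f (so3Coord F A u).1, f (so3Coord F A u).2.1, f (so3Coord F A u).2.2) := by
  induction u using TensorProduct.induction_on with
  | zero => simp only [map_zero]; simp; rfl
  | tmul X a => simp [so3Coord]
  | add x y hx hy => simp [hx, hy]

end SO3

namespace Superalgebra

variable {F A : Type*} [Field F] [AddCommGroup A] [Module F A]

/-- In coordinates the product on `so_3 ⊗ A` is the cross product of triples with entries in `A`.
The order of factors is kept, since `A` is only supercommutative. -/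
theorem so3Coord_so3Mul (S : Superalgebra F A) (a b : A × A × A) :
    so3Coord F A (S.so3Mul (so3Vec F a) (so3Vec F b)) =
      (S.mul a.2.1 b.2.2 - S.mul a.2.2 b.2.1, S.mul a.2.2 b.1 - S.mul a.1 b.2.2,
        S.mul a.1 b.2.1 - S.mul a.2.1 b.1) := by
  simp only [so3Vec, map_add, LinearMap.add_apply, so3Mul_tmul, so3Mk_lie, so3Coord_tmul_mk]
  simp
  refine ⟨?_, ?_, ?_⟩ <;> abel

theorem so3Der_vec (hF : ringChar F ≠ 2) (S : Superalgebra F A) (a b : A × A × A) :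
    S.so3Der (so3Vec F a) (so3Vec F b) =
      -(S.innerDer a.1 b.1 + S.innerDer a.2.1 b.2.1 + S.innerDer a.2.2 b.2.2) := by
  have h2 : (2 : F) ≠ 0 := Ring.two_ne_zero hF
  simp only [so3Vec, map_add, LinearMap.add_apply, so3Der_tmul, so3Mk_trace]
  simp [h2]
  abel

theorem so3Coord_mem_of_mem (S : Superalgebra F A) {i : ZMod 2} {u : SO3 F ⊗[F] A}
    (hu : u ∈ S.so3Part i) : (so3Coord F A u).1 ∈ S.part i ∧ (so3Coord F A u).2.1 ∈ S.part i ∧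
      (so3Coord F A u).2.2 ∈ S.part i := by
  refine S.so3Part_induction (P := fun u => (so3Coord F A u).1 ∈ S.part i ∧
    (so3Coord F A u).2.1 ∈ S.part i ∧ (so3Coord F A u).2.2 ∈ S.part i) hu (by simp) ?_ ?_
  · intro X a ha
    exact ⟨Submodule.smul_mem _ _ ha, Submodule.smul_mem _ _ ha, Submodule.smul_mem _ _ ha⟩
  · intro u v hu hv
    rw [map_add]
    exact ⟨add_mem hu.1 hv.1, add_mem hu.2.1 hv.2.1, add_mem hu.2.2 hv.2.2⟩

end Superalgebra

section ChengKac

variable {F Z : Type*} [Field F] [CommRing Z] [Algebra F Z]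

/-! ### Explicit operators on `K` and on `JCK(Z, δ)`. -/

section Operators

variable (F Z) in
/-- The map `f ↦ f w₁`. -/
def jckW₁ : Z →ₗ[F] JCKSpace Z where
  toFun f := ((0, f, 0, 0), (0, 0, 0, 0))
  map_add' _ _ := by simp
  map_smul' _ _ := by simp

variable (F Z) in
/-- The map `f ↦ f w₂`. -/
def jckW₂ : Z →ₗ[F] JCKSpace Z where
  toFun f := ((0, 0, f, 0), (0, 0, 0, 0))
  map_add' _ _ := by simp
  map_smul' _ _ := by simp

variable (F Z) in
/-- The map `f ↦ f w₃`. -/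
def jckW₃ : Z →ₗ[F] JCKSpace Z where
  toFun f := ((0, 0, 0, f), (0, 0, 0, 0))
  map_add' _ _ := by simp
  map_smul' _ _ := by simp

variable (F Z) in
/-- The map `f ↦ f x`. -/
def jckX : Z →ₗ[F] JCKSpace Z where
  toFun f := ((0, 0, 0, 0), (f, 0, 0, 0))
  map_add' _ _ := by simp
  map_smul' _ _ := by simp

theorem jckW₁_mem (δ : Derivation F Z Z) (f : Z) : jckW₁ F Z f ∈ (JCK δ).part 0 :=
  (mem_prodPart_zero (a := jckW₁ F Z f)).2 rfl

theorem jckW₂_mem (δ : Derivation F Z Z) (f : Z) : jckW₂ F Z f ∈ (JCK δ).part 0 :=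
  (mem_prodPart_zero (a := jckW₂ F Z f)).2 rfl

theorem jckW₃_mem (δ : Derivation F Z Z) (f : Z) : jckW₃ F Z f ∈ (JCK δ).part 0 :=
  (mem_prodPart_zero (a := jckW₃ F Z f)).2 rfl

theorem jckX_mem (δ : Derivation F Z Z) (f : Z) : jckX F Z f ∈ (JCK δ).part 1 :=
  (mem_prodPart_one (a := jckX F Z f)).2 rfl

theorem jck_mem_part_zero (δ : Derivation F Z Z) (a u₁ u₂ u₃ : Z) :
    ((a, u₁, u₂, u₃), (0, 0, 0, 0)) ∈ (JCK δ).part 0 :=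
  (mem_prodPart_zero (a := (((a, u₁, u₂, u₃), (0, 0, 0, 0)) : JCKSpace Z))).2 rfl

theorem jck_mem_part_one (δ : Derivation F Z Z) (b v₁ v₂ v₃ : Z) :
    ((0, 0, 0, 0), (b, v₁, v₂, v₃)) ∈ (JCK δ).part 1 :=
  (mem_prodPart_one (a := (((0, 0, 0, 0), (b, v₁, v₂, v₃)) : JCKSpace Z))).2 rfl

theorem KantorK_mul_apply (δ : Derivation F Z Z) (a b : Z × Z) :
    (KantorK δ).mul a b = kantorMul δ a b := rfl

theorem kantor_mem_part_zero (δ : Derivation F Z Z) (a : Z) : (a, 0) ∈ (KantorK δ).part 0 :=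
  (mem_prodPart_zero (a := ((a, 0) : Z × Z))).2 rfl

theorem kantor_mem_part_one (δ : Derivation F Z Z) (a : Z) : (0, a) ∈ (KantorK δ).part 1 :=
  (mem_prodPart_one (a := ((0, a) : Z × Z))).2 rfl

/-- The even inner derivation `-(D(p₁ w₂, w₃) + D(p₂ w₃, w₁) + D(p₃ w₁, w₂))` of `JCK(Z, δ)`. -/
noncomputable def jckRot (δ : Derivation F Z Z) : Z × Z × Z →ₗ[F] Module.End F (JCKSpace Z) :=
  -(((JCK δ).innerDer.flip (jckW₃ F Z 1)).comp ((jckW₂ F Z).comp (LinearMap.fst F Z (Z × Z))) +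
    ((JCK δ).innerDer.flip (jckW₁ F Z 1)).comp ((jckW₃ F Z).comp
      ((LinearMap.fst F Z Z).comp (LinearMap.snd F Z (Z × Z)))) +
    ((JCK δ).innerDer.flip (jckW₂ F Z 1)).comp ((jckW₁ F Z).comp
      ((LinearMap.snd F Z Z).comp (LinearMap.snd F Z (Z × Z)))))

/-- The odd inner derivation `D(w₁, q₁ x) + D(w₂, q₂ x) + D(w₃, q₃ x)` of `JCK(Z, δ)`. -/
noncomputable def jckOdd (δ : Derivation F Z Z) : Z × Z × Z →ₗ[F] Module.End F (JCKSpace Z) :=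
  ((JCK δ).innerDer (jckW₁ F Z 1)).comp ((jckX F Z).comp (LinearMap.fst F Z (Z × Z))) +
    ((JCK δ).innerDer (jckW₂ F Z 1)).comp ((jckX F Z).comp
      ((LinearMap.fst F Z Z).comp (LinearMap.snd F Z (Z × Z)))) +
    ((JCK δ).innerDer (jckW₃ F Z 1)).comp ((jckX F Z).comp
      ((LinearMap.snd F Z Z).comp (LinearMap.snd F Z (Z × Z))))

theorem jckRot_eq (δ : Derivation F Z Z) (p : Z × Z × Z) :
    jckRot δ p = -((JCK δ).innerDer (jckW₂ F Z p.1) (jckW₃ F Z 1) +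
      (JCK δ).innerDer (jckW₃ F Z p.2.1) (jckW₁ F Z 1) +
      (JCK δ).innerDer (jckW₁ F Z p.2.2) (jckW₂ F Z 1)) := by
  simp [jckRot]

theorem jckOdd_eq (δ : Derivation F Z Z) (q : Z × Z × Z) :
    jckOdd δ q = (JCK δ).innerDer (jckW₁ F Z 1) (jckX F Z q.1) +
      (JCK δ).innerDer (jckW₂ F Z 1) (jckX F Z q.2.1) +
      (JCK δ).innerDer (jckW₃ F Z 1) (jckX F Z q.2.2) := by
  simp [jckOdd]

theorem jckRot_mem_inderPart (δ : Derivation F Z Z) (p : Z × Z × Z) :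
    jckRot δ p ∈ (JCK δ).inderPart 0 := by
  rw [jckRot_eq]
  refine neg_mem (add_mem (add_mem ?_ ?_) ?_) <;> refine Submodule.subset_span ⟨0, 0, rfl, ?_⟩
  · exact ⟨_, jckW₂_mem δ _, _, jckW₃_mem δ _, rfl⟩
  · exact ⟨_, jckW₃_mem δ _, _, jckW₁_mem δ _, rfl⟩
  · exact ⟨_, jckW₁_mem δ _, _, jckW₂_mem δ _, rfl⟩

theorem jckOdd_mem_inderPart (δ : Derivation F Z Z) (q : Z × Z × Z) :
    jckOdd δ q ∈ (JCK δ).inderPart 1 := by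
  rw [jckOdd_eq]
  refine add_mem (add_mem ?_ ?_) ?_ <;> refine Submodule.subset_span ⟨0, 1, rfl, ?_⟩
  · exact ⟨_, jckW₁_mem δ _, _, jckX_mem δ _, rfl⟩
  · exact ⟨_, jckW₂_mem δ _, _, jckX_mem δ _, rfl⟩
  · exact ⟨_, jckW₃_mem δ _, _, jckX_mem δ _, rfl⟩

/-- The matrix on the `w_i` is the general matrix over `Z` with zero diagonal that is skew for
`diag(1, 1, -1)`, the form given by the squares of the `w_i`. The operator vanishes on `Z`, and it
sends `x` to a combination of the `x_i` with coefficients `±δ p_i`. -/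
theorem jckRot_apply (δ : Derivation F Z Z) (p₁ p₂ p₃ a u₁ u₂ u₃ b v₁ v₂ v₃ : Z) :
    jckRot δ (p₁, p₂, p₃) ((a, u₁, u₂, u₃), (b, v₁, v₂, v₃)) =
      ((0, -p₃ * u₂ - p₂ * u₃, p₃ * u₁ + p₁ * u₃, -p₂ * u₁ + p₁ * u₂),
       (0, -δ p₁ * b - p₃ * v₂ - p₂ * v₃, -δ p₂ * b + p₃ * v₁ + p₁ * v₃,
        δ p₃ * b - p₂ * v₁ + p₁ * v₂)) := by
  simp only [jckRot_eq, LinearMap.neg_apply, LinearMap.add_apply,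
    (JCK δ).innerDer_apply (jckW₂_mem δ _) (jckW₃_mem δ _),
    (JCK δ).innerDer_apply (jckW₃_mem δ _) (jckW₁_mem δ _),
    (JCK δ).innerDer_apply (jckW₁_mem δ _) (jckW₂_mem δ _), koszul_zero_left, one_smul]
  simp only [LinearMap.sub_apply, JCK_mul_apply, jckW₁, jckW₂, jckW₃, LinearMap.coe_mk,
    AddHom.coe_mk, jckMul]
  refine Prod.ext (Prod.ext ?_ (Prod.ext ?_ (Prod.ext ?_ ?_)))
      (Prod.ext ?_ (Prod.ext ?_ (Prod.ext ?_ ?_))) <;> simp <;> ring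

/-- The image of `w_i` is `-q_i x` for `i = 1, 2` and `q_3 x` for `i = 3`, and the image of `x` has
no `1`-coordinate. These values later single out `q` inside an arbitrary odd derivation. -/
theorem jckOdd_apply (δ : Derivation F Z Z) (q₁ q₂ q₃ a u₁ u₂ u₃ b v₁ v₂ v₃ : Z) :
    jckOdd δ (q₁, q₂, q₃) ((a, u₁, u₂, u₃), (b, v₁, v₂, v₃)) =
      ((-q₁ * v₁ - q₂ * v₂ + q₃ * v₃,
        δ q₁ * b - q₁ * δ b + q₂ * v₃ - q₃ * v₂,
        δ q₂ * b - q₂ * δ b - q₁ * v₃ + q₃ * v₁,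
        δ q₃ * b - q₃ * δ b - q₁ * v₂ + q₂ * v₁),
       (-q₁ * u₁ - q₂ * u₂ + q₃ * u₃,
        -q₁ * δ a + q₂ * δ u₃ - q₃ * δ u₂,
        -q₂ * δ a - q₁ * δ u₃ + q₃ * δ u₁,
        -q₃ * δ a - q₁ * δ u₂ + q₂ * δ u₁)) := by
  simp only [jckOdd_eq, LinearMap.neg_apply, LinearMap.add_apply,
    (JCK δ).innerDer_apply (jckW₂_mem δ _) (jckX_mem δ _),
    (JCK δ).innerDer_apply (jckW₃_mem δ _) (jckX_mem δ _),
    (JCK δ).innerDer_apply (jckW₁_mem δ _) (jckX_mem δ _), koszul_zero_left, one_smul]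
  simp only [LinearMap.sub_apply, JCK_mul_apply, jckW₁, jckW₂, jckW₃, jckX, LinearMap.coe_mk,
    AddHom.coe_mk, jckMul]
  refine Prod.ext (Prod.ext ?_ (Prod.ext ?_ (Prod.ext ?_ ?_)))
      (Prod.ext ?_ (Prod.ext ?_ (Prod.ext ?_ ?_))) <;> simp <;> ring

/-- The even operator `f ↦ d f`, `f x ↦ (d f + h f) x` of `K`. -/
def kantorEven (d : Derivation F Z Z) (h : Z) : Module.End F (Z × Z) where
  toFun a := (d a.1, d a.2 + h * a.2)
  map_add' a b := by ext <;> simp <;> ring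
  map_smul' c a := by ext <;> simp

/-- The odd operator `f ↦ 0`, `f x ↦ m f` of `K`. -/
def kantorOdd (F : Type*) {Z : Type*} [Field F] [CommRing Z] [Algebra F Z] (m : Z) :
    Module.End F (Z × Z) where
  toFun a := (m * a.2, 0)
  map_add' a b := by ext <;> simp; ring
  map_smul' c a := by ext <;> simp

/-- The even operator `f ↦ d f`, `f w_i ↦ d f w_i`, `f x ↦ (d f + h f) x`,
`f x_i ↦ (d f - h f) x_i` of `JCK(Z, δ)`. -/
def jckExtEven (d : Derivation F Z Z) (h : Z) : Module.End F (JCKSpace Z) where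
  toFun a := ((d a.1.1, d a.1.2.1, d a.1.2.2.1, d a.1.2.2.2),
    (d a.2.1 + h * a.2.1, d a.2.2.1 - h * a.2.2.1, d a.2.2.2.1 - h * a.2.2.2.1,
      d a.2.2.2.2 - h * a.2.2.2.2))
  map_add' a b := by ext <;> simp <;> ring
  map_smul' c a := by ext <;> simp [smul_sub]

/-- The odd operator `f ↦ 0`, `f w_i ↦ -(m f) x_i`, `f x ↦ m f`, `f x_i ↦ 0` of `JCK(Z, δ)`. -/
def jckExtOdd (F : Type*) {Z : Type*} [Field F] [CommRing Z] [Algebra F Z] (m : Z) :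
    Module.End F (JCKSpace Z) where
  toFun a := ((m * a.2.1, 0, 0, 0), (0, -m * a.1.2.1, -m * a.1.2.2.1, -m * a.1.2.2.2))
  map_add' a b := by ext <;> simp <;> ring
  map_smul' c a := by ext <;> simp

theorem kantorEven_apply (d : Derivation F Z Z) (h a b : Z) :
    kantorEven d h (a, b) = (d a, d b + h * b) := rfl

theorem kantorOdd_apply (m a b : Z) : kantorOdd F m (a, b) = (m * b, 0) := rfl

theorem jckExtEven_apply (d : Derivation F Z Z) (h a u₁ u₂ u₃ b v₁ v₂ v₃ : Z) :
    jckExtEven d h ((a, u₁, u₂, u₃), (b, v₁, v₂, v₃)) =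
      ((d a, d u₁, d u₂, d u₃), (d b + h * b, d v₁ - h * v₁, d v₂ - h * v₂, d v₃ - h * v₃)) :=
  rfl

theorem jckExtOdd_apply (m a u₁ u₂ u₃ b v₁ v₂ v₃ : Z) :
    jckExtOdd F m ((a, u₁, u₂, u₃), (b, v₁, v₂, v₃)) =
      ((m * b, 0, 0, 0), (0, -m * u₁, -m * u₂, -m * u₃)) := rfl

theorem kantorEven_mem (δ d : Derivation F Z Z) (h : Z) :
    kantorEven d h ∈ (KantorK δ).endPart 0 := by
  intro j a ha
  obtain ⟨a, b⟩ := a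
  rcases parity_cases j with rfl | rfl
  · obtain rfl : b = 0 := mem_prodPart_zero.1 ha
    simpa [kantorEven_apply] using kantor_mem_part_zero δ (d a)
  · obtain rfl : a = 0 := mem_prodPart_one.1 ha
    simpa [kantorEven_apply] using kantor_mem_part_one δ (d b + h * b)

theorem kantorOdd_mem (δ : Derivation F Z Z) (m : Z) :
    kantorOdd F m ∈ (KantorK δ).endPart 1 := by
  intro j a ha
  obtain ⟨a, b⟩ := a
  rcases parity_cases j with rfl | rfl
  · obtain rfl : b = 0 := mem_prodPart_zero.1 ha
    simpa [kantorOdd_apply] using kantor_mem_part_one δ 0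
  · obtain rfl : a = 0 := mem_prodPart_one.1 ha
    simpa [kantorOdd_apply, parity_one_add_one] using kantor_mem_part_zero δ (m * b)

theorem jckExtEven_mem (δ d : Derivation F Z Z) (h : Z) :
    jckExtEven d h ∈ (JCK δ).endPart 0 := by
  intro j a ha
  rcases jck_mem_cases ha with ⟨rfl, a, u₁, u₂, u₃, rfl⟩ | ⟨rfl, b, v₁, v₂, v₃, rfl⟩
  · simpa [jckExtEven_apply] using jck_mem_part_zero δ (d a) (d u₁) (d u₂) (d u₃)
  · simpa [jckExtEven_apply] using jck_mem_part_one δ _ _ _ _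

theorem jckExtOdd_mem (δ : Derivation F Z Z) (m : Z) :
    jckExtOdd F m ∈ (JCK δ).endPart 1 := by
  intro j a ha
  rcases jck_mem_cases ha with ⟨rfl, a, u₁, u₂, u₃, rfl⟩ | ⟨rfl, b, v₁, v₂, v₃, rfl⟩
  · simpa [jckExtOdd_apply] using jck_mem_part_one δ _ _ _ _
  · simpa [jckExtOdd_apply, parity_one_add_one] using jck_mem_part_zero δ (m * b) 0 0 0

theorem jckRot_mem (δ : Derivation F Z Z) (p : Z × Z × Z) : jckRot δ p ∈ (JCK δ).endPart 0 :=
  (JCK δ).inderPart_le_endPart 0 (jckRot_mem_inderPart δ p)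

theorem jckOdd_mem (δ : Derivation F Z Z) (q : Z × Z × Z) : jckOdd δ q ∈ (JCK δ).endPart 1 :=
  (JCK δ).inderPart_le_endPart 1 (jckOdd_mem_inderPart δ q)

end Operators

/-! ### Supercommutators of the operators. -/

section Brackets

variable (δ : Derivation F Z Z)

theorem kantorEven_comm_even (d d' : Derivation F Z Z) (h h' : Z) :
    (KantorK δ).superComm (kantorEven d h) (kantorEven d' h') =
      kantorEven ⁅d, d'⁆ (d h' - d' h) := by
  rw [(KantorK δ).superComm_of_mem (kantorEven_mem δ d h) (kantorEven_mem δ d' h')]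
  apply LinearMap.ext
  rintro ⟨a, b⟩
  simp only [koszul_zero_left, one_smul, LinearMap.sub_apply, Module.End.mul_apply,
    kantorEven_apply, Derivation.commutator_apply]
  refine Prod.ext ?_ ?_ <;> simp <;> ring

theorem kantorEven_comm_odd (d : Derivation F Z Z) (h m : Z) :
    (KantorK δ).superComm (kantorEven d h) (kantorOdd F m) = kantorOdd F (d m - h * m) := by
  rw [(KantorK δ).superComm_of_mem (kantorEven_mem δ d h) (kantorOdd_mem δ m)]
  apply LinearMap.ext
  rintro ⟨a, b⟩
  simp only [koszul_zero_left, one_smul, LinearMap.sub_apply, Module.End.mul_apply,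
    kantorEven_apply, kantorOdd_apply]
  refine Prod.ext ?_ ?_ <;> simp; ring

theorem kantorOdd_comm_odd (m m' : Z) :
    (KantorK δ).superComm (kantorOdd F m) (kantorOdd F m') = 0 := by
  rw [(KantorK δ).superComm_of_mem (kantorOdd_mem δ m) (kantorOdd_mem δ m')]
  apply LinearMap.ext
  rintro ⟨a, b⟩
  simp [koszul_one_one, kantorOdd_apply]

theorem kantor_innerDer_even_even (s s' : Z) : (KantorK δ).innerDer (s, 0) (s', 0) = 0 := by
  apply LinearMap.ext
  rintro ⟨a, b⟩
  rw [(KantorK δ).innerDer_apply (kantor_mem_part_zero δ s) (kantor_mem_part_zero δ s')]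
  simp [KantorK_mul_apply, kantorMul, koszul_zero_left]
  constructor <;> ring

theorem kantor_innerDer_even_odd (s t : Z) :
    (KantorK δ).innerDer (s, 0) (0, t) = kantorOdd F (t * δ s) := by
  apply LinearMap.ext
  rintro ⟨a, b⟩
  rw [(KantorK δ).innerDer_apply (kantor_mem_part_zero δ s) (kantor_mem_part_one δ t)]
  simp [KantorK_mul_apply, kantorMul, koszul_zero_left, kantorOdd_apply]
  constructor <;> ring

/-- Only the product `t t'` enters, so a single pair with `t' = 1` yields every even operator of
this shape. -/
theorem kantor_innerDer_odd_odd (t t' : Z) : (KantorK δ).innerDer (0, t) (0, t') =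
    kantorEven ((-(2 * (t * t'))) • δ) (δ (t * t')) := by
  apply LinearMap.ext
  rintro ⟨a, b⟩
  rw [(KantorK δ).innerDer_apply (kantor_mem_part_one δ t) (kantor_mem_part_one δ t')]
  simp [KantorK_mul_apply, kantorMul, koszul_one_one, kantorEven_apply]
  constructor <;> ring

theorem jck_innerDer_even_odd (s t : Z) :
    (JCK δ).innerDer (kantorIncl F Z (s, 0)) (jckX F Z t) = jckExtOdd F (t * δ s) := by
  apply LinearMap.ext
  rintro ⟨⟨a, u₁, u₂, u₃⟩, ⟨b, v₁, v₂, v₃⟩⟩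
  rw [(JCK δ).innerDer_apply (kantorIncl_mem δ 0 _ (kantor_mem_part_zero δ s)) (jckX_mem δ t)]
  simp only [JCK_mul_apply, kantorIncl, jckX, LinearMap.coe_mk, AddHom.coe_mk, jckMul,
    koszul_zero_left, one_smul, jckExtOdd_apply]
  refine Prod.ext (Prod.ext ?_ (Prod.ext ?_ (Prod.ext ?_ ?_)))
      (Prod.ext ?_ (Prod.ext ?_ (Prod.ext ?_ ?_))) <;> simp <;> ring

theorem jck_innerDer_odd_odd (t t' : Z) : (JCK δ).innerDer (jckX F Z t) (jckX F Z t') =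
    jckExtEven ((-(2 * (t * t'))) • δ) (δ (t * t')) := by
  apply LinearMap.ext
  rintro ⟨⟨a, u₁, u₂, u₃⟩, ⟨b, v₁, v₂, v₃⟩⟩
  rw [(JCK δ).innerDer_apply (jckX_mem δ t) (jckX_mem δ t')]
  simp only [JCK_mul_apply, jckX, LinearMap.coe_mk, AddHom.coe_mk, jckMul,
    koszul_one_one, jckExtEven_apply]
  refine Prod.ext (Prod.ext ?_ (Prod.ext ?_ (Prod.ext ?_ ?_)))
      (Prod.ext ?_ (Prod.ext ?_ (Prod.ext ?_ ?_))) <;> simp <;> ring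

/-- This is the cross product except for the sign of the third coordinate, the trace left by `w_3² =
-1`. -/
theorem jckRot_comm_rot (p₁ p₂ p₃ p₁' p₂' p₃' : Z) :
    (JCK δ).superComm (jckRot δ (p₁, p₂, p₃)) (jckRot δ (p₁', p₂', p₃')) =
      jckRot δ (p₂ * p₃' - p₃ * p₂', p₃ * p₁' - p₁ * p₃', -(p₁ * p₂' - p₂ * p₁')) := by
  rw [(JCK δ).superComm_of_mem (jckRot_mem δ _) (jckRot_mem δ _)]
  apply LinearMap.ext
  rintro ⟨⟨a, u₁, u₂, u₃⟩, ⟨b, v₁, v₂, v₃⟩⟩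
  simp only [koszul_zero_left, one_smul, LinearMap.sub_apply, Module.End.mul_apply, jckRot_apply]
  refine Prod.ext (Prod.ext ?_ (Prod.ext ?_ (Prod.ext ?_ ?_)))
      (Prod.ext ?_ (Prod.ext ?_ (Prod.ext ?_ ?_))) <;> simp <;> ring

/-- The `jckExtOdd` term plays the part of the trace term of the Tits bracket, since `D(s, t x) =
kantorOdd (t δ s)` in `K`. -/
theorem jckRot_comm_odd (p₁ p₂ p₃ q₁ q₂ q₃ : Z) :
    (JCK δ).superComm (jckRot δ (p₁, p₂, p₃)) (jckOdd δ (q₁, q₂, q₃)) =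
      jckOdd δ (-p₂ * q₃ - p₃ * q₂, p₃ * q₁ + p₁ * q₃, p₁ * q₂ - p₂ * q₁) -
        jckExtOdd F (q₁ * δ p₁ + q₂ * δ p₂ + q₃ * δ p₃) := by
  rw [(JCK δ).superComm_of_mem (jckRot_mem δ _) (jckOdd_mem δ _)]
  apply LinearMap.ext
  rintro ⟨⟨a, u₁, u₂, u₃⟩, ⟨b, v₁, v₂, v₃⟩⟩
  simp only [koszul_zero_left, one_smul, LinearMap.sub_apply, Module.End.mul_apply, jckRot_apply,
    jckOdd_apply, jckExtOdd_apply]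
  refine Prod.ext (Prod.ext ?_ (Prod.ext ?_ (Prod.ext ?_ ?_)))
      (Prod.ext ?_ (Prod.ext ?_ (Prod.ext ?_ ?_))) <;> simp <;> ring

set_option maxHeartbeats 1000000 in
-- The rotation is a cross product for the product `(q x)(q' x) = δ q q' - q δ q'` of `K`. The
-- remaining term extends `-∑ ± D(q_i x, q_i' x)`, with the signs of `diag(1, 1, -1)`.
theorem jckOdd_comm_odd (q₁ q₂ q₃ q₁' q₂' q₃' : Z) :
    (JCK δ).superComm (jckOdd δ (q₁, q₂, q₃)) (jckOdd δ (q₁', q₂', q₃')) =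
      jckRot δ ((δ q₂ * q₃' - q₂ * δ q₃') - (δ q₃ * q₂' - q₃ * δ q₂'),
        (δ q₃ * q₁' - q₃ * δ q₁') - (δ q₁ * q₃' - q₁ * δ q₃'),
        (δ q₁ * q₂' - q₁ * δ q₂') - (δ q₂ * q₁' - q₂ * δ q₁')) +
      jckExtEven ((2 * (q₁ * q₁' + q₂ * q₂' - q₃ * q₃')) • δ)
        (-δ (q₁ * q₁' + q₂ * q₂' - q₃ * q₃')) := by
  rw [(JCK δ).superComm_of_mem (jckOdd_mem δ _) (jckOdd_mem δ _)]
  apply LinearMap.ext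
  rintro ⟨⟨a, u₁, u₂, u₃⟩, ⟨b, v₁, v₂, v₃⟩⟩
  simp only [koszul_one_one, LinearMap.sub_apply, Module.End.mul_apply, jckRot_apply,
    jckOdd_apply, jckExtEven_apply, LinearMap.add_apply, LinearMap.smul_apply]
  refine Prod.ext (Prod.ext ?_ (Prod.ext ?_ (Prod.ext ?_ ?_)))
      (Prod.ext ?_ (Prod.ext ?_ (Prod.ext ?_ ?_))) <;> simp <;> ring

/-- The relation `[d, δ] = 2hδ` is needed for the values on `x`: from the coefficients `±δ p_i` one
gets `d(δ p_i) - 2h δ p_i`, which must be `δ(d p_i)`. -/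
theorem jckExtEven_comm_rot (d : Derivation F Z Z) (h : Z)
    (hd : ∀ a, d (δ a) = δ (d a) + 2 * h * δ a) (p₁ p₂ p₃ : Z) :
    (JCK δ).superComm (jckExtEven d h) (jckRot δ (p₁, p₂, p₃)) =
      jckRot δ (d p₁, d p₂, d p₃) := by
  rw [(JCK δ).superComm_of_mem (jckExtEven_mem δ _ _) (jckRot_mem δ _)]
  apply LinearMap.ext
  rintro ⟨⟨a, u₁, u₂, u₃⟩, ⟨b, v₁, v₂, v₃⟩⟩
  simp only [koszul_zero_left, one_smul, LinearMap.sub_apply, Module.End.mul_apply, jckRot_apply,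
    jckExtEven_apply]
  refine Prod.ext (Prod.ext ?_ (Prod.ext ?_ (Prod.ext ?_ ?_)))
      (Prod.ext ?_ (Prod.ext ?_ (Prod.ext ?_ ?_))) <;> simp [hd] <;> ring

theorem jckExtEven_comm_odd (d : Derivation F Z Z) (h : Z)
    (hd : ∀ a, d (δ a) = δ (d a) + 2 * h * δ a) (q₁ q₂ q₃ : Z) :
    (JCK δ).superComm (jckExtEven d h) (jckOdd δ (q₁, q₂, q₃)) =
      jckOdd δ (d q₁ + h * q₁, d q₂ + h * q₂, d q₃ + h * q₃) := by
  rw [(JCK δ).superComm_of_mem (jckExtEven_mem δ _ _) (jckOdd_mem δ _)]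
  apply LinearMap.ext
  rintro ⟨⟨a, u₁, u₂, u₃⟩, ⟨b, v₁, v₂, v₃⟩⟩
  simp only [koszul_zero_left, one_smul, LinearMap.sub_apply, Module.End.mul_apply, jckOdd_apply,
    jckExtEven_apply]
  refine Prod.ext (Prod.ext ?_ (Prod.ext ?_ (Prod.ext ?_ ?_)))
      (Prod.ext ?_ (Prod.ext ?_ (Prod.ext ?_ ?_))) <;> simp [hd] <;> ring

theorem jckExtEven_comm_extEven (d d' : Derivation F Z Z) (h h' : Z) :
    (JCK δ).superComm (jckExtEven d h) (jckExtEven d' h') =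
      jckExtEven ⁅d, d'⁆ (d h' - d' h) := by
  rw [(JCK δ).superComm_of_mem (jckExtEven_mem δ d h) (jckExtEven_mem δ d' h')]
  apply LinearMap.ext
  rintro ⟨⟨a, u₁, u₂, u₃⟩, ⟨b, v₁, v₂, v₃⟩⟩
  simp only [koszul_zero_left, one_smul, LinearMap.sub_apply, Module.End.mul_apply,
    jckExtEven_apply, Derivation.commutator_apply]
  refine Prod.ext (Prod.ext ?_ (Prod.ext ?_ (Prod.ext ?_ ?_)))
      (Prod.ext ?_ (Prod.ext ?_ (Prod.ext ?_ ?_))) <;> simp <;> ring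

theorem jckExtEven_comm_extOdd (d : Derivation F Z Z) (h m : Z) :
    (JCK δ).superComm (jckExtEven d h) (jckExtOdd F m) = jckExtOdd F (d m - h * m) := by
  rw [(JCK δ).superComm_of_mem (jckExtEven_mem δ d h) (jckExtOdd_mem δ m)]
  apply LinearMap.ext
  rintro ⟨⟨a, u₁, u₂, u₃⟩, ⟨b, v₁, v₂, v₃⟩⟩
  simp only [koszul_zero_left, one_smul, LinearMap.sub_apply, Module.End.mul_apply,
    jckExtEven_apply, jckExtOdd_apply]
  refine Prod.ext (Prod.ext ?_ (Prod.ext ?_ (Prod.ext ?_ ?_)))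
      (Prod.ext ?_ (Prod.ext ?_ (Prod.ext ?_ ?_))) <;> simp <;> ring

theorem jckExtOdd_comm_rot (m p₁ p₂ p₃ : Z) :
    (JCK δ).superComm (jckExtOdd F m) (jckRot δ (p₁, p₂, p₃)) = 0 := by
  rw [(JCK δ).superComm_of_mem (jckExtOdd_mem δ m) (jckRot_mem δ _)]
  apply LinearMap.ext
  rintro ⟨⟨a, u₁, u₂, u₃⟩, ⟨b, v₁, v₂, v₃⟩⟩
  simp only [koszul_zero_right, one_smul, LinearMap.sub_apply, Module.End.mul_apply,
    jckRot_apply, jckExtOdd_apply, LinearMap.zero_apply]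
  refine Prod.ext (Prod.ext ?_ (Prod.ext ?_ (Prod.ext ?_ ?_)))
      (Prod.ext ?_ (Prod.ext ?_ (Prod.ext ?_ ?_))) <;> simp <;> ring

theorem jckExtOdd_comm_odd (m q₁ q₂ q₃ : Z) :
    (JCK δ).superComm (jckExtOdd F m) (jckOdd δ (q₁, q₂, q₃)) =
      jckRot δ (m * q₁, m * q₂, -(m * q₃)) := by
  rw [(JCK δ).superComm_of_mem (jckExtOdd_mem δ m) (jckOdd_mem δ _)]
  apply LinearMap.ext
  rintro ⟨⟨a, u₁, u₂, u₃⟩, ⟨b, v₁, v₂, v₃⟩⟩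
  simp only [koszul_one_one, LinearMap.sub_apply, Module.End.mul_apply, LinearMap.smul_apply,
    jckRot_apply, jckOdd_apply, jckExtOdd_apply]
  refine Prod.ext (Prod.ext ?_ (Prod.ext ?_ (Prod.ext ?_ ?_)))
      (Prod.ext ?_ (Prod.ext ?_ (Prod.ext ?_ ?_))) <;> simp <;> ring

theorem jckExtOdd_comm_extOdd (m m' : Z) :
    (JCK δ).superComm (jckExtOdd F m) (jckExtOdd F m') = 0 := by
  rw [(JCK δ).superComm_of_mem (jckExtOdd_mem δ m) (jckExtOdd_mem δ m')]
  apply LinearMap.ext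
  rintro ⟨⟨a, u₁, u₂, u₃⟩, ⟨b, v₁, v₂, v₃⟩⟩
  simp [koszul_one_one, jckExtOdd_apply]

end Brackets

end ChengKac

section ChengKac

variable {F Z : Type*} [Field F] [CommRing Z] [Algebra F Z]

/-! ### Derivations of `K` and of `JCK(Z, δ)` in normal form. -/

section Classification

theorem Superalgebra.derPart_zero_leibniz {A : Type*} [AddCommGroup A] [Module F A]
    {S : Superalgebra F A} {D : Module.End F A} (hD : D ∈ S.derPart 0) (a b : A) :
    D (S.mul a b) = S.mul (D a) b + S.mul a (D b) := by
  rw [← S.proj_add a]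
  simp only [map_add, LinearMap.add_apply, hD.2 _ _ b (S.proj_mem _ a), koszul_zero_left,
    one_smul]
  abel

theorem Superalgebra.derPart_leibniz_of_mem_zero {A : Type*} [AddCommGroup A] [Module F A]
    {S : Superalgebra F A} {i : ZMod 2} {D : Module.End F A} (hD : D ∈ S.derPart i) {a : A}
    (ha : a ∈ S.part 0) (b : A) : D (S.mul a b) = S.mul (D a) b + S.mul a (D b) := by
  rw [hD.2 _ _ b ha, koszul_zero_right, one_smul]

theorem eq_zero_of_add_self (hF : ringChar F ≠ 2) {z : Z} (hz : z + z = 0) : z = 0 := by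
  have h2 : (2 : F) ≠ 0 := Ring.two_ne_zero hF
  have h : (2 : F) • z = 0 := by rw [two_smul, hz]
  exact (smul_eq_zero.1 h).resolve_left h2

/-- The annihilator of `c` is an ideal; if it contains `δ(Z)` it contains `1`. -/
theorem eq_zero_of_mul_derivation {δ : Derivation F Z Z}
    (hδ : Ideal.span (Set.range δ) = ⊤) {c : Z} (hc : ∀ a, c * δ a = 0) : c = 0 := by
  have h : Ideal.span (Set.range δ) ≤ LinearMap.ker (LinearMap.mul Z Z c) :=
    Ideal.span_le.2 (by rintro _ ⟨a, rfl⟩; exact hc a)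
  have h1 : (1 : Z) ∈ LinearMap.ker (LinearMap.mul Z Z c) := h (hδ ▸ Submodule.mem_top)
  simpa using h1

/-- Write `1` as a sum of terms `c_i δ(a_i)`. The target `P` is only an additive subgroup because
spaces of inner derivations are not given as `Z`-submodules. -/
theorem forall_of_derivation {δ : Derivation F Z Z} (hδ : Ideal.span (Set.range δ) = ⊤)
    {V : Type*} [AddCommGroup V] (φ : Z →+ V) (P : AddSubgroup V)
    (h : ∀ a c, φ (c * δ a) ∈ P) (m : Z) : φ m ∈ P := by
  have h1 : (1 : Z) ∈ Ideal.span (Set.range δ) := hδ ▸ Submodule.mem_top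
  -- The multiplier `c` is quantified inside the induction so that it can absorb the `Z`-scalars of
  -- the span.
  suffices H : ∀ x ∈ Ideal.span (Set.range δ), ∀ c, φ (c * x) ∈ P by
    simpa using H 1 h1 m
  intro x hx
  induction hx using Submodule.span_induction with
  | mem x hx => obtain ⟨a, rfl⟩ := hx; exact h a
  | zero => intro c; simp
  | add x y _ _ hx hy => intro c; rw [mul_add, map_add]; exact add_mem (hx c) (hy c)
  | smul c' x _ hx => intro c; rw [smul_eq_mul, ← mul_assoc]; exact hx (c * c')

theorem kantorEven_mem_derPart {δ d : Derivation F Z Z} {h : Z}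
    (hd : ∀ a, d (δ a) = δ (d a) + 2 * h * δ a) : kantorEven d h ∈ (KantorK δ).derPart 0 := by
  refine ⟨kantorEven_mem δ d h, ?_⟩
  rintro j ⟨a, b⟩ ⟨a', b'⟩ -
  simp only [KantorK_mul_apply, kantorMul, kantorEven_apply, koszul_zero_left, one_smul]
  refine Prod.ext ?_ ?_ <;> simp [hd] <;> ring

/-- On `Z` the map `f` is a derivation `d`, and `f x = h x` for some `h`; then `b x = b · x`
determines `f` on `Zx`. -/
theorem exists_eq_kantorEven {δ : Derivation F Z Z} {f : Module.End F (Z × Z)}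
    (hf : f ∈ (KantorK δ).derPart 0) :
    ∃ (d : Derivation F Z Z) (h : Z), (∀ a, d (δ a) = δ (d a) + 2 * h * δ a) ∧
      f = kantorEven d h := by
  have hL := Superalgebra.derPart_zero_leibniz hf
  simp only [KantorK_mul_apply] at hL
  have h0 : ∀ a, (f (a, 0)).2 = 0 := fun a =>
    mem_prodPart_zero.1 (hf.1 0 _ (kantor_mem_part_zero δ a))
  have h1 : ∀ b, (f (0, b)).1 = 0 := fun b =>
    mem_prodPart_one.1 (hf.1 1 _ (kantor_mem_part_one δ b))
  let d : Derivation F Z Z :=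
    Derivation.mk' ((LinearMap.fst F Z Z).comp (f.comp (LinearMap.inl F Z Z))) (by
      intro a b
      have h := hL (a, 0) (b, 0)
      have h' := congrArg Prod.fst h
      simp [kantorMul, h0] at h'
      simp [h']
      ring)
  have hd : ∀ a, f (a, 0) = (d a, 0) := fun a => Prod.ext rfl (h0 a)
  clear_value d
  have he : ∀ b, f (0, b) = (0, d b + (f (0, 1)).2 * b) := by
    intro b
    refine Prod.ext (h1 b) ?_
    have h := congrArg Prod.snd (hL (b, 0) (0, 1))
    simp [kantorMul, hd, h1] at h
    simp [h]
    ring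
  generalize (f (0, 1)).2 = h at he
  refine ⟨d, h, fun a => ?_, ?_⟩
  -- Applying `f` to `(a x) x = δ a` gives `[d, δ] = 2hδ`.
  · have h' := congrArg Prod.fst (hL (0, a) (0, 1))
    simp [kantorMul, he, hd] at h'
    rw [h']
    ring
  · apply LinearMap.ext
    rintro ⟨a, b⟩
    have e : ((a, b) : Z × Z) = (a, 0) + (0, b) := by simp
    rw [e, map_add, hd, he]
    simp [kantorEven_apply]

/-- `D(a, c x)` realises the parameter `c δ a`, and such elements generate `Z` additively. -/
theorem kantorOdd_mem_inderPart {δ : Derivation F Z Z}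
    (hδ : Ideal.span (Set.range δ) = ⊤) (m : Z) : kantorOdd F m ∈ (KantorK δ).inderPart 1 := by
  let φ : Z →+ Module.End F (Z × Z) :=
    { toFun := kantorOdd F
      map_zero' := by apply LinearMap.ext; rintro ⟨a, b⟩; simp [kantorOdd_apply]
      map_add' := fun x y => by
        apply LinearMap.ext; rintro ⟨a, b⟩; simp [kantorOdd_apply]; ring }
  refine forall_of_derivation hδ φ ((KantorK δ).inderPart 1).toAddSubgroup (fun a c => ?_) m
  exact Submodule.subset_span ⟨0, 1, rfl, _, kantor_mem_part_zero δ a, _,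
    kantor_mem_part_one δ c, (kantor_innerDer_even_odd δ a c).symm⟩

theorem jckExtOdd_mem_inderPart {δ : Derivation F Z Z}
    (hδ : Ideal.span (Set.range δ) = ⊤) (m : Z) : jckExtOdd F m ∈ (JCK δ).inderPart 1 := by
  let φ : Z →+ Module.End F (JCKSpace Z) :=
    { toFun := jckExtOdd F
      map_zero' := by
        apply LinearMap.ext; rintro ⟨⟨a, u₁, u₂, u₃⟩, ⟨b, v₁, v₂, v₃⟩⟩; simp [jckExtOdd_apply]
      map_add' := fun x y => by
        apply LinearMap.ext; rintro ⟨⟨a, u₁, u₂, u₃⟩, ⟨b, v₁, v₂, v₃⟩⟩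
        simp [jckExtOdd_apply]
        refine ⟨?_, ?_, ?_, ?_⟩ <;> ring }
  refine forall_of_derivation hδ φ ((JCK δ).inderPart 1).toAddSubgroup (fun a c => ?_) m
  exact Submodule.subset_span ⟨0, 1, rfl, _, kantorIncl_mem δ 0 _ (kantor_mem_part_zero δ a), _,
    jckX_mem δ c, (jck_innerDer_even_odd δ a c).symm⟩

theorem kantorOdd_neg (m : Z) : kantorOdd F (-m) = -kantorOdd F m := by
  apply LinearMap.ext
  rintro ⟨a, b⟩
  simp [kantorOdd_apply]

theorem kantor_innerDer_odd_even (δ : Derivation F Z Z) (s t : Z) :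
    (KantorK δ).innerDer (0, t) (s, 0) = -kantorOdd F (t * δ s) := by
  rw [← kantor_innerDer_even_odd]
  have h := (KantorK δ).superComm_skew
    ((KantorK δ).mul_mem_endPart_of_mem (kantor_mem_part_one δ t))
    ((KantorK δ).mul_mem_endPart_of_mem (kantor_mem_part_zero δ s))
  rwa [koszul_zero_right, one_smul] at h

theorem exists_eq_kantorOdd {δ : Derivation F Z Z} {f : Module.End F (Z × Z)}
    (hf : f ∈ (KantorK δ).inderPart 1) : ∃ m : Z, f = kantorOdd F m := by
  induction hf using Submodule.span_induction with
  | mem f hf =>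
    obtain ⟨j, k, hjk, ⟨a, a'⟩, ha, ⟨b, b'⟩, hb, rfl⟩ := hf
    rcases parity_cases j with rfl | rfl <;> rcases parity_cases k with rfl | rfl
    · exact absurd hjk (by decide)
    · obtain rfl : a' = 0 := mem_prodPart_zero.1 ha
      obtain rfl : b = 0 := mem_prodPart_one.1 hb
      exact ⟨_, kantor_innerDer_even_odd δ a b'⟩
    · obtain rfl : a = 0 := mem_prodPart_one.1 ha
      obtain rfl : b' = 0 := mem_prodPart_zero.1 hb
      exact ⟨_, (kantor_innerDer_odd_even δ b a').trans (kantorOdd_neg _).symm⟩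
    · exact absurd hjk (by decide)
  | zero => exact ⟨0, by apply LinearMap.ext; rintro ⟨a, b⟩; simp [kantorOdd_apply]; rfl⟩
  | add f g _ _ hf hg =>
    obtain ⟨m, rfl⟩ := hf
    obtain ⟨n, rfl⟩ := hg
    exact ⟨m + n, by apply LinearMap.ext; rintro ⟨a, b⟩; simp [kantorOdd_apply]; ring⟩
  | smul c f _ hf =>
    obtain ⟨m, rfl⟩ := hf
    exact ⟨c • m, by apply LinearMap.ext; rintro ⟨a, b⟩; simp [kantorOdd_apply]⟩

set_option maxHeartbeats 1000000 in
theorem jckExtEven_mem_derPart {δ d : Derivation F Z Z} {h : Z}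
    (hd : ∀ a, d (δ a) = δ (d a) + 2 * h * δ a) : jckExtEven d h ∈ (JCK δ).derPart 0 := by
  refine ⟨jckExtEven_mem δ d h, ?_⟩
  rintro j ⟨⟨a, u₁, u₂, u₃⟩, ⟨b, v₁, v₂, v₃⟩⟩ ⟨⟨a', u₁', u₂', u₃'⟩, ⟨b', v₁', v₂', v₃'⟩⟩ -
  simp only [JCK_mul_apply, jckMul, jckExtEven_apply, koszul_zero_left, one_smul]
  refine Prod.ext (Prod.ext ?_ (Prod.ext ?_ (Prod.ext ?_ ?_)))
      (Prod.ext ?_ (Prod.ext ?_ (Prod.ext ?_ ?_))) <;> simp [hd] <;> ring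

theorem jck_linearMap_ext {f g : Module.End F (JCKSpace Z)}
    (h0 : ∀ z, f ((z, 0, 0, 0), (0, 0, 0, 0)) = g ((z, 0, 0, 0), (0, 0, 0, 0)))
    (h1 : ∀ z, f ((0, z, 0, 0), (0, 0, 0, 0)) = g ((0, z, 0, 0), (0, 0, 0, 0)))
    (h2 : ∀ z, f ((0, 0, z, 0), (0, 0, 0, 0)) = g ((0, 0, z, 0), (0, 0, 0, 0)))
    (h3 : ∀ z, f ((0, 0, 0, z), (0, 0, 0, 0)) = g ((0, 0, 0, z), (0, 0, 0, 0)))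
    (k0 : ∀ z, f ((0, 0, 0, 0), (z, 0, 0, 0)) = g ((0, 0, 0, 0), (z, 0, 0, 0)))
    (k1 : ∀ z, f ((0, 0, 0, 0), (0, z, 0, 0)) = g ((0, 0, 0, 0), (0, z, 0, 0)))
    (k2 : ∀ z, f ((0, 0, 0, 0), (0, 0, z, 0)) = g ((0, 0, 0, 0), (0, 0, z, 0)))
    (k3 : ∀ z, f ((0, 0, 0, 0), (0, 0, 0, z)) = g ((0, 0, 0, 0), (0, 0, 0, z))) : f = g := by
  apply LinearMap.ext
  rintro ⟨⟨a, u₁, u₂, u₃⟩, ⟨b, v₁, v₂, v₃⟩⟩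
  have e : (((a, u₁, u₂, u₃), (b, v₁, v₂, v₃)) : JCKSpace Z) =
      ((a, 0, 0, 0), (0, 0, 0, 0)) + ((0, u₁, 0, 0), (0, 0, 0, 0)) +
      ((0, 0, u₂, 0), (0, 0, 0, 0)) + ((0, 0, 0, u₃), (0, 0, 0, 0)) +
      ((0, 0, 0, 0), (b, 0, 0, 0)) + ((0, 0, 0, 0), (0, v₁, 0, 0)) +
      ((0, 0, 0, 0), (0, 0, v₂, 0)) + ((0, 0, 0, 0), (0, 0, 0, v₃)) := by simp
  rw [e]
  simp only [map_add, h0, h1, h2, h3, k0, k1, k2, k3]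

/-- An even derivation of `JCK(Z, δ)` annihilating the `w_i` is determined by its action on `K`. -/
theorem exists_eq_jckExtEven {δ : Derivation F Z Z} {D : Module.End F (JCKSpace Z)}
    (hD : D ∈ (JCK δ).derPart 0)
    (w1 : D ((0, 1, 0, 0), (0, 0, 0, 0)) = 0) (w2 : D ((0, 0, 1, 0), (0, 0, 0, 0)) = 0)
    (w3 : D ((0, 0, 0, 1), (0, 0, 0, 0)) = 0) :
    ∃ (d : Derivation F Z Z) (h : Z), (∀ a, d (δ a) = δ (d a) + 2 * h * δ a) ∧
      D = jckExtEven d h := by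
  have hL := Superalgebra.derPart_zero_leibniz hD
  simp only [JCK_mul_apply] at hL
  have hZ : ∀ a, D ((a, 0, 0, 0), (0, 0, 0, 0)) =
      (((D ((a, 0, 0, 0), (0, 0, 0, 0))).1.1, 0, 0, 0), (0, 0, 0, 0)) := by
    intro a
    obtain ⟨f, u₁, u₂, u₃, h⟩ := jck_mem_even (hD.1 0 _ (jck_mem_part_zero δ a 0 0 0))
    -- Since `D w_i = 0` and `w_i² = 1` for `i = 1, 2`, one has `D a = w_i (w_i (D a))`, which has
    -- only `1`- and `w_i`-coordinates. Taking both `i` leaves only the `1`-coordinate.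
    have e1 := hL ((0, 1, 0, 0), (0, 0, 0, 0)) ((a, 0, 0, 0), (0, 0, 0, 0))
    have e2 := hL ((0, 0, 1, 0), (0, 0, 0, 0)) ((a, 0, 0, 0), (0, 0, 0, 0))
    have e1' := hL ((0, 1, 0, 0), (0, 0, 0, 0)) ((0, a, 0, 0), (0, 0, 0, 0))
    have e2' := hL ((0, 0, 1, 0), (0, 0, 0, 0)) ((0, 0, a, 0), (0, 0, 0, 0))
    simp [jckMul, h, w1, w2] at e1 e2
    simp [jckMul, h, w1, w2, e1, e2] at e1' e2'
    rw [h]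
    simp [e1', e2']
  let d : Derivation F Z Z :=
    Derivation.mk' ((LinearMap.fst F Z _).comp ((LinearMap.fst F (Z × Z × Z × Z) _).comp
      (D.comp ((LinearMap.inl F (Z × Z × Z × Z) _).comp (LinearMap.inl F Z (Z × Z × Z)))))) (by
      intro a b
      have h := congrArg (fun z => z.1.1) (hL ((a, 0, 0, 0), (0, 0, 0, 0)) ((b, 0, 0, 0), (0, 0, 0, 0)))
      simp [jckMul] at h
      rw [hZ a, hZ b] at h
      simp at h
      simp [← Prod.zero_eq_mk] at h ⊢
      rw [h]
      ring)
  have hd : ∀ a, D ((a, 0, 0, 0), (0, 0, 0, 0)) = ((d a, 0, 0, 0), (0, 0, 0, 0)) := hZ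
  clear_value d
  obtain ⟨h, h₁, h₂, h₃, hx⟩ := jck_mem_odd (hD.1 1 _ (jck_mem_part_one δ 1 0 0 0))
  obtain ⟨p, p₁, p₂, p₃, hx1⟩ := jck_mem_odd (hD.1 1 _ (jck_mem_part_one δ 0 1 0 0))
  obtain ⟨q, q₁, q₂, q₃, hx2⟩ := jck_mem_odd (hD.1 1 _ (jck_mem_part_one δ 0 0 1 0))
  obtain ⟨r, r₁, r₂, r₃, hx3⟩ := jck_mem_odd (hD.1 1 _ (jck_mem_part_one δ 0 0 0 1))
  -- Here `D` commutes with multiplication by each `w_i`. As `w_i x = 0` and the `w_i` permute the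
  -- `x_j` up to sign, this forces `D x = h x` and `D x_j = p₁ x_j` with a common `p₁`; then `x x_1
  -- = -w_1` gives `p₁ = -h`.
  have e01 := hL ((0, 1, 0, 0), (0, 0, 0, 0)) ((0, 0, 0, 0), (1, 0, 0, 0))
  have e02 := hL ((0, 0, 1, 0), (0, 0, 0, 0)) ((0, 0, 0, 0), (1, 0, 0, 0))
  have e11 := hL ((0, 1, 0, 0), (0, 0, 0, 0)) ((0, 0, 0, 0), (0, 1, 0, 0))
  have e12 := hL ((0, 1, 0, 0), (0, 0, 0, 0)) ((0, 0, 0, 0), (0, 0, 1, 0))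
  have e13 := hL ((0, 1, 0, 0), (0, 0, 0, 0)) ((0, 0, 0, 0), (0, 0, 0, 1))
  have e21 := hL ((0, 0, 1, 0), (0, 0, 0, 0)) ((0, 0, 0, 0), (0, 1, 0, 0))
  have e22 := hL ((0, 0, 1, 0), (0, 0, 0, 0)) ((0, 0, 0, 0), (0, 0, 1, 0))
  have e23 := hL ((0, 0, 1, 0), (0, 0, 0, 0)) ((0, 0, 0, 0), (0, 0, 0, 1))
  have e33 := hL ((0, 0, 0, 1), (0, 0, 0, 0)) ((0, 0, 0, 0), (0, 0, 0, 1))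
  have ex := hL ((0, 0, 0, 0), (1, 0, 0, 0)) ((0, 0, 0, 0), (0, 1, 0, 0))
  have n1 : D ((0, -1, 0, 0), (0, 0, 0, 0)) = 0 := by
    have := map_neg D ((0, 1, 0, 0), (0, 0, 0, 0)); simpa [w1] using this
  have m2 : D ((0, 0, 0, 0), (0, 0, -1, 0)) = ((0, 0, 0, 0), (-q, -q₁, -q₂, -q₃)) := by
    have := map_neg D ((0, 0, 0, 0), (0, 0, 1, 0)); simpa [hx2] using this
  have m3 : D ((0, 0, 0, 0), (0, 0, 0, -1)) = ((0, 0, 0, 0), (-r, -r₁, -r₂, -r₃)) := by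
    have := map_neg D ((0, 0, 0, 0), (0, 0, 0, 1)); simpa [hx3] using this
  have zz : D ((0, 0, 0, 0), (0, 0, 0, 0)) = 0 := map_zero D
  simp [jckMul, w1, w2, w3, hx, hx1, hx2, hx3, n1, m2, m3, zz, Prod.ext_iff]
    at e01 e02 e11 e12 e13 e21 e22 e23 e33 ex
  obtain ⟨rfl, rfl⟩ := e01
  obtain ⟨-, rfl⟩ := e02
  obtain ⟨rfl, rfl⟩ := e11
  obtain ⟨rfl, rfl, rfl, rfl⟩ := e12
  obtain ⟨rfl, rfl⟩ := e22
  obtain ⟨rfl, rfl, -⟩ := e23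
  obtain ⟨rfl, -⟩ := e13
  obtain ⟨-, hp, -⟩ := ex
  obtain rfl : p₁ = -h := by linear_combination hp
  have hw1 : ∀ a, D ((0, a, 0, 0), (0, 0, 0, 0)) = ((0, d a, 0, 0), (0, 0, 0, 0)) := fun a => by
    simpa [jckMul, hd, w1] using hL ((a, 0, 0, 0), (0, 0, 0, 0)) ((0, 1, 0, 0), (0, 0, 0, 0))
  have hw2 : ∀ a, D ((0, 0, a, 0), (0, 0, 0, 0)) = ((0, 0, d a, 0), (0, 0, 0, 0)) := fun a => by
    simpa [jckMul, hd, w2] using hL ((a, 0, 0, 0), (0, 0, 0, 0)) ((0, 0, 1, 0), (0, 0, 0, 0))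
  have hw3 : ∀ a, D ((0, 0, 0, a), (0, 0, 0, 0)) = ((0, 0, 0, d a), (0, 0, 0, 0)) := fun a => by
    simpa [jckMul, hd, w3] using hL ((a, 0, 0, 0), (0, 0, 0, 0)) ((0, 0, 0, 1), (0, 0, 0, 0))
  have hX : ∀ b, D ((0, 0, 0, 0), (b, 0, 0, 0)) = ((0, 0, 0, 0), (d b + b * h, 0, 0, 0)) :=
    fun b => by
      simpa [jckMul, hd, hx] using hL ((b, 0, 0, 0), (0, 0, 0, 0)) ((0, 0, 0, 0), (1, 0, 0, 0))
  have hX1 : ∀ b, D ((0, 0, 0, 0), (0, b, 0, 0)) = ((0, 0, 0, 0), (0, d b + -(b * h), 0, 0)) :=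
    fun b => by
      simpa [jckMul, hd, hx1] using hL ((b, 0, 0, 0), (0, 0, 0, 0)) ((0, 0, 0, 0), (0, 1, 0, 0))
  have hX2 : ∀ b, D ((0, 0, 0, 0), (0, 0, b, 0)) = ((0, 0, 0, 0), (0, 0, d b + -(b * h), 0)) :=
    fun b => by
      simpa [jckMul, hd, hx2] using hL ((b, 0, 0, 0), (0, 0, 0, 0)) ((0, 0, 0, 0), (0, 0, 1, 0))
  have hX3 : ∀ b, D ((0, 0, 0, 0), (0, 0, 0, b)) = ((0, 0, 0, 0), (0, 0, 0, d b + -(b * h))) :=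
    fun b => by
      simpa [jckMul, hd, hx3] using hL ((b, 0, 0, 0), (0, 0, 0, 0)) ((0, 0, 0, 0), (0, 0, 0, 1))
  refine ⟨d, h, fun a => ?_, ?_⟩
  -- The relation between `d`, `δ` and `h` comes from `(a w_1) x = δ(a) x_1`.
  · have e := hL ((0, a, 0, 0), (0, 0, 0, 0)) ((0, 0, 0, 0), (1, 0, 0, 0))
    simp [jckMul, hw1, hx, hX1] at e
    linear_combination e
  · apply jck_linearMap_ext <;> intro z <;>
      simp [hd, hw1, hw2, hw3, hX, hX1, hX2, hX3, jckExtEven_apply] <;> ring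

/-- Differentiating `w_i w_j = 0` shows that `D w_i` has no `1`-coordinate and that the off-diagonal
entries are skew for `diag(1, 1, -1)`. Differentiating `w_i² = ±1` makes twice each diagonal entry
vanish. A rotation with the same matrix is then subtracted. -/
theorem exists_eq_jckRot_add_jckExtEven (hF : ringChar F ≠ 2) {δ : Derivation F Z Z}
    {D : Module.End F (JCKSpace Z)} (hD : D ∈ (JCK δ).derPart 0) :
    ∃ (p : Z × Z × Z) (d : Derivation F Z Z) (h : Z),
      (∀ a, d (δ a) = δ (d a) + 2 * h * δ a) ∧ D = jckRot δ p + jckExtEven d h := by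
  have hL := Superalgebra.derPart_zero_leibniz hD
  simp only [JCK_mul_apply] at hL
  obtain ⟨t₁, m₁₁, m₁₂, m₁₃, h1⟩ := jck_mem_even (hD.1 0 _ (jck_mem_part_zero δ 0 1 0 0))
  obtain ⟨t₂, m₂₁, m₂₂, m₂₃, h2⟩ := jck_mem_even (hD.1 0 _ (jck_mem_part_zero δ 0 0 1 0))
  obtain ⟨t₃, m₃₁, m₃₂, m₃₃, h3⟩ := jck_mem_even (hD.1 0 _ (jck_mem_part_zero δ 0 0 0 1))
  have zz : D ((0, 0, 0, 0), (0, 0, 0, 0)) = 0 := map_zero D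
  have e00 := hL ((1, 0, 0, 0), (0, 0, 0, 0)) ((1, 0, 0, 0), (0, 0, 0, 0))
  have e11 := hL ((0, 1, 0, 0), (0, 0, 0, 0)) ((0, 1, 0, 0), (0, 0, 0, 0))
  have e12 := hL ((0, 1, 0, 0), (0, 0, 0, 0)) ((0, 0, 1, 0), (0, 0, 0, 0))
  have e13 := hL ((0, 1, 0, 0), (0, 0, 0, 0)) ((0, 0, 0, 1), (0, 0, 0, 0))
  have e22 := hL ((0, 0, 1, 0), (0, 0, 0, 0)) ((0, 0, 1, 0), (0, 0, 0, 0))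
  have e23 := hL ((0, 0, 1, 0), (0, 0, 0, 0)) ((0, 0, 0, 1), (0, 0, 0, 0))
  have e33 := hL ((0, 0, 0, 1), (0, 0, 0, 0)) ((0, 0, 0, 1), (0, 0, 0, 0))
  obtain ⟨c₀, c₁, c₂, c₃, h0⟩ := jck_mem_even (hD.1 0 _ (jck_mem_part_zero δ 1 0 0 0))
  have n1 : D ((-1, 0, 0, 0), (0, 0, 0, 0)) = ((-c₀, -c₁, -c₂, -c₃), (0, 0, 0, 0)) := by
    have := map_neg D ((1, 0, 0, 0), (0, 0, 0, 0)); simpa [h0] using this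
  simp [jckMul, h0, h1, h2, h3, zz, n1, Prod.ext_iff] at e00 e11 e12 e13 e22 e23 e33
  obtain ⟨rfl, rfl, rfl, rfl⟩ := e00
  obtain ⟨a12, rfl, rfl⟩ := e12
  obtain ⟨a13, rfl, -⟩ := e13
  obtain rfl := eq_zero_of_add_self hF e11.1.symm
  obtain rfl := eq_zero_of_add_self hF e22.1.symm
  obtain rfl : m₃₃ = 0 := eq_zero_of_add_self hF (by linear_combination e33.1)
  obtain rfl : m₂₁ = -m₁₂ := by linear_combination -a12
  obtain rfl : m₃₁ = m₁₃ := by linear_combination -a13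
  obtain rfl : m₃₂ = m₂₃ := by linear_combination -e23.1
  -- The parameters are read off from the action on the `w_i` in `jckRot_apply`.
  have hJ := (JCK_isJordan δ).inderPart_le_derPart 0 (jckRot_mem_inderPart δ (m₃₂, -m₃₁, m₁₂))
  obtain ⟨d, h, hd, e⟩ := exists_eq_jckExtEven (sub_mem hD hJ)
    (by simp [h1, jckRot_apply, Prod.ext_iff]) (by simp [h2, jckRot_apply, Prod.ext_iff])
    (by simp [h3, jckRot_apply, Prod.ext_iff])
  exact ⟨_, d, h, hd, by rw [← e]; abel⟩

/-- Uniqueness for odd derivations. Successively `D` vanishes on the `w_i` and `x`, on `Z`, on the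
multiples of these, and finally on the `x_i`; the last stage needs `Z = Zδ(Z)`. -/
theorem eq_zero_of_mem_derPart_one {δ : Derivation F Z Z}
    (hδ : Ideal.span (Set.range δ) = ⊤)
    {D : Module.End F (JCKSpace Z)} (hD : D ∈ (JCK δ).derPart 1)
    (h1 : (D ((0, 1, 0, 0), (0, 0, 0, 0))).2.1 = 0)
    (h2 : (D ((0, 0, 1, 0), (0, 0, 0, 0))).2.1 = 0)
    (h3 : (D ((0, 0, 0, 1), (0, 0, 0, 0))).2.1 = 0)
    (hx : (D ((0, 0, 0, 0), (1, 0, 0, 0))).1.1 = 0) : D = 0 := by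
  have hL : ∀ a u₁ u₂ u₃ b, D (jckMul δ ((a, u₁, u₂, u₃), (0, 0, 0, 0)) b) = _ :=
    fun a u₁ u₂ u₃ b =>
      Superalgebra.derPart_leibniz_of_mem_zero hD (jck_mem_part_zero δ a u₁ u₂ u₃) b
  simp only [JCK_mul_apply] at hL
  have zz : D ((0, 0, 0, 0), (0, 0, 0, 0)) = 0 := map_zero D
  have hp := fun a u₁ u₂ u₃ => jck_mem_odd (hD.1 0 _ (jck_mem_part_zero δ a u₁ u₂ u₃))
  obtain ⟨c₀, c₁, c₂, c₃, h0⟩ := hp 1 0 0 0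
  have n1 : D ((-1, 0, 0, 0), (0, 0, 0, 0)) = ((0, 0, 0, 0), (-c₀, -c₁, -c₂, -c₃)) := by
    have := map_neg D ((1, 0, 0, 0), (0, 0, 0, 0)); simpa [h0] using this
  obtain ⟨t₁, m₁₁, m₁₂, m₁₃, w1⟩ := hp 0 1 0 0
  obtain ⟨t₂, m₂₁, m₂₂, m₂₃, w2⟩ := hp 0 0 1 0
  obtain ⟨t₃, m₃₁, m₃₂, m₃₃, w3⟩ := hp 0 0 0 1
  obtain ⟨f, u₁, u₂, u₃, x⟩ := jck_mem_even (hD.1 1 _ (jck_mem_part_one δ 1 0 0 0))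
  rw [w1] at h1
  rw [w2] at h2
  rw [w3] at h3
  rw [x] at hx
  dsimp only at h1 h2 h3 hx
  subst h1 h2 h3 hx
  have e00 := hL 1 0 0 0 ((1, 0, 0, 0), (0, 0, 0, 0))
  have e11 := hL 0 1 0 0 ((0, 1, 0, 0), (0, 0, 0, 0))
  have e12 := hL 0 1 0 0 ((0, 0, 1, 0), (0, 0, 0, 0))
  have e13 := hL 0 1 0 0 ((0, 0, 0, 1), (0, 0, 0, 0))
  have e22 := hL 0 0 1 0 ((0, 0, 1, 0), (0, 0, 0, 0))
  have e23 := hL 0 0 1 0 ((0, 0, 0, 1), (0, 0, 0, 0))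
  have e33 := hL 0 0 0 1 ((0, 0, 0, 1), (0, 0, 0, 0))
  -- In `0 = D(w_i x) = (D w_i) x + w_i (D x)` the `x_j`-coordinates of `D w_i` appear on the `w_j`,
  -- and the `w_i`-coordinate of `D x` appears, up to sign, on `1`. With the hypotheses all of them
  -- vanish.
  have e1x := hL 0 1 0 0 ((0, 0, 0, 0), (1, 0, 0, 0))
  have e2x := hL 0 0 1 0 ((0, 0, 0, 0), (1, 0, 0, 0))
  have e3x := hL 0 0 0 1 ((0, 0, 0, 0), (1, 0, 0, 0))
  simp [jckMul, h0, w1, w2, w3, x, zz, n1, Prod.ext_iff]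
    at e00 e11 e12 e13 e22 e23 e33 e1x e2x e3x
  obtain ⟨-, -, -, -⟩ := e00
  obtain ⟨rfl, rfl, rfl, rfl⟩ := e1x
  obtain ⟨rfl, rfl, rfl, rfl⟩ := e2x
  obtain ⟨rfl, rfl, rfl, rfl⟩ := e3x
  have z1 : D ((0, 1, 0, 0), (0, 0, 0, 0)) = 0 := w1
  have z2 : D ((0, 0, 1, 0), (0, 0, 0, 0)) = 0 := w2
  have z3 : D ((0, 0, 0, 1), (0, 0, 0, 0)) = 0 := w3
  have zx : D ((0, 0, 0, 0), (1, 0, 0, 0)) = 0 := x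
  have hZ : ∀ a, D ((a, 0, 0, 0), (0, 0, 0, 0)) = 0 := by
    intro a
    obtain ⟨f, v₁, v₂, v₃, h⟩ := hp a 0 0 0
    -- From `D a = ± w_i (w_i (D a))`, and since `w_i` kills `x` and `x_i`, the element `D a` has no
    -- coordinate on `x` or on `x_i`, for each `i`.
    have r1 := hL 0 1 0 0 ((a, 0, 0, 0), (0, 0, 0, 0))
    have r2 := hL 0 0 1 0 ((a, 0, 0, 0), (0, 0, 0, 0))
    have r3 := hL 0 0 0 1 ((a, 0, 0, 0), (0, 0, 0, 0))
    have s1 := hL 0 1 0 0 ((0, a, 0, 0), (0, 0, 0, 0))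
    have s2 := hL 0 0 1 0 ((0, 0, a, 0), (0, 0, 0, 0))
    have s3 := hL 0 0 0 1 ((0, 0, 0, a), (0, 0, 0, 0))
    have hn : D ((-a, 0, 0, 0), (0, 0, 0, 0)) = ((0, 0, 0, 0), (-f, -v₁, -v₂, -v₃)) := by
      have := map_neg D ((a, 0, 0, 0), (0, 0, 0, 0)); simpa [h] using this
    simp [jckMul, h, z1, z2, z3] at r1 r2 r3
    simp [jckMul, h, hn, z1, z2, z3, r1, r2, r3, Prod.ext_iff] at s1 s2 s3
    rw [h]
    simp [s1, s2, s3]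
  have hw1 : ∀ a, D ((0, a, 0, 0), (0, 0, 0, 0)) =
      ((0, 0, 0, 0), (0, 0, 0, 0)) := fun a => by
    simpa [jckMul, hZ, z1] using hL a 0 0 0 ((0, 1, 0, 0), (0, 0, 0, 0))
  have hw2 : ∀ a, D ((0, 0, a, 0), (0, 0, 0, 0)) =
      ((0, 0, 0, 0), (0, 0, 0, 0)) := fun a => by
    simpa [jckMul, hZ, z2] using hL a 0 0 0 ((0, 0, 1, 0), (0, 0, 0, 0))
  have hw3 : ∀ a, D ((0, 0, 0, a), (0, 0, 0, 0)) =
      ((0, 0, 0, 0), (0, 0, 0, 0)) := fun a => by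
    simpa [jckMul, hZ, z3] using hL a 0 0 0 ((0, 0, 0, 1), (0, 0, 0, 0))
  have hX : ∀ b, D ((0, 0, 0, 0), (b, 0, 0, 0)) =
      ((0, 0, 0, 0), (0, 0, 0, 0)) := fun b => by
    simpa [jckMul, hZ, zx] using hL b 0 0 0 ((0, 0, 0, 0), (1, 0, 0, 0))
  have hX1 : D ((0, 0, 0, 0), (0, 1, 0, 0)) =
      ((0, 0, 0, 0), (0, 0, 0, 0)) := by
    obtain ⟨f, v₁, v₂, v₃, h⟩ := jck_mem_even (hD.1 1 _ (jck_mem_part_one δ 0 1 0 0))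
    -- `δ(a) x_1 = (a w_1) x` is killed by `D`, hence `δ(a) D(x_1) = 0` for all `a`, and so `D x_1 =
    -- 0`. The other two follow from `x_2 = w_3 x_1` and `x_3 = w_2 x_1`.
    have r : ∀ a, _ := fun a => hL 0 a 0 0 ((0, 0, 0, 0), (1, 0, 0, 0))
    have s : ∀ a, _ := fun a => hL (δ a) 0 0 0 ((0, 0, 0, 0), (0, 1, 0, 0))
    simp [jckMul, hZ, hw1, zx] at r
    simp [jckMul, hZ, r, h, Prod.ext_iff] at s
    simp only [forall_and, mul_comm (δ _), eq_comm (a := (0 : Z))] at s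
    obtain ⟨s₀, s₁, s₂, s₃⟩ := s
    rw [h, eq_zero_of_mul_derivation hδ s₀, eq_zero_of_mul_derivation hδ s₁,
      eq_zero_of_mul_derivation hδ s₂, eq_zero_of_mul_derivation hδ s₃]
  have hX2 : D ((0, 0, 0, 0), (0, 0, 1, 0)) =
      ((0, 0, 0, 0), (0, 0, 0, 0)) := by
    simpa [jckMul, z3, hX1] using hL 0 0 0 1 ((0, 0, 0, 0), (0, 1, 0, 0))
  have hX3 : D ((0, 0, 0, 0), (0, 0, 0, 1)) =
      ((0, 0, 0, 0), (0, 0, 0, 0)) := by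
    simpa [jckMul, z2, hX1] using hL 0 0 1 0 ((0, 0, 0, 0), (0, 1, 0, 0))
  refine jck_linearMap_ext hZ hw1 hw2 hw3 hX (fun b => ?_) (fun b => ?_) (fun b => ?_)
  · change _ = ((0, 0, 0, 0), (0, 0, 0, 0))
    simpa [jckMul, hZ, hX1] using hL b 0 0 0 ((0, 0, 0, 0), (0, 1, 0, 0))
  · change _ = ((0, 0, 0, 0), (0, 0, 0, 0))
    simpa [jckMul, hZ, hX2] using hL b 0 0 0 ((0, 0, 0, 0), (0, 0, 1, 0))
  · change _ = ((0, 0, 0, 0), (0, 0, 0, 0))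
    simpa [jckMul, hZ, hX3] using hL b 0 0 0 ((0, 0, 0, 0), (0, 0, 0, 1))

theorem exists_eq_jckOdd_add_jckExtOdd {δ : Derivation F Z Z}
    (hδ : Ideal.span (Set.range δ) = ⊤)
    {D : Module.End F (JCKSpace Z)} (hD : D ∈ (JCK δ).derPart 1) :
    ∃ (q : Z × Z × Z) (m : Z), D = jckOdd δ q + jckExtOdd F m := by
  -- The signs invert those in `jckOdd_apply`: `w_1` and `w_2` carry `-q_i x`, while `w_3` carries
  -- `+q_3 x`.
  let q : Z × Z × Z := (-(D ((0, 1, 0, 0), (0, 0, 0, 0))).2.1,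
    -(D ((0, 0, 1, 0), (0, 0, 0, 0))).2.1, (D ((0, 0, 0, 1), (0, 0, 0, 0))).2.1)
  let m : Z := (D ((0, 0, 0, 0), (1, 0, 0, 0))).1.1
  refine ⟨q, m, ?_⟩
  rw [← sub_eq_zero]
  have hJ := (JCK_isJordan δ).inderPart_le_derPart 1
  apply eq_zero_of_mem_derPart_one hδ
    (sub_mem hD (add_mem (hJ (jckOdd_mem_inderPart δ q)) (hJ (jckExtOdd_mem_inderPart hδ m)))) <;>
  simp [jckOdd_apply, jckExtOdd_apply, q, m]

end Classification
end ChengKac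

/-! ### The Tits construction in coordinates. -/

namespace Superalgebra

variable {F A B : Type*} [Field F] [AddCommGroup A] [Module F A] [AddCommGroup B] [Module F B]

/-- The `so_3 ⊗ K` component of the bracket of `u + f` and `v + g` in a Tits construction, in terms
of the coordinates `a`, `b` of `u`, `v`, where `c` is the Koszul sign of the two elements. -/
def titsCoord (K : Superalgebra F B) (c : F) (a b : B × B × B) (f g : Module.End F B) :
    B × B × B :=
  (K.mul a.2.1 b.2.2 - K.mul a.2.2 b.2.1 + f b.1 - c • g a.1,
    K.mul a.2.2 b.1 - K.mul a.1 b.2.2 + f b.2.1 - c • g a.2.1,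
    K.mul a.1 b.2.1 - K.mul a.2.1 b.1 + f b.2.2 - c • g a.2.2)

/-- The derivation component of the bracket of `u + f` and `v + g` in a Tits construction, in terms
of the coordinates `a`, `b` of `u`, `v`. -/
noncomputable def titsDer (K : Superalgebra F B) (a b : B × B × B) (f g : Module.End F B) :
    Module.End F B :=
  -(K.innerDer a.1 b.1 + K.innerDer a.2.1 b.2.1 + K.innerDer a.2.2 b.2.2) + K.superComm f g

/-- The triples of homogeneous elements of degree `i`. -/
def tripart (K : Superalgebra F B) (i : ZMod 2) : Submodule F (B × B × B) :=
  (K.part i).prod ((K.part i).prod (K.part i))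

/-- A linear map `ψ` on `K³ ⊕ End(K)` which restricts to an even multiplicative bijection from
the Tits construction of `𝔡`, in coordinates, onto a graded subalgebra `T` of `gl(S)` shows that
the two are isomorphic. -/
theorem Sub.isIsomorphic_tits (hF : ringChar F ≠ 2) {S : Superalgebra F A} (T : S.gl.Sub)
    (K : Superalgebra F B) (hK : K.IsJordan) (𝔡 : K.gl.Sub)
    (hd : (K.inder hK).carrier ≤ 𝔡.carrier) (hd' : 𝔡.carrier ≤ K.der.carrier)
    (ψ : B × B × B → Module.End F B → Module.End F A)
    (hadd : ∀ a b f g, ψ (a + b) (f + g) = ψ a f + ψ b g)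
    (hsmul : ∀ (c : F) a f, ψ (c • a) (c • f) = c • ψ a f)
    (hinj : ∀ a, ∀ f ∈ 𝔡.carrier, ψ a f = 0 → a = 0 ∧ f = 0)
    (hmem : ∀ a, ∀ f ∈ 𝔡.carrier, ψ a f ∈ T.carrier)
    (hsurj : ∀ D ∈ T.carrier, ∃ a, ∃ f ∈ 𝔡.carrier, ψ a f = D)
    (hpart : ∀ i, ∀ a ∈ K.tripart i, ∀ f ∈ 𝔡.carrier, f ∈ K.endPart i → ψ a f ∈ S.endPart i)
    (hmul : ∀ i j, ∀ a ∈ K.tripart i, ∀ f ∈ 𝔡.carrier, f ∈ K.endPart i →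
      ∀ b ∈ K.tripart j, ∀ g ∈ 𝔡.carrier, g ∈ K.endPart j →
      ψ (K.titsCoord (koszul F i j) a b f g) (K.titsDer a b f g) =
        S.superComm (ψ a f) (ψ b g)) :
    T.toSuperalgebra.IsIsomorphic (K.tits hK 𝔡 hd hd') := by
  let φ : (SO3 F ⊗[F] B) × 𝔡.carrier →ₗ[F] Module.End F A :=
    { toFun := fun x => ψ (so3Coord F B x.1) x.2.1
      map_add' := fun x y => by
        rw [← hadd, Prod.fst_add, map_add]
        rfl
      map_smul' := fun c x => by
        rw [RingHom.id_apply, ← hsmul, Prod.smul_fst, map_smul]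
        rfl }
  have hφ : ∀ x, φ x = ψ (so3Coord F B x.1) x.2.1 := fun _ => rfl
  have hc : ∀ {i : ZMod 2} {u : SO3 F ⊗[F] B}, u ∈ K.so3Part i → so3Coord F B u ∈ K.tripart i :=
    fun hu => by
      obtain ⟨h1, h2, h3⟩ := K.so3Coord_mem_of_mem hu
      exact ⟨h1, h2, h3⟩
  refine isIsomorphic_of_range_eq T _ φ ?_ ?_ ?_ ?_
  · refine (injective_iff_map_eq_zero φ).2 fun x hx => ?_
    obtain ⟨h1, h2⟩ := hinj _ x.2.1 x.2.2 hx
    refine Prod.ext ?_ (Subtype.ext h2)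
    rw [← so3Vec_coord hF x.1, h1]
    simp [so3Vec]
  · apply le_antisymm
    · rintro _ ⟨x, rfl⟩
      exact hmem _ x.2.1 x.2.2
    · intro D hD
      obtain ⟨a, f, hf, e⟩ := hsurj D hD
      refine ⟨(so3Vec F a, ⟨f, hf⟩), ?_⟩
      rw [hφ, so3Coord_vec, e]
  · exact fun i x hx => hpart i _ (hc hx.1) x.2.1 x.2.2 hx.2
  · rintro i j ⟨u, f⟩ ⟨v, g⟩ ⟨hu, hf⟩ ⟨hv, hg⟩
    have hg' : g.1 ∈ K.endPart j := hg
    -- The twist produces the sign with the parities in the order `j, i`; it is symmetric in them.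
    have hs : ∀ {a}, a ∈ K.part i → K.signTwist g.1 a = koszul F i j • g.1 a := fun ha => by
      rw [K.signTwist_apply hg' ha, koszul, koszul, mul_comm]
    obtain ⟨h1, h2, h3⟩ := hc hu
    have key := hmul i j _ (hc hu) f.1 f.2 hf _ (hc hv) g.1 g.2 hg
    rw [hφ, hφ, hφ]
    refine Eq.trans ?_ key
    congr 1
    · change so3Coord F B (K.so3Mul u v + LinearMap.lTensor (SO3 F) f.1 v -
        LinearMap.lTensor (SO3 F) (K.signTwist g.1) u) = _
      rw [map_sub, map_add, so3Coord_lTensor, so3Coord_lTensor, hs h1, hs h2, hs h3]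
      conv_lhs => rw [← so3Vec_coord hF u, ← so3Vec_coord hF v]
      simp only [so3Coord_so3Mul, so3Coord_vec]
      rfl
    · change K.so3Der u v + K.superComm f.1 g.1 = _
      conv_lhs => rw [← so3Vec_coord hF u, ← so3Vec_coord hF v]
      rw [so3Der_vec hF]
      rfl

end Superalgebra

section ChengKac

variable {F Z : Type*} [Field F] [CommRing Z] [Algebra F Z]

/-! ### The comparison map and its multiplicativity. -/

section TitsMap

/-- The linear extension to `JCK(Z, δ)` of endomorphisms of `K`, with the odd ones scaled by `ι`,
which sends derivations to derivations annihilating `w₁, w₂, w₃`, up to inner ones. -/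
def jckExt (ι : F) : Module.End F (Z × Z) →ₗ[F] Module.End F (JCKSpace Z) where
  toFun f :=
    { toFun := fun a =>
        (((f (a.1.1, 0)).1 + ι • (f (0, a.2.1)).1, (f (a.1.2.1, 0)).1, (f (a.1.2.2.1, 0)).1,
            (f (a.1.2.2.2, 0)).1),
          ((f (0, a.2.1)).2,
            -- For `f = kantorEven d h` this gives `2 d v - (d v + h v) = d v - h v`: a formula
            -- linear in `f` for the required coefficient `-h`, with no choice of `(d, h)`.
            2 * (f (a.2.2.1, 0)).1 - (f (0, a.2.2.1)).2 - ι • (f (0, a.1.2.1)).1,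
            2 * (f (a.2.2.2.1, 0)).1 - (f (0, a.2.2.2.1)).2 - ι • (f (0, a.1.2.2.1)).1,
            2 * (f (a.2.2.2.2, 0)).1 - (f (0, a.2.2.2.2)).2 - ι • (f (0, a.1.2.2.2)).1))
      map_add' := fun a b => by
        have e0 : ∀ x y : Z, f (x + y, 0) = f (x, 0) + f (y, 0) := fun x y => by
          rw [← map_add]; simp
        have e1 : ∀ x y : Z, f (0, x + y) = f (0, x) + f (0, y) := fun x y => by
          rw [← map_add]; simp
        ext <;> simp [e0, e1] <;> ring
      map_smul' := fun c a => by
        have e0 : ∀ x : Z, f (c • x, 0) = c • f (x, 0) := fun x => by rw [← map_smul]; simp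
        have e1 : ∀ x : Z, f (0, c • x) = c • f (0, x) := fun x => by rw [← map_smul]; simp
        ext <;> simp [e0, e1, smul_sub, smul_comm ι c] }
  map_add' f g := by
    apply LinearMap.ext
    intro a
    ext <;> simp <;> ring
  map_smul' c f := by
    apply LinearMap.ext
    intro a
    ext <;> simp [smul_sub, smul_comm ι c]

theorem jckExt_kantorEven (ι : F) (d : Derivation F Z Z) (h : Z) :
    jckExt ι (kantorEven d h) = jckExtEven d h := by
  apply LinearMap.ext
  rintro ⟨⟨a, u₁, u₂, u₃⟩, ⟨b, v₁, v₂, v₃⟩⟩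
  simp [jckExt, kantorEven_apply, jckExtEven_apply]
  refine ⟨?_, ?_, ?_⟩ <;> ring

theorem jckExt_kantorOdd (ι : F) (m : Z) :
    jckExt ι (kantorOdd F m) = jckExtOdd F (algebraMap F Z ι * m) := by
  apply LinearMap.ext
  rintro ⟨⟨a, u₁, u₂, u₃⟩, ⟨b, v₁, v₂, v₃⟩⟩
  simp [jckExt, kantorOdd_apply, jckExtOdd_apply, Algebra.smul_def, mul_assoc]

/-- The linear map `K³ ⊕ End(K) → End(JCK(Z, δ))` inducing, in coordinates, the isomorphism
between the Tits construction and the derivations of `JCK(Z, δ)`. -/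
noncomputable def jckTits (δ : Derivation F Z Z) (ι : F) (a : (Z × Z) × (Z × Z) × (Z × Z))
    (f : Module.End F (Z × Z)) : Module.End F (JCKSpace Z) :=
  -- Scaling the first two even coordinates by `ι` repairs the sign in `jckRot_comm_rot`. Scaling
  -- the third odd coordinate turns `q_1 q_1' + q_2 q_2' - q_3 q_3'` into a dot product. The mixed
  -- brackets are then compatible once the odd operators of `K` are also scaled by `ι`.
  jckRot δ (algebraMap F Z ι * a.1.1, algebraMap F Z ι * a.2.1.1, a.2.2.1) +
    jckOdd δ (a.1.2, a.2.1.2, algebraMap F Z ι * a.2.2.2) + jckExt ι f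

theorem jckTits_add (δ : Derivation F Z Z) (ι : F) (a b : (Z × Z) × (Z × Z) × (Z × Z))
    (f g : Module.End F (Z × Z)) :
    jckTits δ ι (a + b) (f + g) = jckTits δ ι a f + jckTits δ ι b g := by
  simp only [jckTits, Prod.fst_add, Prod.snd_add, mul_add, ← Prod.mk_add_mk, map_add]
  abel

theorem jckTits_smul (δ : Derivation F Z Z) (ι c : F) (a : (Z × Z) × (Z × Z) × (Z × Z))
    (f : Module.End F (Z × Z)) : jckTits δ ι (c • a) (c • f) = c • jckTits δ ι a f := by
  simp only [jckTits, Prod.smul_fst, Prod.smul_snd, mul_smul_comm, ← Prod.smul_mk, map_smul,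
    smul_add]

theorem mk_zero_zero_zero : ((0, 0, 0) : Z × Z × Z) = 0 := rfl

theorem jckTits_eq_add (δ : Derivation F Z Z) (ι : F) (a : (Z × Z) × (Z × Z) × (Z × Z))
    (d : Derivation F Z Z) (h m : Z) :
    jckTits δ ι a (kantorEven d h + kantorOdd F m) =
      (jckRot δ (algebraMap F Z ι * a.1.1, algebraMap F Z ι * a.2.1.1, a.2.2.1) +
        jckExtEven d h) +
      (jckOdd δ (a.1.2, a.2.1.2, algebraMap F Z ι * a.2.2.2) +
        jckExtOdd F (algebraMap F Z ι * m)) := by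
  rw [jckTits, map_add, jckExt_kantorEven, jckExt_kantorOdd]
  abel

theorem jckTits_even (δ : Derivation F Z Z) (ι : F) (s₁ s₂ s₃ : Z) (d : Derivation F Z Z)
    (h : Z) : jckTits δ ι ((s₁, 0), (s₂, 0), (s₃, 0)) (kantorEven d h) =
      jckRot δ (algebraMap F Z ι * s₁, algebraMap F Z ι * s₂, s₃) + jckExtEven d h := by
  simp [jckTits, jckExt_kantorEven, mk_zero_zero_zero]

theorem jckTits_odd (δ : Derivation F Z Z) (ι : F) (t₁ t₂ t₃ m : Z) :
    jckTits δ ι ((0, t₁), (0, t₂), (0, t₃)) (kantorOdd F m) =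
      jckOdd δ (t₁, t₂, algebraMap F Z ι * t₃) + jckExtOdd F (algebraMap F Z ι * m) := by
  simp [jckTits, jckExt_kantorOdd, mk_zero_zero_zero]

theorem jckExtOdd_add (m m' : Z) : jckExtOdd F (m + m') = jckExtOdd F m + jckExtOdd F m' := by
  apply LinearMap.ext
  rintro ⟨⟨a, u₁, u₂, u₃⟩, ⟨b, v₁, v₂, v₃⟩⟩
  simp [jckExtOdd_apply]
  refine ⟨?_, ?_, ?_, ?_⟩ <;> ring

theorem jckExtOdd_neg (m : Z) : jckExtOdd F (-m) = -jckExtOdd F m := by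
  apply LinearMap.ext
  rintro ⟨⟨a, u₁, u₂, u₃⟩, ⟨b, v₁, v₂, v₃⟩⟩
  simp [jckExtOdd_apply]

/-- Reduces each multiplicativity check to scalar equations in `Z`, one per coordinate. The odd
counterpart does the same. -/
theorem jckTits_eq_of_even {δ : Derivation F Z Z} {ι : F} {a : (Z × Z) × (Z × Z) × (Z × Z)}
    {f : Module.End F (Z × Z)} {d : Derivation F Z Z} {h s₁ s₂ s₃ p₁ p₂ p₃ : Z}
    (ha : a = ((s₁, 0), (s₂, 0), (s₃, 0))) (hf : f = kantorEven d h)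
    (h₁ : algebraMap F Z ι * s₁ = p₁) (h₂ : algebraMap F Z ι * s₂ = p₂) (h₃ : s₃ = p₃) :
    jckTits δ ι a f = jckRot δ (p₁, p₂, p₃) + jckExtEven d h := by
  rw [ha, hf, jckTits_even, h₁, h₂, h₃]

theorem jckTits_eq_of_odd {δ : Derivation F Z Z} {ι : F} {a : (Z × Z) × (Z × Z) × (Z × Z)}
    {f : Module.End F (Z × Z)} {m m' t₁ t₂ t₃ q₁ q₂ q₃ : Z}
    (ha : a = ((0, t₁), (0, t₂), (0, t₃))) (hf : f = kantorOdd F m)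
    (h₁ : t₁ = q₁) (h₂ : t₂ = q₂) (h₃ : algebraMap F Z ι * t₃ = q₃)
    (hm : algebraMap F Z ι * m = m') :
    jckTits δ ι a f = jckOdd δ (q₁, q₂, q₃) + jckExtOdd F m' := by
  rw [ha, hf, jckTits_odd, h₁, h₂, h₃, hm]

section Mul

variable (δ : Derivation F Z Z) {ι : F}

theorem jck_superComm_even_even (d d' : Derivation F Z Z) (h h' : Z)
    (hd : ∀ a, d (δ a) = δ (d a) + 2 * h * δ a)
    (hd' : ∀ a, d' (δ a) = δ (d' a) + 2 * h' * δ a) (p₁ p₂ p₃ p₁' p₂' p₃' : Z) :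
    (JCK δ).superComm (jckRot δ (p₁, p₂, p₃) + jckExtEven d h)
        (jckRot δ (p₁', p₂', p₃') + jckExtEven d' h') =
      jckRot δ (p₂ * p₃' - p₃ * p₂' + d p₁' - d' p₁, p₃ * p₁' - p₁ * p₃' + d p₂' - d' p₂,
        -(p₁ * p₂' - p₂ * p₁') + d p₃' - d' p₃) + jckExtEven ⁅d, d'⁆ (d h' - d' h) := by
  simp only [map_add, LinearMap.add_apply]
  rw [jckRot_comm_rot, jckExtEven_comm_rot δ d h hd, jckExtEven_comm_extEven,
    (JCK δ).superComm_skew (jckRot_mem δ _) (jckExtEven_mem δ d' h'),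
    jckExtEven_comm_rot δ d' h' hd', koszul_zero_left, one_smul, ← map_neg]
  simp only [← add_assoc]
  rw [← map_add, ← map_add, Prod.neg_mk, Prod.neg_mk]
  simp only [Prod.mk_add_mk, sub_eq_add_neg]

theorem jck_superComm_even_odd (d : Derivation F Z Z) (h : Z)
    (hd : ∀ a, d (δ a) = δ (d a) + 2 * h * δ a) (p₁ p₂ p₃ q₁ q₂ q₃ m : Z) :
    (JCK δ).superComm (jckRot δ (p₁, p₂, p₃) + jckExtEven d h)
        (jckOdd δ (q₁, q₂, q₃) + jckExtOdd F m) =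
      jckOdd δ (-p₂ * q₃ - p₃ * q₂ + (d q₁ + h * q₁), p₃ * q₁ + p₁ * q₃ + (d q₂ + h * q₂),
        p₁ * q₂ - p₂ * q₁ + (d q₃ + h * q₃)) +
      jckExtOdd F (d m - h * m - (q₁ * δ p₁ + q₂ * δ p₂ + q₃ * δ p₃)) := by
  have e : ((-p₂ * q₃ - p₃ * q₂ + (d q₁ + h * q₁), p₃ * q₁ + p₁ * q₃ + (d q₂ + h * q₂),
        p₁ * q₂ - p₂ * q₁ + (d q₃ + h * q₃)) : Z × Z × Z) =
      (-p₂ * q₃ - p₃ * q₂, p₃ * q₁ + p₁ * q₃, p₁ * q₂ - p₂ * q₁) +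
        (d q₁ + h * q₁, d q₂ + h * q₂, d q₃ + h * q₃) := rfl
  rw [e, map_add (jckOdd δ), map_add, map_add, LinearMap.add_apply, LinearMap.add_apply,
    jckRot_comm_odd, jckExtEven_comm_odd δ d h hd, jckExtEven_comm_extOdd,
    (JCK δ).superComm_skew (jckRot_mem δ _) (jckExtOdd_mem δ m), jckExtOdd_comm_rot,
    sub_eq_add_neg (d m - h * m), jckExtOdd_add (d m - h * m), jckExtOdd_neg,
    smul_zero, neg_zero, zero_add]
  abel

theorem jck_superComm_odd_odd (q₁ q₂ q₃ m q₁' q₂' q₃' m' : Z) :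
    (JCK δ).superComm (jckOdd δ (q₁, q₂, q₃) + jckExtOdd F m)
        (jckOdd δ (q₁', q₂', q₃') + jckExtOdd F m') =
      jckRot δ ((δ q₂ * q₃' - q₂ * δ q₃') - (δ q₃ * q₂' - q₃ * δ q₂') + m * q₁' + m' * q₁,
        (δ q₃ * q₁' - q₃ * δ q₁') - (δ q₁ * q₃' - q₁ * δ q₃') + m * q₂' + m' * q₂,
        (δ q₁ * q₂' - q₁ * δ q₂') - (δ q₂ * q₁' - q₂ * δ q₁') + -(m * q₃') + -(m' * q₃)) +
      jckExtEven ((2 * (q₁ * q₁' + q₂ * q₂' - q₃ * q₃')) • δ)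
        (-δ (q₁ * q₁' + q₂ * q₂' - q₃ * q₃')) := by
  rw [map_add, map_add, LinearMap.add_apply, LinearMap.add_apply]
  rw [jckOdd_comm_odd, jckExtOdd_comm_odd, jckExtOdd_comm_extOdd,
    (JCK δ).superComm_skew (jckOdd_mem δ _) (jckExtOdd_mem δ m'), jckExtOdd_comm_odd,
    koszul_one_one]
  rw [← Prod.mk_add_mk, ← Prod.mk_add_mk, ← Prod.mk_add_mk, ← Prod.mk_add_mk, map_add, map_add]
  have hs : ∀ X : Module.End F (JCKSpace Z), -((-1 : F) • X) = X := fun X => by module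
  rw [hs]
  abel

theorem algebraMap_sq {F : Type*} [Field F] {ι : F} (hι : -1 = ι * ι) (Z : Type*) [CommRing Z] [Algebra F Z] :
    algebraMap F Z ι * algebraMap F Z ι = -1 := by
  rw [← map_mul, ← hι, map_neg, map_one]

theorem jckTits_mul_even_even (hι : -1 = ι * ι)
    (s₁ s₂ s₃ s₁' s₂' s₃' : Z) (d d' : Derivation F Z Z) (h h' : Z)
    (hd : ∀ a, d (δ a) = δ (d a) + 2 * h * δ a)
    (hd' : ∀ a, d' (δ a) = δ (d' a) + 2 * h' * δ a) :
    jckTits δ ι ((KantorK δ).titsCoord (koszul F 0 0) ((s₁, 0), (s₂, 0), (s₃, 0))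
        ((s₁', 0), (s₂', 0), (s₃', 0)) (kantorEven d h) (kantorEven d' h'))
      ((KantorK δ).titsDer ((s₁, 0), (s₂, 0), (s₃, 0)) ((s₁', 0), (s₂', 0), (s₃', 0))
        (kantorEven d h) (kantorEven d' h')) =
      (JCK δ).superComm (jckTits δ ι ((s₁, 0), (s₂, 0), (s₃, 0)) (kantorEven d h))
        (jckTits δ ι ((s₁', 0), (s₂', 0), (s₃', 0)) (kantorEven d' h')) := by
  have hj := algebraMap_sq hι Z
  rw [jckTits_even, jckTits_even, jck_superComm_even_even δ d d' h h' hd hd']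
  refine jckTits_eq_of_even
    (s₁ := s₂ * s₃' - s₃ * s₂' + d s₁' - d' s₁) (s₂ := s₃ * s₁' - s₁ * s₃' + d s₂' - d' s₂)
    (s₃ := s₁ * s₂' - s₂ * s₁' + d s₃' - d' s₃) ?_ ?_ ?_ ?_ ?_
  · simp [Superalgebra.titsCoord, koszul_zero_left, koszul_zero_right, koszul_one_one,
      kantorEven_apply, kantorEven_apply, KantorK_mul_apply, kantorMul]
  · simp [Superalgebra.titsDer, kantor_innerDer_even_even, kantorEven_comm_even]
  · simp; ring
  · simp; ring
  · simp
    -- Here `ι² = -1` absorbs the minus sign of the third coordinate of `jckRot_comm_rot`.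
    linear_combination -(s₁' * s₂ - s₁ * s₂') * hj

theorem jckTits_mul_even_odd (hι : -1 = ι * ι)
    (s₁ s₂ s₃ t₁ t₂ t₃ : Z) (d : Derivation F Z Z) (h m : Z)
    (hd : ∀ a, d (δ a) = δ (d a) + 2 * h * δ a) :
    jckTits δ ι ((KantorK δ).titsCoord (koszul F 0 1) ((s₁, 0), (s₂, 0), (s₃, 0))
        ((0, t₁), (0, t₂), (0, t₃)) (kantorEven d h) (kantorOdd F m))
      ((KantorK δ).titsDer ((s₁, 0), (s₂, 0), (s₃, 0)) ((0, t₁), (0, t₂), (0, t₃))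
        (kantorEven d h) (kantorOdd F m)) =
      (JCK δ).superComm (jckTits δ ι ((s₁, 0), (s₂, 0), (s₃, 0)) (kantorEven d h))
        (jckTits δ ι ((0, t₁), (0, t₂), (0, t₃)) (kantorOdd F m)) := by
  have hj := algebraMap_sq hι Z
  rw [jckTits_even, jckTits_odd, jck_superComm_even_odd δ d h hd]
  refine jckTits_eq_of_odd (m := d m - h * m - (t₁ * δ s₁ + t₂ * δ s₂ + t₃ * δ s₃))
    (t₁ := s₂ * t₃ - s₃ * t₂ + (d t₁ + h * t₁)) (t₂ := s₃ * t₁ - s₁ * t₃ + (d t₂ + h * t₂))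
    (t₃ := s₁ * t₂ - s₂ * t₁ + (d t₃ + h * t₃)) ?_ ?_ ?_ ?_ ?_ ?_
  · simp [Superalgebra.titsCoord, koszul_zero_left, koszul_zero_right, koszul_one_one,
      kantorEven_apply, kantorOdd_apply, KantorK_mul_apply, kantorMul]
  · simp only [Superalgebra.titsDer, kantor_innerDer_even_odd,
      kantorEven_comm_odd]
    apply LinearMap.ext
    rintro ⟨a, b⟩
    simp [kantorOdd_apply]
    ring
  · linear_combination (s₂ * t₃) * hj
  · linear_combination -(s₁ * t₃) * hj
  · simp; ring
  · simp; ring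

theorem jckTits_mul_odd_even (hι : -1 = ι * ι)
    (s₁ s₂ s₃ t₁ t₂ t₃ : Z) (d : Derivation F Z Z) (h m : Z)
    (hd : ∀ a, d (δ a) = δ (d a) + 2 * h * δ a) :
    jckTits δ ι ((KantorK δ).titsCoord (koszul F 1 0) ((0, t₁), (0, t₂), (0, t₃))
        ((s₁, 0), (s₂, 0), (s₃, 0)) (kantorOdd F m) (kantorEven d h))
      ((KantorK δ).titsDer ((0, t₁), (0, t₂), (0, t₃)) ((s₁, 0), (s₂, 0), (s₃, 0))
        (kantorOdd F m) (kantorEven d h)) =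
      (JCK δ).superComm (jckTits δ ι ((0, t₁), (0, t₂), (0, t₃)) (kantorOdd F m))
        (jckTits δ ι ((s₁, 0), (s₂, 0), (s₃, 0)) (kantorEven d h)) := by
  have hj := algebraMap_sq hι Z
  -- The bracket on `J` is obtained from the even-odd one by super-anticommutativity.
  rw [jckTits_even, jckTits_odd, (JCK δ).superComm_skew
    (add_mem (jckOdd_mem δ _) (jckExtOdd_mem δ _)) (add_mem (jckRot_mem δ _) (jckExtEven_mem δ _ _)),
    jck_superComm_even_odd δ d h hd, koszul_zero_right, one_smul, neg_add, ← map_neg,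
    ← jckExtOdd_neg, Prod.neg_mk, Prod.neg_mk]
  refine jckTits_eq_of_odd (m := -(d m - h * m - (t₁ * δ s₁ + t₂ * δ s₂ + t₃ * δ s₃)))
    (t₁ := t₂ * s₃ - t₃ * s₂ - (d t₁ + h * t₁)) (t₂ := t₃ * s₁ - t₁ * s₃ - (d t₂ + h * t₂))
    (t₃ := t₁ * s₂ - t₂ * s₁ - (d t₃ + h * t₃)) ?_ ?_ ?_ ?_ ?_ ?_
  · simp [Superalgebra.titsCoord, koszul_zero_left, koszul_zero_right, koszul_one_one,
      kantorOdd_apply, kantorEven_apply, KantorK_mul_apply, kantorMul]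
  · simp only [Superalgebra.titsDer, kantor_innerDer_odd_even,
      (KantorK δ).superComm_skew (kantorOdd_mem δ m) (kantorEven_mem δ d h),
      kantorEven_comm_odd, koszul_zero_right, one_smul]
    apply LinearMap.ext
    rintro ⟨a, b⟩
    simp [kantorOdd_apply]
    ring
  · linear_combination -(s₂ * t₃) * hj
  · linear_combination (s₁ * t₃) * hj
  · simp; ring
  · simp; ring

theorem jckTits_mul_odd_odd (hι : -1 = ι * ι)
    (t₁ t₂ t₃ m t₁' t₂' t₃' m' : Z) :
    jckTits δ ι ((KantorK δ).titsCoord (koszul F 1 1) ((0, t₁), (0, t₂), (0, t₃))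
        ((0, t₁'), (0, t₂'), (0, t₃')) (kantorOdd F m) (kantorOdd F m'))
      ((KantorK δ).titsDer ((0, t₁), (0, t₂), (0, t₃)) ((0, t₁'), (0, t₂'), (0, t₃'))
        (kantorOdd F m) (kantorOdd F m')) =
      (JCK δ).superComm (jckTits δ ι ((0, t₁), (0, t₂), (0, t₃)) (kantorOdd F m))
        (jckTits δ ι ((0, t₁'), (0, t₂'), (0, t₃')) (kantorOdd F m')) := by
  have hj := algebraMap_sq hι Z
  rw [jckTits_odd, jckTits_odd, jck_superComm_odd_odd]
  -- The indefinite form becomes the sum of squares occurring in `-∑ D(t_i x, t_i' x)`.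
  have e : t₁ * t₁' + t₂ * t₂' - algebraMap F Z ι * t₃ * (algebraMap F Z ι * t₃') =
      t₁ * t₁' + t₂ * t₂' + t₃ * t₃' := by linear_combination -(t₃ * t₃') * hj
  rw [e]
  refine jckTits_eq_of_even
    (s₁ := (δ t₂ * t₃' - t₂ * δ t₃') - (δ t₃ * t₂' - t₃ * δ t₂') + m * t₁' + m' * t₁)
    (s₂ := (δ t₃ * t₁' - t₃ * δ t₁') - (δ t₁ * t₃' - t₁ * δ t₃') + m * t₂' + m' * t₂)
    (s₃ := (δ t₁ * t₂' - t₁ * δ t₂') - (δ t₂ * t₁' - t₂ * δ t₁') + m * t₃' + m' * t₃)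
    ?_ ?_ ?_ ?_ ?_
  · simp [Superalgebra.titsCoord, koszul_zero_left, koszul_zero_right, koszul_one_one,
      kantorOdd_apply, kantorOdd_apply, KantorK_mul_apply, kantorMul]
  · simp only [Superalgebra.titsDer, kantor_innerDer_odd_odd, kantorOdd_comm_odd]
    apply LinearMap.ext
    rintro ⟨a, b⟩
    simp [kantorEven_apply]
    constructor <;> ring
  · simp; ring
  · simp; ring
  · linear_combination (m * t₃' + m' * t₃) * hj

end Mul

end TitsMap
end ChengKac

section ChengKac

variable {F Z : Type*} [Field F] [CommRing Z] [Algebra F Z]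

/-! ### The two isomorphisms. -/

section Isomorphism

theorem exists_eq_of_mem_tripart_zero {δ : Derivation F Z Z} {a : (Z × Z) × (Z × Z) × (Z × Z)}
    (ha : a ∈ (KantorK δ).tripart 0) : ∃ s₁ s₂ s₃, a = ((s₁, 0), (s₂, 0), (s₃, 0)) :=
  ⟨a.1.1, a.2.1.1, a.2.2.1, Prod.ext (Prod.ext rfl (mem_prodPart_zero.1 ha.1))
    (Prod.ext (Prod.ext rfl (mem_prodPart_zero.1 ha.2.1))
      (Prod.ext rfl (mem_prodPart_zero.1 ha.2.2)))⟩

theorem exists_eq_of_mem_tripart_one {δ : Derivation F Z Z} {a : (Z × Z) × (Z × Z) × (Z × Z)}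
    (ha : a ∈ (KantorK δ).tripart 1) : ∃ t₁ t₂ t₃, a = ((0, t₁), (0, t₂), (0, t₃)) :=
  ⟨a.1.2, a.2.1.2, a.2.2.2, Prod.ext (Prod.ext (mem_prodPart_one.1 ha.1) rfl)
    (Prod.ext (Prod.ext (mem_prodPart_one.1 ha.2.1) rfl)
      (Prod.ext (mem_prodPart_one.1 ha.2.2) rfl))⟩

/-- The summands are separated by evaluation: extensions kill `w_1` and `w_2`, rotations kill `Z`,
and the `x`-coordinate of the image of `x` is `h`. -/
theorem eq_zero_of_jckRot_add_jckExtEven {δ d : Derivation F Z Z} {h p₁ p₂ p₃ : Z}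
    (e : jckRot δ (p₁, p₂, p₃) + jckExtEven d h = 0) :
    p₁ = 0 ∧ p₂ = 0 ∧ p₃ = 0 ∧ kantorEven d h = 0 := by
  have e1 := congrArg (fun D : Module.End F (JCKSpace Z) => D ((0, 1, 0, 0), (0, 0, 0, 0))) e
  have e2 := congrArg (fun D : Module.End F (JCKSpace Z) => D ((0, 0, 1, 0), (0, 0, 0, 0))) e
  have ez := fun a =>
    congrArg (fun D : Module.End F (JCKSpace Z) => D ((a, 0, 0, 0), (0, 0, 0, 0))) e
  have ex := congrArg (fun D : Module.End F (JCKSpace Z) => D ((0, 0, 0, 0), (1, 0, 0, 0))) e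
  simp [jckRot_apply, jckExtEven_apply, Prod.ext_iff] at e1 e2 ez ex
  refine ⟨e2.2, e1.2, e1.1, ?_⟩
  apply LinearMap.ext
  rintro ⟨a, b⟩
  simp [kantorEven_apply, ez, ex]

theorem eq_zero_of_jckOdd_add_jckExtOdd {δ : Derivation F Z Z} {q₁ q₂ q₃ m : Z}
    (e : jckOdd δ (q₁, q₂, q₃) + jckExtOdd F m = 0) : q₁ = 0 ∧ q₂ = 0 ∧ q₃ = 0 ∧ m = 0 := by
  have e1 := congrArg (fun D : Module.End F (JCKSpace Z) => D ((0, 1, 0, 0), (0, 0, 0, 0))) e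
  have e2 := congrArg (fun D : Module.End F (JCKSpace Z) => D ((0, 0, 1, 0), (0, 0, 0, 0))) e
  have e3 := congrArg (fun D : Module.End F (JCKSpace Z) => D ((0, 0, 0, 1), (0, 0, 0, 0))) e
  have ex := congrArg (fun D : Module.End F (JCKSpace Z) => D ((0, 0, 0, 0), (1, 0, 0, 0))) e
  simp [jckOdd_apply, jckExtOdd_apply, Prod.ext_iff] at e1 e2 e3 ex
  exact ⟨e1.1, e2.1, e3.1, ex.1⟩

/-- If a graded subalgebra `d` of `gl(K)` is described by a class of pairs `(d, h)` and all the
`kantorOdd m`, and a graded subalgebra `c` of `gl(JCK(Z, δ))` is described by the corresponding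
operators, then `c` is isomorphic to the Tits construction of `d`. -/
theorem jck_isIsomorphic_tits (hF : ringChar F ≠ 2) {ι : F} (hι : -1 = ι * ι)
    (δ : Derivation F Z Z) (c : (JCK δ).gl.Sub) (𝔡 : (KantorK δ).gl.Sub)
    (hd : ((KantorK δ).inder (KantorK_isJordan δ)).carrier ≤ 𝔡.carrier)
    (hd' : 𝔡.carrier ≤ (KantorK δ).der.carrier)
    (h𝔡₀ : ∀ f ∈ 𝔡.carrier, f ∈ (KantorK δ).endPart 0 → ∃ (d : Derivation F Z Z) (h : Z),
      (∀ a, d (δ a) = δ (d a) + 2 * h * δ a) ∧ f = kantorEven d h)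
    (h𝔡₁ : ∀ f ∈ 𝔡.carrier, f ∈ (KantorK δ).endPart 1 → ∃ m : Z, f = kantorOdd F m)
    (hodd : ∀ m : Z, kantorOdd F m ∈ 𝔡.carrier)
    (hc₀ : ∀ D ∈ (JCK δ).endPart 0, D ∈ c.carrier ↔ ∃ (p : Z × Z × Z) (d : Derivation F Z Z)
      (h : Z), kantorEven d h ∈ 𝔡.carrier ∧ D = jckRot δ p + jckExtEven d h)
    (hc₁ : ∀ D ∈ (JCK δ).endPart 1, D ∈ c.carrier ↔ ∃ (q : Z × Z × Z) (m : Z),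
      D = jckOdd δ q + jckExtOdd F m) :
    c.toSuperalgebra.IsIsomorphic ((KantorK δ).tits (KantorK_isJordan δ) 𝔡 hd hd') := by
  have hj := algebraMap_sq hι Z
  -- The image of `ι` is a unit of `Z` with inverse `-ι`; the same inverse gives the preimages for
  -- surjectivity.
  have hjz : ∀ z : Z, algebraMap F Z ι * z = 0 → z = 0 := fun z hz => by
    linear_combination (-algebraMap F Z ι) * hz + z * hj
  have hdec : ∀ f ∈ 𝔡.carrier, ∃ (d : Derivation F Z Z) (h m : Z),
      kantorEven d h ∈ 𝔡.carrier ∧ f = kantorEven d h + kantorOdd F m := by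
    intro f hf
    obtain ⟨d, h, -, e0⟩ := h𝔡₀ _ (𝔡.proj_mem 0 f hf) ((KantorK δ).gl.proj_mem 0 f)
    obtain ⟨m, e1⟩ := h𝔡₁ _ (𝔡.proj_mem 1 f hf) ((KantorK δ).gl.proj_mem 1 f)
    refine ⟨d, h, m, e0 ▸ 𝔡.proj_mem 0 f hf, ?_⟩
    rw [← e0, ← e1, (KantorK δ).gl.proj_add]
  have hm0 : ∀ p d h, jckRot δ p + jckExtEven d h ∈ (JCK δ).endPart 0 := fun p d h =>
    add_mem (jckRot_mem δ p) (jckExtEven_mem δ d h)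
  have hm1 : ∀ q m, jckOdd δ q + jckExtOdd F m ∈ (JCK δ).endPart 1 := fun q m =>
    add_mem (jckOdd_mem δ q) (jckExtOdd_mem δ m)
  refine Superalgebra.Sub.isIsomorphic_tits hF c _ _ 𝔡 hd hd' (jckTits δ ι) (jckTits_add δ ι)
    (jckTits_smul δ ι) ?_ ?_ ?_ ?_ ?_
  · rintro ⟨⟨s₁, t₁⟩, ⟨s₂, t₂⟩, ⟨s₃, t₃⟩⟩ f hf𝔡 hu
    obtain ⟨d, h, m, -, rfl⟩ := hdec f hf𝔡
    rw [jckTits_eq_add] at hu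
    have hu1 := eq_neg_of_add_eq_zero_left hu
    -- The even summand equals minus the odd one, so both vanish.
    have hz := Submodule.disjoint_def.1 (JCK δ).isCompl_endPart.disjoint _ (hm0 _ _ _)
      (hu1 ▸ neg_mem (hm1 _ _))
    rw [hz, zero_add] at hu
    obtain ⟨p1, p2, p3, hk⟩ := eq_zero_of_jckRot_add_jckExtEven hz
    obtain ⟨q1, q2, q3, hm⟩ := eq_zero_of_jckOdd_add_jckExtOdd hu
    constructor
    · simp_all
    · rw [hk, hjz _ hm, zero_add]
      apply LinearMap.ext
      rintro ⟨a, b⟩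
      simp [kantorOdd_apply]
  · intro a f hf𝔡
    obtain ⟨d, h, m, hk, rfl⟩ := hdec f hf𝔡
    rw [jckTits_eq_add]
    exact add_mem ((hc₀ _ (hm0 _ _ _)).2 ⟨_, d, h, hk, rfl⟩) ((hc₁ _ (hm1 _ _)).2 ⟨_, _, rfl⟩)
  · intro D hD
    obtain ⟨⟨p₁, p₂, p₃⟩, d, h, hk, e0⟩ := (hc₀ _ ((JCK δ).gl.proj_mem 0 D)).1
      (c.proj_mem 0 D hD)
    obtain ⟨⟨q₁, q₂, q₃⟩, m, e1⟩ := (hc₁ _ ((JCK δ).gl.proj_mem 1 D)).1 (c.proj_mem 1 D hD)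
    have hjj : ∀ z, algebraMap F Z ι * (-algebraMap F Z ι * z) = z := fun z => by
      linear_combination -z * hj
    refine ⟨((-algebraMap F Z ι * p₁, q₁), (-algebraMap F Z ι * p₂, q₂),
      (p₃, -algebraMap F Z ι * q₃)),
      kantorEven d h + kantorOdd F (-algebraMap F Z ι * m), add_mem hk (hodd _), ?_⟩
    rw [jckTits_eq_add]
    dsimp only
    rw [hjj, hjj, hjj, hjj, ← e0, ← e1, (JCK δ).gl.proj_add]
  · intro i a ha f hf𝔡 hf
    rcases parity_cases i with rfl | rfl
    · obtain ⟨s₁, s₂, s₃, rfl⟩ := exists_eq_of_mem_tripart_zero ha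
      obtain ⟨d, h, -, rfl⟩ := h𝔡₀ f hf𝔡 hf
      rw [jckTits_even]
      exact hm0 _ _ _
    · obtain ⟨t₁, t₂, t₃, rfl⟩ := exists_eq_of_mem_tripart_one ha
      obtain ⟨m, rfl⟩ := h𝔡₁ f hf𝔡 hf
      rw [jckTits_odd]
      exact hm1 _ _
  · intro i j a ha f hf𝔡 hf b hb g hg𝔡 hg
    rcases parity_cases i with rfl | rfl <;> rcases parity_cases j with rfl | rfl
    · obtain ⟨s₁, s₂, s₃, rfl⟩ := exists_eq_of_mem_tripart_zero ha
      obtain ⟨s₁', s₂', s₃', rfl⟩ := exists_eq_of_mem_tripart_zero hb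
      obtain ⟨d, h, hdh, rfl⟩ := h𝔡₀ f hf𝔡 hf
      obtain ⟨d', h', hdh', rfl⟩ := h𝔡₀ g hg𝔡 hg
      exact jckTits_mul_even_even δ hι _ _ _ _ _ _ d d' h h' hdh hdh'
    · obtain ⟨s₁, s₂, s₃, rfl⟩ := exists_eq_of_mem_tripart_zero ha
      obtain ⟨t₁, t₂, t₃, rfl⟩ := exists_eq_of_mem_tripart_one hb
      obtain ⟨d, h, hdh, rfl⟩ := h𝔡₀ f hf𝔡 hf
      obtain ⟨m, rfl⟩ := h𝔡₁ g hg𝔡 hg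
      exact jckTits_mul_even_odd δ hι _ _ _ _ _ _ d h m hdh
    · obtain ⟨t₁, t₂, t₃, rfl⟩ := exists_eq_of_mem_tripart_one ha
      obtain ⟨s₁, s₂, s₃, rfl⟩ := exists_eq_of_mem_tripart_zero hb
      obtain ⟨m, rfl⟩ := h𝔡₁ f hf𝔡 hf
      obtain ⟨d, h, hdh, rfl⟩ := h𝔡₀ g hg𝔡 hg
      exact jckTits_mul_odd_even δ hι _ _ _ _ _ _ d h m hdh
    · obtain ⟨t₁, t₂, t₃, rfl⟩ := exists_eq_of_mem_tripart_one ha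
      obtain ⟨t₁', t₂', t₃', rfl⟩ := exists_eq_of_mem_tripart_one hb
      obtain ⟨m, rfl⟩ := h𝔡₁ f hf𝔡 hf
      obtain ⟨m', rfl⟩ := h𝔡₁ g hg𝔡 hg
      exact jckTits_mul_odd_odd δ hι _ _ _ _ _ _ _ _

theorem exists_mul_of_mem_kantor_inderPart {δ : Derivation F Z Z} {f : Module.End F (Z × Z)}
    (hf : f ∈ (KantorK δ).inderPart 0) : ∃ k : Z, ∀ a, (f (a, 0)).1 = k * δ a := by
  induction hf using Submodule.span_induction with
  | mem f hf =>
    obtain ⟨j, k, hjk, ⟨a, a'⟩, ha, ⟨b, b'⟩, hb, rfl⟩ := hf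
    rcases parity_cases j with rfl | rfl <;> rcases parity_cases k with rfl | rfl
    · obtain rfl : a' = 0 := mem_prodPart_zero.1 ha
      obtain rfl : b' = 0 := mem_prodPart_zero.1 hb
      exact ⟨0, fun c => by simp [kantor_innerDer_even_even]⟩
    · exact absurd hjk (by decide)
    · exact absurd hjk (by decide)
    · obtain rfl : a = 0 := mem_prodPart_one.1 ha
      obtain rfl : b = 0 := mem_prodPart_one.1 hb
      exact ⟨-(2 * (a' * b')), fun c => by simp [kantor_innerDer_odd_odd, kantorEven_apply]⟩
  | zero => exact ⟨0, by simp⟩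
  | add f g _ _ hf hg =>
    obtain ⟨m, hm⟩ := hf
    obtain ⟨n, hn⟩ := hg
    exact ⟨m + n, fun a => by simp [hm, hn, add_mul]⟩
  | smul c f _ hf =>
    obtain ⟨m, hm⟩ := hf
    exact ⟨c • m, fun a => by simp [hm]⟩

/-- The test for innerness of an even derivation. On the `1`-coordinate, pairs of even elements
contribute nothing, and a pair of odd elements with `x`-coordinates `f`, `g` contributes `-2fg δ`.
-/
theorem exists_mul_of_mem_jck_inderPart {δ : Derivation F Z Z}
    {D : Module.End F (JCKSpace Z)} (hD : D ∈ (JCK δ).inderPart 0) :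
    ∃ k : Z, ∀ a, (D ((a, 0, 0, 0), (0, 0, 0, 0))).1.1 = k * δ a := by
  induction hD using Submodule.span_induction with
  | mem D hD =>
    obtain ⟨j, k, hjk, a, ha, b, hb, rfl⟩ := hD
    rcases jck_mem_cases ha with ⟨rfl, f, u₁, u₂, u₃, rfl⟩ | ⟨rfl, f, u₁, u₂, u₃, rfl⟩ <;>
    rcases jck_mem_cases hb with ⟨rfl, g, v₁, v₂, v₃, rfl⟩ | ⟨rfl, g, v₁, v₂, v₃, rfl⟩
    · refine ⟨0, fun c => ?_⟩
      rw [(JCK δ).innerDer_apply ha hb]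
      simp [JCK_mul_apply, jckMul, koszul_zero_left]
      ring
    · exact absurd hjk (by decide)
    · exact absurd hjk (by decide)
    · refine ⟨-(2 * (f * g)), fun c => ?_⟩
      rw [(JCK δ).innerDer_apply ha hb]
      simp [JCK_mul_apply, jckMul, koszul_one_one]
      ring
  | zero => exact ⟨0, by simp⟩
  | add f g _ _ hf hg =>
    obtain ⟨m, hm⟩ := hf
    obtain ⟨n, hn⟩ := hg
    exact ⟨m + n, fun a => by simp [hm, hn, add_mul]⟩
  | smul c f _ hf =>
    obtain ⟨m, hm⟩ := hf
    exact ⟨c • m, fun a => by simp [hm]⟩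

/-- Inserting `d = kδ` in `[d, δ] = 2hδ` gives `(2h + δ k) δ(a) = 0` for all `a`, hence `2h = -δ k`.
The conclusion has the shape of the parameters of `D(t x, x)` with `t = -k/2`, which explains the
factor `1`. -/
theorem eq_of_mul_derivation (hF : ringChar F ≠ 2) {δ d : Derivation F Z Z} {h k : Z}
    (hδ : Ideal.span (Set.range δ) = ⊤) (hd : ∀ a, d (δ a) = δ (d a) + 2 * h * δ a)
    (hk : ∀ a, d a = k * δ a) :
    d = (-(2 * ((-2⁻¹ : F) • k * 1))) • δ ∧ h = δ ((-2⁻¹ : F) • k * 1) := by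
  have h2 : (2 : F) ≠ 0 := Ring.two_ne_zero hF
  have ht : ∀ z : Z, 2 * ((2⁻¹ : F) • z) = z := fun z => by
    rw [mul_smul_comm, two_mul, ← two_smul F z, smul_smul, inv_mul_cancel₀ h2, one_smul]
  have hh : 2 * h + δ k = 0 := eq_zero_of_mul_derivation hδ fun a => by
    have e := hd a
    rw [hk, hk, Derivation.leibniz, smul_eq_mul, smul_eq_mul] at e
    linear_combination -e
  constructor
  · ext a
    simp [hk, ht]
  · rw [mul_one, Derivation.map_smul, neg_smul]
    rw [show δ k = -(2 * h) by linear_combination hh, smul_neg, neg_neg, ← mul_smul_comm, ht]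

theorem kantorEven_mem_inderPart (hF : ringChar F ≠ 2) {δ d : Derivation F Z Z} {h k : Z}
    (hδ : Ideal.span (Set.range δ) = ⊤) (hd : ∀ a, d (δ a) = δ (d a) + 2 * h * δ a)
    (hk : ∀ a, d a = k * δ a) : kantorEven d h ∈ (KantorK δ).inderPart 0 := by
  obtain ⟨e1, e2⟩ := eq_of_mul_derivation hF hδ hd hk
  rw [e1, e2, ← kantor_innerDer_odd_odd]
  exact Submodule.subset_span
    ⟨1, 1, rfl, _, kantor_mem_part_one δ _, _, kantor_mem_part_one δ _, rfl⟩

theorem jckExtEven_mem_inderPart (hF : ringChar F ≠ 2) {δ d : Derivation F Z Z} {h k : Z}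
    (hδ : Ideal.span (Set.range δ) = ⊤) (hd : ∀ a, d (δ a) = δ (d a) + 2 * h * δ a)
    (hk : ∀ a, d a = k * δ a) : jckExtEven d h ∈ (JCK δ).inderPart 0 := by
  obtain ⟨e1, e2⟩ := eq_of_mul_derivation hF hδ hd hk
  rw [e1, e2, ← jck_innerDer_odd_odd]
  exact Submodule.subset_span ⟨1, 1, rfl, _, jckX_mem δ _, _, jckX_mem δ _, rfl⟩

theorem jck_der_isIsomorphic (hF : ringChar F ≠ 2) (hi : IsSquare (-1 : F))
    (δ : Derivation F Z Z) (hδ : Ideal.span (Set.range δ) = ⊤) :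
    (JCK δ).der.toSuperalgebra.IsIsomorphic
      ((KantorK δ).tits (KantorK_isJordan δ) ((KantorK δ).derBar (KantorK_isJordan δ))
        ((KantorK δ).inder_le_derBar _) ((KantorK δ).derBar_le_der _)) := by
  obtain ⟨ι, hι⟩ := hi
  have hJ := (JCK_isJordan δ).inderPart_le_derPart
  have h0 : ∀ f ∈ ((KantorK δ).derBar (KantorK_isJordan δ)).carrier,
      f ∈ (KantorK δ).endPart 0 → f ∈ (KantorK δ).derPart 0 := fun f hf hf0 => by
    simpa using Superalgebra.Sub.mem_ofParts _ _ _ _ hf hf0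
  have h1 : ∀ f ∈ ((KantorK δ).derBar (KantorK_isJordan δ)).carrier,
      f ∈ (KantorK δ).endPart 1 → f ∈ (KantorK δ).inderPart 1 := fun f hf hf1 => by
    simpa using Superalgebra.Sub.mem_ofParts _ _ _ _ hf hf1
  refine jck_isIsomorphic_tits hF hι δ _ _ _ _ (fun f hf hf0 => exists_eq_kantorEven (h0 f hf hf0))
    (fun f hf hf1 => exists_eq_kantorOdd (h1 f hf hf1))
    (fun m => Submodule.mem_sup_right (by simpa using kantorOdd_mem_inderPart hδ m)) ?_ ?_
  · refine fun D hD0 => ⟨fun hD => ?_, ?_⟩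
    · obtain ⟨p, d, h, hd, e⟩ := exists_eq_jckRot_add_jckExtEven hF
        (Superalgebra.Sub.mem_ofParts _ _ _ _ hD hD0)
      exact ⟨p, d, h, Submodule.mem_sup_left (by simpa using kantorEven_mem_derPart hd), e⟩
    · rintro ⟨p, d, h, hdh, rfl⟩
      obtain ⟨d', h', hd', e⟩ := exists_eq_kantorEven (h0 _ hdh (kantorEven_mem δ d h))
      -- The pair `(d, h)` is not known directly to satisfy `[d, δ] = 2hδ`; the extension depends
      -- only on the operator on `K`, so a pair that does satisfy it may be used instead.
      rw [← jckExt_kantorEven ι d h, e, jckExt_kantorEven]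
      exact Submodule.mem_sup_left
        (add_mem (hJ 0 (jckRot_mem_inderPart δ p)) (jckExtEven_mem_derPart hd'))
  · refine fun D hD1 => ⟨fun hD => exists_eq_jckOdd_add_jckExtOdd hδ
      (Superalgebra.Sub.mem_ofParts _ _ _ _ hD hD1), ?_⟩
    rintro ⟨q, m, rfl⟩
    exact Submodule.mem_sup_right
      (add_mem (hJ 1 (jckOdd_mem_inderPart δ q)) (hJ 1 (jckExtOdd_mem_inderPart hδ m)))

theorem jck_inder_isIsomorphic (hF : ringChar F ≠ 2) (hi : IsSquare (-1 : F))
    (δ : Derivation F Z Z) (hδ : Ideal.span (Set.range δ) = ⊤) :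
    ((JCK δ).inder (JCK_isJordan δ)).toSuperalgebra.IsIsomorphic
      ((KantorK δ).tits (KantorK_isJordan δ) ((KantorK δ).inder (KantorK_isJordan δ))
        le_rfl ((KantorK δ).inder_le_der _)) := by
  obtain ⟨ι, hι⟩ := hi
  have hJ := (JCK_isJordan δ).inderPart_le_derPart
  have hK := (KantorK_isJordan δ).inderPart_le_derPart
  have hm : ∀ i, ∀ f ∈ ((KantorK δ).inder (KantorK_isJordan δ)).carrier,
      f ∈ (KantorK δ).endPart i → f ∈ (KantorK δ).inderPart i := fun i f hf hfi =>
    Superalgebra.Sub.mem_ofParts _ _ _ _ hf hfi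
  refine jck_isIsomorphic_tits hF hι δ _ _ _ _
    (fun f hf hf0 => exists_eq_kantorEven (hK 0 (hm 0 f hf hf0)))
    (fun f hf hf1 => exists_eq_kantorOdd (hm 1 f hf hf1))
    (fun m => Submodule.mem_sup_right (kantorOdd_mem_inderPart hδ m)) ?_ ?_
  · refine fun D hD0 => ⟨fun hD => ?_, ?_⟩
    · have hDi : D ∈ (JCK δ).inderPart 0 := Superalgebra.Sub.mem_ofParts _ _ _ _ hD hD0
      obtain ⟨⟨p₁, p₂, p₃⟩, d, h, hd, e⟩ := exists_eq_jckRot_add_jckExtEven hF (hJ 0 hDi)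
      obtain ⟨k, hk⟩ := exists_mul_of_mem_jck_inderPart hDi
      -- The rotation vanishes on `Z`, so the multiple of `δ` found for `D` is `d` itself.
      have hk' : ∀ a, d a = k * δ a := fun a => by
        simpa [e, jckRot_apply, jckExtEven_apply] using hk a
      exact ⟨_, d, h, Submodule.mem_sup_left (kantorEven_mem_inderPart hF hδ hd hk'), e⟩
    · rintro ⟨p, d, h, hdh, rfl⟩
      have hdi := hm 0 _ hdh (kantorEven_mem δ d h)
      obtain ⟨k, hk⟩ := exists_mul_of_mem_kantor_inderPart hdi
      obtain ⟨d', h', hd', e⟩ := exists_eq_kantorEven (hK 0 hdi)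
      rw [e] at hk
      rw [← jckExt_kantorEven ι d h, e, jckExt_kantorEven]
      exact Submodule.mem_sup_left
        (add_mem (jckRot_mem_inderPart δ p) (jckExtEven_mem_inderPart hF hδ hd' hk))
  · refine fun D hD1 => ⟨fun hD => exists_eq_jckOdd_add_jckExtOdd hδ
      (hJ 1 (Superalgebra.Sub.mem_ofParts _ _ _ _ hD hD1)), ?_⟩
    rintro ⟨q, m, rfl⟩
    exact Submodule.mem_sup_right
      (add_mem (jckOdd_mem_inderPart δ q) (jckExtOdd_mem_inderPart hδ m))

end Isomorphism
end ChengKac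

theorem mainTheorem1 {F : Type*} {Z : Type*} [Field F] [CommRing Z] [Algebra F Z]
    (hF : ringChar F ≠ 2) (hi : IsSquare (-1 : F))
    (δ : Derivation F Z Z) (hδ : Ideal.span (Set.range δ) = ⊤) :
    ((JCK δ).der.toSuperalgebra.IsLie ∧
      ((KantorK δ).tits (KantorK_isJordan δ) ((KantorK δ).derBar (KantorK_isJordan δ))
        ((KantorK δ).inder_le_derBar _) ((KantorK δ).derBar_le_der _)).IsLie ∧
      (JCK δ).der.toSuperalgebra.IsIsomorphic
        ((KantorK δ).tits (KantorK_isJordan δ) ((KantorK δ).derBar (KantorK_isJordan δ))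
          ((KantorK δ).inder_le_derBar _) ((KantorK δ).derBar_le_der _))) ∧
    (((JCK δ).inder (JCK_isJordan δ)).toSuperalgebra.IsLie ∧
      ((KantorK δ).tits (KantorK_isJordan δ) ((KantorK δ).inder (KantorK_isJordan δ))
        le_rfl ((KantorK δ).inder_le_der _)).IsLie ∧
      ((JCK δ).inder (JCK_isJordan δ)).toSuperalgebra.IsIsomorphic
        ((KantorK δ).tits (KantorK_isJordan δ) ((KantorK δ).inder (KantorK_isJordan δ))
          le_rfl ((KantorK δ).inder_le_der _))) := by
  have h₁ := jck_der_isIsomorphic hF hi δ hδ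
  have h₂ := jck_inder_isIsomorphic hF hi δ hδ
  have l₁ := (JCK δ).der.isLie_toSuperalgebra
  have l₂ := ((JCK δ).inder (JCK_isJordan δ)).isLie_toSuperalgebra
  -- The Tits constructions are Lie superalgebras because they are isomorphic to subalgebras of
  -- `gl(J)`.
  exact ⟨⟨l₁, h₁.isLie l₁, h₁⟩, ⟨l₂, h₂.isLie l₂, h₂⟩⟩
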